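/- Let $P_u,P_v$ be probability measures on $\mathbb R$ with zero mean, unit variance and supports contained in $[-K_u,K_u]$ and $[-K_v,K_v]$ respectively. For integers $N,M\ge 1$ put $\rho=P_u^{\otimes N}\otimes P_v^{\otimes M}$, and for $\beta\ge 0$ let $\mathbb P_\beta$ be the law of the $N\times M$ random matrix $Y=\sqrt{\beta/N}\,u^*v^{*\top}+W$, where $(u^*,v^*)\sim\rho$ and $W$ is independent of $(u^*,v^*)$ with i.i.d. standard Gaussian entries. Let $L(\cdot;\beta)=\mathrm d\mathbb P_\beta/\mathrm d\mathbb P_0$ be the likelihood ratio. For $u\in\mathbb R^N$, $v\in\mathbb R^M$ set $$-H(u,v)=\sum_{i=1}^N\sum_{j=1}^M\Big(\sqrt{\tfrac{\beta}{N}}\,Y_{ij}u_iv_j-\tfrac{\beta}{2N}u_i^2v_j^2\Big),$$ and for a function $f$ of $n$ replicas $(u^{(l)},v^{(l)})_{l=1}^n$ let $$\langle f\rangle=\frac{\int f\prod_{l=1}^n e^{-H(u^{(l)},v^{(l)})}\,\mathrm d\rho(u^{(l)},v^{(l)})}{\big(\int e^{-H(u,v)}\,\mathrm d\rho(u,v)\big)^n}$$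 be its Gibbs average given $Y$. The overlaps of two replicas are $R^u_{12}=\frac1N\sum_{i=1}^N u^{(1)}_iu^{(2)}_i$ and $R^v_{12}=\frac1N\sum_{j=1}^M v^{(1)}_jv^{(2)}_j$. Proposition. Let $s\in\mathbb R$, $\alpha\ge 0$, and let $K_u,K_v,C$ be constants. There is a function $\beta\mapsto K(\beta)=K(s,\alpha,\beta,K_u,K_v,C)\in\mathbb R$ such that: (i) $K$ is bounded on $[0,\beta']$ for every $\beta'\ge 0$ with $\alpha\beta'^2K_u^4K_v^4<1$; (ii) for every $\beta\ge0$ with $\alpha\beta^2K_u^4K_v^4<1$, all $P_u,P_v$ as above, and all $N,M\ge 1$ with $|M-\alpha N|\le C\sqrt N$, $$\left|\,N\,\mathbb E\big[\langle R^u_{12}R^v_{12}\rangle\,e^{\mathrm i s\log L(Y;\beta)}\big]-\frac{\alpha\beta}{1-\alpha\beta^2}\,\mathbb E\big[e^{\mathrm i s\log L(Y;\beta)}\big]\right|\le\frac{K(\beta)}{\sqrt N},$$ where the expectations are over $Y\sim\mathbb P_\beta$. -/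

import Mathlib

open MeasureTheory ProbabilityTheory

noncomputable section

namespace SpikedModel

/-- An admissible prior: a probability measure on `ℝ` with zero mean, unit variance, and support
contained in `[-K, K]`. -/
structure IsPrior (P : Measure ℝ) (K : ℝ) : Prop where
  isProbabilityMeasure : IsProbabilityMeasure P
  mean_zero : ∫ x, x ∂P = 0
  unit_variance : ∫ x, x ^ 2 ∂P = 1
  bounded_support : ∀ᵐ x ∂P, |x| ≤ K

/-- A pair of vectors `(u, v) ∈ ℝ^N × ℝ^M`. -/
abbrev Config (N M : ℕ) : Type := (Fin N → ℝ) × (Fin M → ℝ)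

/-- The product prior `ρ = Pu^{⊗N} ⊗ Pv^{⊗M}` of the pair `(u, v)`. -/
def prior (Pu Pv : Measure ℝ) (N M : ℕ) : Measure (Config N M) :=
  (Measure.pi fun _ : Fin N => Pu).prod (Measure.pi fun _ : Fin M => Pv)

/-- The law of an `N × M` matrix `W` with i.i.d. standard Gaussian entries. -/
def noise (N M : ℕ) : Measure (Fin N → Fin M → ℝ) :=
  Measure.pi fun _ : Fin N => Measure.pi fun _ : Fin M => gaussianReal 0 1

/-- The law `P_β` of `Y = √(β/N) u vᵀ + W`, with `(u, v) ∼ ρ` and `W` Gaussian, independent. -/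
def spikedLaw (Pu Pv : Measure ℝ) (N M : ℕ) (β : ℝ) : Measure (Fin N → Fin M → ℝ) :=
  ((prior Pu Pv N M).prod (noise N M)).map
    fun p i j => √(β / N) * (p.1.1 i * p.1.2 j) + p.2 i j

/-- The likelihood ratio `L(·; β) = dP_β / dP_0`. -/
def likelihoodRatio (Pu Pv : Measure ℝ) (N M : ℕ) (β : ℝ) (Y : Fin N → Fin M → ℝ) : ℝ :=
  ((spikedLaw Pu Pv N M β).rnDeriv (spikedLaw Pu Pv N M 0) Y).toReal

/-- Minus the Hamiltonian,
`-H(u, v) = ∑_{i,j} (√(β/N) Y_{ij} u_i v_j - β/(2N) u_i² v_j²)`. -/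
def negHamiltonian {N M : ℕ} (β : ℝ) (Y : Fin N → Fin M → ℝ) (x : Config N M) : ℝ :=
  ∑ i, ∑ j, (√(β / N) * Y i j * x.1 i * x.2 j - β / (2 * N) * x.1 i ^ 2 * x.2 j ^ 2)

/-- The Gibbs average `⟨f⟩` of a function `f` of `n` replicas, given `Y`. -/
def gibbsAverage (Pu Pv : Measure ℝ) {N M n : ℕ} (β : ℝ) (Y : Fin N → Fin M → ℝ)
    (f : (Fin n → Config N M) → ℝ) : ℝ :=
  (∫ x, f x * ∏ l, Real.exp (negHamiltonian β Y (x l))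
      ∂(Measure.pi fun _ : Fin n => prior Pu Pv N M)) /
    (∫ x, Real.exp (negHamiltonian β Y x) ∂(prior Pu Pv N M)) ^ n

/-- The overlap `R^u = (1/N) ∑_{i ≤ N} u_i u'_i` of two configurations. -/
def overlapU {N M : ℕ} (x y : Config N M) : ℝ := (∑ i, x.1 i * y.1 i) / N

/-- The overlap `R^v = (1/N) ∑_{j ≤ M} v_j v'_j` of two configurations, also normalized by `N`. -/
def overlapV {N M : ℕ} (x y : Config N M) : ℝ := (∑ j, x.2 j * y.2 j) / N

/-- The random variable `e^{i s log L(Y; β)}`. -/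
def expLogLR (Pu Pv : Measure ℝ) (N M : ℕ) (β s : ℝ) (Y : Fin N → Fin M → ℝ) : ℂ :=
  Complex.exp (Complex.I * s * Real.log (likelihoodRatio Pu Pv N M β Y))

end SpikedModel

end

/-! Everything is transported to pure noise. By Cameron–Martin the likelihood ratio is L =
`partition`, the prior average of the tilts exp(⟨Y, T x⟩ - |T x|²/2). The expectation E[⟨Q⟩ e^{is
log L}] over two replicas becomes `obs`: the Gaussian integral of L⁻¹ L^{is} times the unnormalised
pair average of Q. As |L⁻¹ L^{is}| = L⁻¹, it is dominated by `nishimori`, the planted Gibbs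
expectation of |Q|.

The constant αβ/(1 - αβ²) solves a linear system produced by the cavity method. Put x = N E[⟨R^u
R^v⟩ L^{is}], y = N E[⟨(R^v)²⟩ L^{is}], a = E[L^{is}]. Isolating u_i, the product u_i u_i' may be
replaced by β R^v, so x ≈ β y (`norm_row_equation_le`). Isolating v_j, the product v_j v_j' may be
replaced by β R^u, while the diagonal terms (v_j v_j')²/N add up to (M/N) a, so y ≈ α a + αβ x
(`norm_col_equation_le`). Hence (1 - αβ²) x ≈ αβ a, with errors O(N^{-1/2}) (`norm_fullObs_sub_le`).

In one cavity step the signal is T + η τ with τ orthogonal to T, so the partition function L' of the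
reduced signal T does not change when the noise is shifted along τ. If the phase involved L' in
place of L, the Gaussian tilts of the new coordinate would integrate out exactly
(`integral_tilt_of_invariant`). What remains is the mean of Q exp(η η' S) over the new coordinates,
with S = ⟨τ, τ'⟩. For Q = (η η' - S) φ the first order cancels and φ S² = O(N^{-3/2}) is left.
Exchanging L for L' costs |L - L'| |n| / L'², where n is the pair integral of Q. Young's inequality
splits this into a chi-square distance and a four-replica integral, and both reduce to the smaller
system by the same tilt integration (`norm_obs_lift_le`).

All this needs overlaps of order N^{-1/2}. Planted averages are controlled by integrals against
exp(⟨T, T'⟩) under two independent priors (`nishimori_le_second_moment`), and ⟨T, T'⟩ = (β/N) (∑ u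
u') (∑ v v'). By Hoeffding the two sums are sub-Gaussian with variance proxies N K_u⁴ and M K_v⁴,
and Gaussian linearisation bounds the integral when β² (M/N) K_u⁴ K_v⁴ stays below 1
(`integral_pow_mul_exp_le`). This is where the threshold enters. -/

noncomputable section

namespace SpikedModel

set_option linter.unusedSectionVars false

/-! ### Frobenius product and Gaussian tilts -/

/-- The Frobenius inner product of two matrices. -/
def dot {N M : ℕ} (A B : Fin N → Fin M → ℝ) : ℝ := ∑ i, ∑ j, A i j * B i j

section Dot

variable {N M : ℕ} (A B C : Fin N → Fin M → ℝ)

theorem dot_comm : dot A B = dot B A := by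
  simp only [dot, mul_comm]

theorem dot_add_left : dot (A + B) C = dot A C + dot B C := by
  simp only [dot, Pi.add_apply, add_mul, Finset.sum_add_distrib]

theorem dot_add_right : dot A (B + C) = dot A B + dot A C := by
  simp only [dot, Pi.add_apply, mul_add, Finset.sum_add_distrib]

theorem dot_smul_left (c : ℝ) : dot (c • A) B = c * dot A B := by
  simp only [dot, Pi.smul_apply, smul_eq_mul, Finset.mul_sum, mul_assoc]

theorem dot_smul_right (c : ℝ) : dot A (c • B) = c * dot A B := by
  rw [dot_comm, dot_smul_left, dot_comm]

theorem dot_self_nonneg : 0 ≤ dot A A :=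
  Finset.sum_nonneg fun _ _ => Finset.sum_nonneg fun _ _ => mul_self_nonneg _

theorem two_mul_dot_le : 2 * dot A B ≤ dot A A + dot B B := by
  have h := dot_self_nonneg (A + (-1 : ℝ) • B)
  simp only [dot_add_left, dot_add_right, dot_smul_left, dot_smul_right] at h
  rw [dot_comm B A] at h
  linarith

theorem abs_dot_le {b : ℝ} (hA : dot A A ≤ b) (hB : dot B B ≤ b) : |dot A B| ≤ b := by
  have h1 := two_mul_dot_le A B
  have h2 := two_mul_dot_le ((-1 : ℝ) • A) B
  simp only [dot_smul_left, dot_smul_right] at h2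
  rw [abs_le]
  constructor <;> linarith

@[fun_prop]
theorem measurable_dot {Θ : Type*} [MeasurableSpace Θ] {f g : Θ → Fin N → Fin M → ℝ}
    (hf : Measurable f) (hg : Measurable g) : Measurable fun θ => dot (f θ) (g θ) := by
  unfold dot
  fun_prop

end Dot

/-- The density of the law of `W + t` with respect to that of the Gaussian matrix `W`. -/
def tilt {N M : ℕ} (Y t : Fin N → Fin M → ℝ) : ℝ := Real.exp (dot Y t - dot t t / 2)

section Tilt

variable {N M : ℕ} (Y s t : Fin N → Fin M → ℝ)

theorem tilt_pos : 0 < tilt Y t := Real.exp_pos _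

theorem tilt_le : tilt Y t ≤ Real.exp (dot Y Y / 2) :=
  Real.exp_le_exp.2 (by linarith [two_mul_dot_le Y t])

theorem tilt_add : tilt Y (s + t) = tilt Y s * tilt Y t * Real.exp (-dot s t) := by
  simp only [tilt, ← Real.exp_add, dot_add_left, dot_add_right]
  rw [dot_comm t s]
  ring_nf

theorem tilt_mul_tilt : tilt Y s * tilt Y t = tilt Y (s + t) * Real.exp (dot s t) := by
  rw [tilt_add, mul_assoc, ← Real.exp_add]
  simp

theorem tilt_add_of_dot_eq_zero (h : dot s t = 0) : tilt Y (s + t) = tilt Y s * tilt Y t := by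
  rw [tilt_mul_tilt, h]; simp

theorem tilt_shift_of_dot_eq_zero (h : dot s t = 0) : tilt (Y + s) t = tilt Y t := by
  simp only [tilt, dot_add_left, h, add_zero]

@[simp]
theorem tilt_zero : tilt Y 0 = 1 := by
  simp [tilt, dot]

@[fun_prop]
theorem measurable_tilt {Θ : Type*} [MeasurableSpace Θ] {f g : Θ → Fin N → Fin M → ℝ}
    (hf : Measurable f) (hg : Measurable g) : Measurable fun θ => tilt (f θ) (g θ) := by
  unfold tilt
  fun_prop

end Tilt

/-! ### The Cameron–Martin formula and invariant integrands -/

/-- The densities cut off to the sides of a box are independent under the product measure, so the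
mass of a box factorises, and boxes determine the measure. -/
theorem pi_withDensity_prod {ι : Type*} [Fintype ι] {α : ι → Type*} [∀ i, MeasurableSpace (α i)]
    (μ : ∀ i, Measure (α i)) [∀ i, IsProbabilityMeasure (μ i)] (f : ∀ i, α i → ENNReal)
    (hf : ∀ i, Measurable (f i)) [∀ i, SigmaFinite ((μ i).withDensity (f i))] :
    (Measure.pi μ).withDensity (fun x => ∏ i, f i (x i)) =
      Measure.pi fun i => (μ i).withDensity (f i) := by
  refine (Measure.pi_eq fun s hs => ?_).symm
  have hind : iIndepFun (fun i (x : ∀ i, α i) => (s i).indicator (f i) (x i)) (Measure.pi μ) :=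
    iIndepFun_pi (X := fun i => (s i).indicator (f i))
      fun i => ((hf i).indicator (hs i)).aemeasurable
  rw [withDensity_apply _ (MeasurableSet.univ_pi hs),
    ← lintegral_indicator (MeasurableSet.univ_pi hs)]
  have hfun : (Set.univ.pi s).indicator (fun x => ∏ i, f i (x i)) =
      fun x => ∏ i, (s i).indicator (f i) (x i) := by
    ext x
    by_cases hx : x ∈ Set.univ.pi s
    · rw [Set.indicator_of_mem hx]
      exact Finset.prod_congr rfl fun i _ => (Set.indicator_of_mem (hx i trivial) _).symm
    · rw [Set.indicator_of_notMem hx]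
      simp only [Set.mem_pi, Set.mem_univ, true_imp_iff, not_forall] at hx
      obtain ⟨i, hi⟩ := hx
      exact (Finset.prod_eq_zero (Finset.mem_univ i) (Set.indicator_of_notMem hi _)).symm
  rw [hfun, lintegral_prod_eq_prod_lintegral_of_indepFun _ _ hind
    fun i => ((hf i).indicator (hs i)).comp (measurable_pi_apply i)]
  refine Finset.prod_congr rfl fun i _ => ?_
  rw [withDensity_apply _ (hs i), ← lintegral_indicator (hs i)]
  exact (measurePreserving_eval μ i).lintegral_comp ((hf i).indicator (hs i))

theorem gaussianReal_withDensity_eq_map (t : ℝ) :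
    (gaussianReal 0 1).withDensity (fun y => ENNReal.ofReal (Real.exp (y * t - t * t / 2))) =
      (gaussianReal 0 1).map (· + t) := by
  rw [gaussianReal_map_add_const, gaussianReal_of_var_ne_zero _ one_ne_zero,
    gaussianReal_of_var_ne_zero _ one_ne_zero, ← withDensity_mul _ (by fun_prop) (by fun_prop)]
  congr 1
  ext y
  simp only [Pi.mul_apply, gaussianPDF, gaussianPDFReal]
  rw [← ENNReal.ofReal_mul (by positivity), mul_assoc, ← Real.exp_add]
  congr 3
  simp
  ring

instance isProbabilityMeasure_noise (N M : ℕ) : IsProbabilityMeasure (noise N M) := by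
  unfold noise; infer_instance

/-- The Cameron--Martin formula for a Gaussian matrix. -/
theorem noise_withDensity_tilt {N M : ℕ} (t : Fin N → Fin M → ℝ) :
    (noise N M).withDensity (fun Y => ENNReal.ofReal (tilt Y t)) = (noise N M).map (· + t) := by
  have hrow : ∀ i : Fin N, (Measure.pi fun _ : Fin M => gaussianReal 0 1).withDensity
      (fun y => ∏ j, ENNReal.ofReal (Real.exp (y j * t i j - t i j * t i j / 2))) =
      (Measure.pi fun _ : Fin M => gaussianReal 0 1).map (· + t i) := by
    intro i
    have : ∀ j, SigmaFinite ((gaussianReal 0 1).withDensity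
        fun y => ENNReal.ofReal (Real.exp (y * t i j - t i j * t i j / 2))) := fun j => by
      rw [gaussianReal_withDensity_eq_map]
      have := Measure.isProbabilityMeasure_map (μ := gaussianReal 0 1) (f := (· + t i j))
        (by fun_prop)
      infer_instance
    rw [pi_withDensity_prod (fun _ : Fin M => gaussianReal 0 1)
      (fun j y => ENNReal.ofReal (Real.exp (y * t i j - t i j * t i j / 2))) (by fun_prop)]
    simp only [gaussianReal_withDensity_eq_map]
    have := fun j => Measure.isProbabilityMeasure_map (μ := gaussianReal 0 1) (f := (· + t i j))
        (by fun_prop)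
    rw [← Measure.pi_map_pi (by fun_prop)]
    rfl
  have hprob : ∀ i : Fin N, IsProbabilityMeasure
      ((Measure.pi fun _ : Fin M => gaussianReal 0 1).map (· + t i)) :=
    fun i => Measure.isProbabilityMeasure_map (by fun_prop)
  have : ∀ i, SigmaFinite ((Measure.pi fun _ : Fin M => gaussianReal 0 1).withDensity
      (fun y => ∏ j, ENNReal.ofReal (Real.exp (y j * t i j - t i j * t i j / 2)))) := fun i => by
    rw [hrow]; infer_instance
  have h := pi_withDensity_prod (fun _ : Fin N => Measure.pi fun _ : Fin M => gaussianReal 0 1)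
      (fun i y => ∏ j, ENNReal.ofReal (Real.exp (y j * t i j - t i j * t i j / 2)))
      (by fun_prop)
  simp only [hrow] at h
  rw [← Measure.pi_map_pi (by fun_prop)] at h
  unfold noise
  refine Eq.trans ?_ (h.trans rfl)
  congr 1
  ext Y
  rw [tilt, dot, dot, Finset.sum_div, ← Finset.sum_sub_distrib, Real.exp_sum,
    ENNReal.ofReal_prod_of_nonneg fun _ _ => (Real.exp_pos _).le]
  refine Finset.prod_congr rfl fun i _ => ?_
  rw [Finset.sum_div, ← Finset.sum_sub_distrib, Real.exp_sum,
    ENNReal.ofReal_prod_of_nonneg fun _ _ => (Real.exp_pos _).le]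

/-- Cameron–Martin with a shift depending on a parameter, fibre by fibre through Tonelli. The
parameter will hold the replicas and their new coordinates. -/
theorem prod_withDensity_tilt {N M : ℕ} {Θ : Type*} [MeasurableSpace Θ] (ν : Measure Θ)
    [SFinite ν] {t : Θ → Fin N → Fin M → ℝ} (ht : Measurable t) :
    ((noise N M).prod ν).withDensity (fun p => ENNReal.ofReal (tilt p.1 (t p.2))) =
      ((noise N M).prod ν).map fun p => (p.1 + t p.2, p.2) := by
  refine Measure.ext_of_lintegral _ fun f hf => ?_
  rw [lintegral_withDensity_eq_lintegral_mul _ (by fun_prop) hf,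
    lintegral_map hf (by fun_prop), lintegral_prod_symm' _ (by fun_prop),
    lintegral_prod_symm' _ (by fun_prop)]
  refine lintegral_congr fun θ => ?_
  simp only [Pi.mul_apply]
  rw [← lintegral_map (f := fun Y => f (Y, θ)) (g := (· + t θ)) (by fun_prop) (by fun_prop),
    ← noise_withDensity_tilt, lintegral_withDensity_eq_lintegral_mul _ (by fun_prop) (by fun_prop)]
  rfl

section Shift

variable {N M : ℕ} {F : Type*} [NormedAddCommGroup F] [NormedSpace ℝ F] [CompleteSpace F]

theorem integrable_tilt_smul_iff {Θ : Type*} [MeasurableSpace Θ] (ν : Measure Θ) [SFinite ν]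
    {t : Θ → Fin N → Fin M → ℝ} (ht : Measurable t) {G : (Fin N → Fin M → ℝ) × Θ → F}
    (hG : StronglyMeasurable G) :
    Integrable (fun p => tilt p.1 (t p.2) • G p) ((noise N M).prod ν) ↔
      Integrable (fun p => G (p.1 + t p.2, p.2)) ((noise N M).prod ν) := by
  have h := integrable_withDensity_iff_integrable_smul' (μ := (noise N M).prod ν) (g := G)
    (f := fun p => ENNReal.ofReal (tilt p.1 (t p.2))) (by fun_prop) (by simp)
  rw [prod_withDensity_tilt ν ht,
    integrable_map_measure hG.aestronglyMeasurable (by fun_prop)] at h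
  simp only [ENNReal.toReal_ofReal (tilt_pos _ _).le] at h
  exact h.symm

theorem integral_tilt_smul {Θ : Type*} [MeasurableSpace Θ] (ν : Measure Θ) [SFinite ν]
    {t : Θ → Fin N → Fin M → ℝ} (ht : Measurable t) {G : (Fin N → Fin M → ℝ) × Θ → F}
    (hG : StronglyMeasurable G) :
    ∫ p, tilt p.1 (t p.2) • G p ∂(noise N M).prod ν =
      ∫ p, G (p.1 + t p.2, p.2) ∂(noise N M).prod ν := by
  have h := integral_withDensity_eq_integral_toReal_smul (μ := (noise N M).prod ν)
    (f := fun p => ENNReal.ofReal (tilt p.1 (t p.2))) (by fun_prop) (by simp) G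
  rw [prod_withDensity_tilt ν ht, integral_map (by fun_prop) hG.aestronglyMeasurable] at h
  simp only [ENNReal.toReal_ofReal (tilt_pos _ _).le] at h
  exact h.symm

/-- Integrating out a Gaussian tilt in directions along which the integrand is invariant. -/
theorem integral_tilt_of_invariant {A E : Type*} [MeasurableSpace A] [MeasurableSpace E]
    (α : Measure A) [SFinite α] (P : Measure E) [IsProbabilityMeasure P]
    {t : A → E → Fin N → Fin M → ℝ} (ht : Measurable (Function.uncurry t))
    {G : (Fin N → Fin M → ℝ) → A → F} (hG : StronglyMeasurable (Function.uncurry G))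
    (hinv : ∀ Y a e, G (Y + t a e) a = G Y a)
    (hint : Integrable (Function.uncurry G) ((noise N M).prod α))
    {B : A → E → ℝ} (hB : Measurable (Function.uncurry B)) {c : ℝ} (hc : ∀ a e, |B a e| ≤ c) :
    Integrable (fun Y => ∫ a, (∫ e, tilt Y (t a e) * B a e ∂P) • G Y a ∂α) (noise N M) ∧
      ∫ Y, ∫ a, (∫ e, tilt Y (t a e) * B a e ∂P) • G Y a ∂α ∂noise N M =
        ∫ Y, ∫ a, (∫ e, B a e ∂P) • G Y a ∂α ∂noise N M := by
  set G' : (Fin N → Fin M → ℝ) × (A × E) → F := fun p => B p.2.1 p.2.2 • G p.1 p.2.1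
  have hG' : StronglyMeasurable G' :=
    (hB.comp measurable_snd).stronglyMeasurable.smul
      (hG.comp_measurable (g := fun p : (Fin N → Fin M → ℝ) × (A × E) => (p.1, p.2.1))
        (by fun_prop))
  have hpres : MeasurePreserving (fun p : (Fin N → Fin M → ℝ) × (A × E) => (p.1, p.2.1))
      ((noise N M).prod (α.prod P)) ((noise N M).prod α) :=
    (MeasurePreserving.id _).prod measurePreserving_fst
  have hint' : Integrable G' ((noise N M).prod (α.prod P)) := by
    have h1 := hpres.integrable_comp_of_integrable hint
    exact h1.bdd_smul c (hB.comp measurable_snd).aestronglyMeasurable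
      (Filter.Eventually.of_forall fun p => hc _ _)
  -- The integrand does not feel the shift, so after Cameron–Martin nothing is left of the tilt.
  have hshift : (fun p : (Fin N → Fin M → ℝ) × (A × E) =>
      G' (p.1 + Function.uncurry t p.2, p.2)) = G' := by
    ext p
    simp only [G']
    rw [← hinv p.1 p.2.1 p.2.2]
    rfl
  have h1 := (integrable_tilt_smul_iff (α.prod P) ht hG').2 (by rw [hshift]; exact hint')
  have h2 := integral_tilt_smul (α.prod P) ht hG'
  rw [hshift, integral_prod _ h1, integral_prod _ hint'] at h2
  have e1 : ∀ᵐ Y ∂noise N M,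
      ∫ a, (∫ e, tilt Y (t a e) * B a e ∂P) • G Y a ∂α =
        ∫ θ, tilt Y (Function.uncurry t θ) • G' (Y, θ) ∂α.prod P := by
    filter_upwards [h1.prod_right_ae] with Y hY
    rw [integral_prod _ hY]
    refine integral_congr_ae (Filter.Eventually.of_forall fun a => ?_)
    simp only [G', Function.uncurry, smul_smul]
    rw [integral_smul_const]
  have e2 : ∀ᵐ Y ∂noise N M, ∫ a, (∫ e, B a e ∂P) • G Y a ∂α = ∫ θ, G' (Y, θ) ∂α.prod P := by
    filter_upwards [hint'.prod_right_ae] with Y hY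
    rw [integral_prod _ hY]
    refine integral_congr_ae (Filter.Eventually.of_forall fun a => ?_)
    simp only [G']
    rw [integral_smul_const]
  refine ⟨(integrable_congr e1).2 h1.integral_prod_left, ?_⟩
  rw [integral_congr_ae e1, integral_congr_ae e2]
  exact h2

end Shift

theorem integrable_of_abs_le {A : Type*} [MeasurableSpace A] {α : Measure A} [IsFiniteMeasure α]
    {f : A → ℝ} (hf : Measurable f) {c : ℝ} (hc : ∀ a, |f a| ≤ c) : Integrable f α :=
  Integrable.of_bound hf.aestronglyMeasurable c (Filter.Eventually.of_forall hc)

/-! ### Size and Lipschitz bounds for the phase factor -/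

/-- The function `l ↦ l⁻¹ l^{is}`. -/
def phaseFun (s l : ℝ) : ℂ := (l : ℂ)⁻¹ * Complex.exp (Complex.I * s * Real.log l)

section Phase

theorem norm_exp_phase (s r : ℝ) : ‖Complex.exp (Complex.I * s * r)‖ = 1 := by
  rw [show Complex.I * (s : ℂ) * r = ((s * r : ℝ) : ℂ) * Complex.I by push_cast; ring]
  exact Complex.norm_exp_ofReal_mul_I _

theorem norm_phaseFun {s l : ℝ} (hl : 0 < l) : ‖phaseFun s l‖ = l⁻¹ := by
  rw [phaseFun, norm_mul, norm_exp_phase, mul_one, norm_inv, Complex.norm_real,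
    Real.norm_of_nonneg hl.le]

@[fun_prop]
theorem measurable_phaseFun {Θ : Type*} [MeasurableSpace Θ] (s : ℝ) {f : Θ → ℝ}
    (hf : Measurable f) : Measurable fun θ => phaseFun s (f θ) := by
  unfold phaseFun
  fun_prop

theorem norm_exp_phase_sub_le (s r r' : ℝ) :
    ‖Complex.exp (Complex.I * s * r) - Complex.exp (Complex.I * s * r')‖ ≤ |s| * |r - r'| := by
  have h : Complex.exp (Complex.I * s * r) - Complex.exp (Complex.I * s * r') =
      Complex.exp (Complex.I * s * r') *
        (Complex.exp (Complex.I * ((s * (r - r') : ℝ) : ℂ)) - 1) := by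
    rw [mul_sub, ← Complex.exp_add]
    push_cast
    ring_nf
  rw [h, norm_mul, norm_exp_phase, one_mul, ← abs_mul]
  exact Real.norm_exp_I_mul_ofReal_sub_one_le

theorem abs_log_sub_log_le {κ l l' : ℝ} (hκ : 0 < κ) (hκ1 : κ ≤ 1) (hl' : 0 < l')
    (h : κ * l' ≤ l) : |Real.log l - Real.log l'| ≤ |l - l'| / (κ * l') := by
  have hκl : 0 < κ * l' := mul_pos hκ hl'
  have hl : 0 < l := hκl.trans_le h
  rw [abs_le']
  constructor
  · rw [← Real.log_div hl.ne' hl'.ne']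
    calc Real.log (l / l') ≤ l / l' - 1 := Real.log_le_sub_one_of_pos (div_pos hl hl')
      _ = (l - l') / l' := by field_simp
      _ ≤ |l - l'| / l' := by gcongr; exact le_abs_self _
      _ ≤ |l - l'| / (κ * l') := by gcongr; nlinarith
  · rw [neg_sub, ← Real.log_div hl'.ne' hl.ne']
    calc Real.log (l' / l) ≤ l' / l - 1 := Real.log_le_sub_one_of_pos (div_pos hl' hl)
      _ = (l' - l) / l := by field_simp
      _ ≤ |l - l'| / l := by gcongr; rw [abs_sub_comm]; exact le_abs_self _
      _ ≤ |l - l'| / (κ * l') := by gcongr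

/-- The modulus 1/l and the phase log l are both Lipschitz away from zero. The lower bound on l
turns every denominator into a power of l', so that only the reduced partition function remains
below the fraction bar. -/
theorem norm_phaseFun_sub_le (s : ℝ) {κ l l' : ℝ} (hκ : 0 < κ) (hκ1 : κ ≤ 1) (hl' : 0 < l')
    (h : κ * l' ≤ l) :
    ‖phaseFun s l - phaseFun s l'‖ ≤ (1 + |s|) / κ * (|l - l'| / l' ^ 2) := by
  have hκl : 0 < κ * l' := mul_pos hκ hl'
  have hl : 0 < l := hκl.trans_le h
  have hdecomp : phaseFun s l - phaseFun s l' =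
      ((l⁻¹ - l'⁻¹ : ℝ) : ℂ) * Complex.exp (Complex.I * s * Real.log l) +
      ((l'⁻¹ : ℝ) : ℂ) * (Complex.exp (Complex.I * s * Real.log l) -
        Complex.exp (Complex.I * s * Real.log l')) := by
    simp only [phaseFun]
    push_cast
    ring
  have h1 : |l⁻¹ - l'⁻¹| ≤ |l - l'| / (κ * l' ^ 2) := by
    rw [inv_sub_inv hl.ne' hl'.ne', abs_div, abs_sub_comm, abs_of_pos (mul_pos hl hl')]
    exact div_le_div_of_nonneg_left (abs_nonneg _) (by positivity) (by nlinarith)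
  calc ‖phaseFun s l - phaseFun s l'‖
      ≤ |l⁻¹ - l'⁻¹| * 1 + l'⁻¹ * (|s| * |Real.log l - Real.log l'|) := by
        rw [hdecomp]
        refine (norm_add_le _ _).trans (add_le_add ?_ ?_)
        · rw [norm_mul, norm_exp_phase, Complex.norm_real, Real.norm_eq_abs]
        · rw [norm_mul, Complex.norm_real, Real.norm_eq_abs, abs_of_pos (inv_pos.2 hl')]
          gcongr
          exact norm_exp_phase_sub_le _ _ _
    _ ≤ |l - l'| / (κ * l' ^ 2) * 1 + l'⁻¹ * (|s| * (|l - l'| / (κ * l'))) := by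
        gcongr
        exact abs_log_sub_log_le hκ hκ1 hl' h
    _ = (1 + |s|) / κ * (|l - l'| / l' ^ 2) := by
        field_simp

end Phase

/-! ### Partition functions and planted two-replica averages -/

section Gibbs

variable {N M : ℕ} {X : Type*} [MeasurableSpace X] (ρ : Measure X)
  (T : X → Fin N → Fin M → ℝ)

/-- The partition function of a Gaussian channel with signal `T x`, `x ∼ ρ`. -/
def partition (Y : Fin N → Fin M → ℝ) : ℝ := ∫ x, tilt Y (T x) ∂ρ

/-- The joint weight of two replicas. -/
def pairWeight (Y : Fin N → Fin M → ℝ) (p : X × X) : ℝ := tilt Y (T p.1) * tilt Y (T p.2)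

/-- The unnormalized Gibbs average of a function of two replicas. -/
def pairInt (Y : Fin N → Fin M → ℝ) (F : X × X → ℝ) : ℝ :=
  ∫ p, pairWeight T Y p * F p ∂ρ.prod ρ

/-- The expectation `E⟨F⟩` of a Gibbs average over the planted law of the disorder. -/
def nishimori (F : X × X → ℝ) : ℝ :=
  ∫ Y, (partition ρ T Y)⁻¹ * pairInt ρ T Y F ∂noise N M

/-- The expectation `E[⟨Q⟩ e^{is log L}]` over the planted law of the disorder. -/
def obs (s : ℝ) (Q : X × X → ℝ) : ℂ :=
  ∫ Y, phaseFun s (partition ρ T Y) * (pairInt ρ T Y Q : ℂ) ∂noise N M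

theorem pairWeight_pos (Y : Fin N → Fin M → ℝ) (p : X × X) : 0 < pairWeight T Y p :=
  mul_pos (tilt_pos _ _) (tilt_pos _ _)

theorem pairWeight_le (Y : Fin N → Fin M → ℝ) (p : X × X) :
    pairWeight T Y p ≤ Real.exp (dot Y Y) := by
  calc pairWeight T Y p ≤ Real.exp (dot Y Y / 2) * Real.exp (dot Y Y / 2) :=
        mul_le_mul (tilt_le _ _) (tilt_le _ _) (tilt_pos _ _).le (Real.exp_pos _).le
    _ = Real.exp (dot Y Y) := by rw [← Real.exp_add]; ring_nf

variable {T}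

@[fun_prop]
theorem measurable_pairWeight (hT : Measurable T) {Θ : Type*} [MeasurableSpace Θ]
    {f : Θ → Fin N → Fin M → ℝ} {g : Θ → X × X} (hf : Measurable f) (hg : Measurable g) :
    Measurable fun θ => pairWeight T (f θ) (g θ) := by
  unfold pairWeight
  fun_prop

variable [IsProbabilityMeasure ρ]

theorem integrable_tilt (hT : Measurable T) (Y : Fin N → Fin M → ℝ) :
    Integrable (fun x => tilt Y (T x)) ρ :=
  integrable_of_abs_le (by fun_prop) fun x =>
    (abs_of_pos (tilt_pos _ _)).trans_le (tilt_le Y (T x))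

theorem partition_pos (hT : Measurable T) (Y : Fin N → Fin M → ℝ) : 0 < partition ρ T Y :=
  (integral_pos_iff_support_of_nonneg (fun _ => (tilt_pos _ _).le) (integrable_tilt ρ hT Y)).2 <| by
    rw [Function.support_eq_univ fun x => (tilt_pos _ _).ne']
    simp

@[fun_prop]
theorem measurable_partition (hT : Measurable T) : Measurable (partition ρ T) := by
  have : StronglyMeasurable (Function.uncurry fun (Y : Fin N → Fin M → ℝ) x => tilt Y (T x)) := by
    apply Measurable.stronglyMeasurable
    unfold Function.uncurry
    fun_prop
  exact this.integral_prod_right.measurable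

theorem measurable_pairInt (hT : Measurable T) {F : X × X → ℝ} (hF : Measurable F) :
    Measurable fun Y => pairInt ρ T Y F := by
  have : StronglyMeasurable (Function.uncurry fun (Y : Fin N → Fin M → ℝ) p =>
      pairWeight T Y p * F p) := by
    apply Measurable.stronglyMeasurable
    unfold Function.uncurry
    fun_prop
  exact this.integral_prod_right.measurable

theorem integrable_partition (hT : Measurable T) : Integrable (partition ρ T) (noise N M) := by
  have h := (integrable_tilt_smul_iff (F := ℝ) ρ hT (G := fun _ => 1)
    stronglyMeasurable_const).2 (integrable_const _)
  have h' := h.integral_prod_left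
  simp only [smul_eq_mul, mul_one] at h'
  exact h'

theorem integral_partition (hT : Measurable T) : ∫ Y, partition ρ T Y ∂noise N M = 1 := by
  have h := (integrable_tilt_smul_iff (F := ℝ) ρ hT (G := fun _ => 1)
    stronglyMeasurable_const).2 (integrable_const _)
  have h2 := integral_tilt_smul (F := ℝ) ρ hT (G := fun _ => 1) stronglyMeasurable_const
  rw [integral_prod _ h] at h2
  simpa [partition] using h2

theorem integrable_pairWeight_mul (hT : Measurable T) (Y : Fin N → Fin M → ℝ) {F : X × X → ℝ}
    (hF : Measurable F) {c : ℝ} (hc : ∀ p, |F p| ≤ c) :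
    Integrable (fun p => pairWeight T Y p * F p) (ρ.prod ρ) :=
  integrable_of_abs_le (c := Real.exp (dot Y Y) * c) (by fun_prop) fun p => by
    rw [abs_mul, abs_of_pos (pairWeight_pos _ _ _)]
    exact mul_le_mul (pairWeight_le _ _ _) (hc p) (abs_nonneg _) (Real.exp_pos _).le

theorem pairInt_const (Y : Fin N → Fin M → ℝ) (c : ℝ) :
    pairInt ρ T Y (fun _ => c) = partition ρ T Y ^ 2 * c := by
  simp only [pairInt, pairWeight, partition]
  rw [integral_mul_const, integral_prod_mul (fun x => tilt Y (T x)) (fun x => tilt Y (T x)), sq]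

theorem pairInt_mono (hT : Measurable T) (Y : Fin N → Fin M → ℝ) {F G : X × X → ℝ}
    (hF : Measurable F) {c : ℝ} (hc : ∀ p, |F p| ≤ c) (hG : Measurable G) {c' : ℝ}
    (hc' : ∀ p, |G p| ≤ c') (h : ∀ p, F p ≤ G p) : pairInt ρ T Y F ≤ pairInt ρ T Y G :=
  integral_mono (integrable_pairWeight_mul ρ hT Y hF hc) (integrable_pairWeight_mul ρ hT Y hG hc')
    fun p => mul_le_mul_of_nonneg_left (h p) (pairWeight_pos _ _ _).le

theorem pairInt_nonneg (Y : Fin N → Fin M → ℝ) {F : X × X → ℝ} (h : ∀ p, 0 ≤ F p) :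
    0 ≤ pairInt ρ T Y F :=
  integral_nonneg fun p => mul_nonneg (pairWeight_pos _ _ _).le (h p)

theorem abs_pairInt_le (Y : Fin N → Fin M → ℝ) (F : X × X → ℝ) :
    |pairInt ρ T Y F| ≤ pairInt ρ T Y fun p => |F p| := by
  refine (abs_integral_le_integral_abs).trans_eq (integral_congr_ae ?_)
  filter_upwards with p
  rw [abs_mul, abs_of_pos (pairWeight_pos _ _ _)]

theorem abs_pairInt_le_const (hT : Measurable T) (Y : Fin N → Fin M → ℝ) {F : X × X → ℝ}
    (hF : Measurable F) {c : ℝ} (hc : ∀ p, |F p| ≤ c) :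
    |pairInt ρ T Y F| ≤ partition ρ T Y ^ 2 * c := by
  rw [← pairInt_const]
  exact (abs_pairInt_le ρ Y F).trans (pairInt_mono ρ hT Y (by fun_prop) (c := c)
    (by simpa using hc) measurable_const (c' := |c|) (by simp) hc)

theorem pairInt_add (hT : Measurable T) (Y : Fin N → Fin M → ℝ) {F G : X × X → ℝ}
    (hF : Measurable F) {c : ℝ} (hc : ∀ p, |F p| ≤ c) (hG : Measurable G) {c' : ℝ}
    (hc' : ∀ p, |G p| ≤ c') :
    pairInt ρ T Y (fun p => F p + G p) = pairInt ρ T Y F + pairInt ρ T Y G := by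
  simp only [pairInt, mul_add]
  exact integral_add (integrable_pairWeight_mul ρ hT Y hF hc)
    (integrable_pairWeight_mul ρ hT Y hG hc')

theorem pairInt_const_mul (Y : Fin N → Fin M → ℝ) (c : ℝ) (F : X × X → ℝ) :
    pairInt ρ T Y (fun p => c * F p) = c * pairInt ρ T Y F := by
  simp only [pairInt, mul_left_comm _ c]
  exact integral_const_mul _ _

theorem integrable_nishimori (hT : Measurable T) {F : X × X → ℝ}
    (hF : Measurable F) {c : ℝ} (hc : ∀ p, |F p| ≤ c) :
    Integrable (fun Y => (partition ρ T Y)⁻¹ * pairInt ρ T Y F) (noise N M) := by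
  refine ((integrable_partition ρ hT).mul_const c).mono'
    (((measurable_partition ρ hT).inv.mul (measurable_pairInt ρ hT hF)).aestronglyMeasurable)
    (Filter.Eventually.of_forall fun Y => ?_)
  have hL := partition_pos ρ hT Y
  rw [Real.norm_eq_abs, abs_mul, abs_of_pos (inv_pos.2 hL)]
  calc (partition ρ T Y)⁻¹ * |pairInt ρ T Y F|
      ≤ (partition ρ T Y)⁻¹ * (partition ρ T Y ^ 2 * c) := by
        gcongr
        exact abs_pairInt_le_const ρ hT Y hF hc
    _ = partition ρ T Y * c := by field_simp

theorem nishimori_mono (hT : Measurable T) {F G : X × X → ℝ}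
    (hF : Measurable F) {c : ℝ} (hc : ∀ p, |F p| ≤ c) (hG : Measurable G) {c' : ℝ}
    (hc' : ∀ p, |G p| ≤ c') (h : ∀ p, F p ≤ G p) : nishimori ρ T F ≤ nishimori ρ T G :=
  integral_mono (integrable_nishimori ρ hT hF hc) (integrable_nishimori ρ hT hG hc') fun Y =>
    mul_le_mul_of_nonneg_left (pairInt_mono ρ hT Y hF hc hG hc' h)
      (inv_nonneg.2 (partition_pos ρ hT Y).le)

theorem nishimori_add (hT : Measurable T) {F G : X × X → ℝ}
    (hF : Measurable F) {c : ℝ} (hc : ∀ p, |F p| ≤ c) (hG : Measurable G) {c' : ℝ}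
    (hc' : ∀ p, |G p| ≤ c') :
    nishimori ρ T (fun p => F p + G p) = nishimori ρ T F + nishimori ρ T G := by
  simp only [nishimori, pairInt_add ρ hT _ hF hc hG hc', mul_add]
  exact integral_add (integrable_nishimori ρ hT hF hc) (integrable_nishimori ρ hT hG hc')

theorem nishimori_const_mul (c : ℝ) (F : X × X → ℝ) :
    nishimori ρ T (fun p => c * F p) = c * nishimori ρ T F := by
  simp only [nishimori, pairInt_const_mul, mul_left_comm _ c]
  exact integral_const_mul _ _

theorem nishimori_const (hT : Measurable T) (c : ℝ) : nishimori ρ T (fun _ => c) = c := by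
  have : ∀ Y, (partition ρ T Y)⁻¹ * (partition ρ T Y ^ 2 * c) = partition ρ T Y * c := fun Y => by
    have := partition_pos ρ hT Y
    field_simp
  simp only [nishimori, pairInt_const, this]
  rw [integral_mul_const, integral_partition ρ hT, one_mul]

theorem integrable_obs (hT : Measurable T) (s : ℝ) {F : X × X → ℝ}
    (hF : Measurable F) {c : ℝ} (hc : ∀ p, |F p| ≤ c) :
    Integrable (fun Y => phaseFun s (partition ρ T Y) * (pairInt ρ T Y F : ℂ)) (noise N M) := by
  refine (integrable_nishimori ρ hT hF hc).mono
    (((measurable_phaseFun s (measurable_partition ρ hT)).mul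
      (Complex.measurable_ofReal.comp (measurable_pairInt ρ hT hF))).aestronglyMeasurable)
    (Filter.Eventually.of_forall fun Y => ?_)
  rw [norm_mul, norm_phaseFun (partition_pos ρ hT Y), norm_mul, norm_inv, Complex.norm_real,
    Real.norm_of_nonneg (partition_pos ρ hT Y).le]

theorem obs_add (hT : Measurable T) (s : ℝ) {F G : X × X → ℝ}
    (hF : Measurable F) {c : ℝ} (hc : ∀ p, |F p| ≤ c) (hG : Measurable G) {c' : ℝ}
    (hc' : ∀ p, |G p| ≤ c') :
    obs ρ T s (fun p => F p + G p) = obs ρ T s F + obs ρ T s G := by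
  simp only [obs, pairInt_add ρ hT _ hF hc hG hc', Complex.ofReal_add, mul_add]
  exact integral_add (integrable_obs ρ hT s hF hc) (integrable_obs ρ hT s hG hc')

theorem obs_const_mul (s c : ℝ) (F : X × X → ℝ) :
    obs ρ T s (fun p => c * F p) = c * obs ρ T s F := by
  simp only [obs, pairInt_const_mul, Complex.ofReal_mul, mul_left_comm _ (c : ℂ)]
  exact integral_const_mul _ _

/-- The oscillating factor has modulus one, so the weight of the observable is exactly the planted
weight 1/L. -/
theorem norm_obs_le (hT : Measurable T) (s : ℝ) {F : X × X → ℝ} (hF : Measurable F) {c : ℝ}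
    (hc : ∀ p, |F p| ≤ c) : ‖obs ρ T s F‖ ≤ nishimori ρ T fun p => |F p| := by
  refine (norm_integral_le_integral_norm _).trans (integral_mono (integrable_obs ρ hT s hF hc).norm
    (integrable_nishimori ρ hT (c := c) (by fun_prop) (by simpa using hc)) fun Y => ?_)
  simp only [norm_mul, norm_phaseFun (partition_pos ρ hT Y), Complex.norm_real, Real.norm_eq_abs]
  exact mul_le_mul_of_nonneg_left (abs_pairInt_le ρ Y F) (inv_nonneg.2 (partition_pos ρ hT Y).le)

end Gibbs

/-! ### Exchangeability of four replicas -/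

section Rearrange

theorem integral_comp_measurePreserving {A B F : Type*} [MeasurableSpace A] [MeasurableSpace B]
    [NormedAddCommGroup F] [NormedSpace ℝ F] {μ : Measure A} {ν : Measure B} {f : A → B}
    (hf : MeasurePreserving f μ ν) {g : B → F} (hg : StronglyMeasurable g) :
    ∫ a, g (f a) ∂μ = ∫ b, g b ∂ν := by
  rw [← hf.map_eq, integral_map hf.measurable.aemeasurable hg.aestronglyMeasurable]

theorem measurePreserving_prodProdProdComm {A B C D : Type*} [MeasurableSpace A]
    [MeasurableSpace B] [MeasurableSpace C] [MeasurableSpace D] (α : Measure A) (β : Measure B)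
    (γ : Measure C) (δ : Measure D) [SFinite α] [SFinite β] [SFinite γ] [SFinite δ] :
    MeasurePreserving (fun q : (A × B) × (C × D) => ((q.1.1, q.2.1), (q.1.2, q.2.2)))
      ((α.prod β).prod (γ.prod δ)) ((α.prod γ).prod (β.prod δ)) := by
  refine ⟨by fun_prop, Measure.ext_of_lintegral _ fun f hf => ?_⟩
  rw [lintegral_map hf (by fun_prop), lintegral_prod _ (by fun_prop),
    lintegral_prod _ (by fun_prop), lintegral_prod _ (by fun_prop), lintegral_prod _ (by fun_prop)]
  refine lintegral_congr fun a => ?_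
  have h1 : ∀ b, ∫⁻ z : C × D, f ((a, z.1), (b, z.2)) ∂γ.prod δ =
      ∫⁻ c, ∫⁻ d, f ((a, c), (b, d)) ∂δ ∂γ := fun b => lintegral_prod _ (by fun_prop)
  have h2 : ∀ c, ∫⁻ z : B × D, f ((a, c), z) ∂β.prod δ =
      ∫⁻ b, ∫⁻ d, f ((a, c), (b, d)) ∂δ ∂β := fun c => lintegral_prod _ (by fun_prop)
  simp only [h1, h2]
  exact lintegral_lintegral_swap (by fun_prop)

end Rearrange

/-- The sum of a function of two replicas over the six pairs among four replicas. -/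
def sumPairs {X : Type*} (F : X × X → ℝ) (q : (X × X) × (X × X)) : ℝ :=
  F q.1 + F q.2 + F (q.1.1, q.2.1) + F (q.1.1, q.2.2) + F (q.1.2, q.2.1) + F (q.1.2, q.2.2)

section FourReplicas

variable {N M : ℕ} {X : Type*} [MeasurableSpace X] (ρ : Measure X) [IsProbabilityMeasure ρ]
  {T : X → Fin N → Fin M → ℝ}

theorem integral_pairWeight_fst (Y : Fin N → Fin M → ℝ) (F : X × X → ℝ) :
    ∫ q, pairWeight T Y q.1 * pairWeight T Y q.2 * F q.1 ∂(ρ.prod ρ).prod (ρ.prod ρ) =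
      partition ρ T Y ^ 2 * pairInt ρ T Y F := by
  have h := integral_prod_mul (μ := ρ.prod ρ) (ν := ρ.prod ρ)
    (fun p => pairWeight T Y p * F p) (fun p => pairWeight T Y p * 1)
  have h1 : ∫ p, pairWeight T Y p * 1 ∂ρ.prod ρ = partition ρ T Y ^ 2 * 1 := pairInt_const ρ Y 1
  rw [h1, mul_one] at h
  rw [pairInt, mul_comm (partition ρ T Y ^ 2), ← h]
  congr 1
  ext q
  ring

theorem integral_pairWeight_snd (Y : Fin N → Fin M → ℝ) (F : X × X → ℝ) :
    ∫ q, pairWeight T Y q.1 * pairWeight T Y q.2 * F q.2 ∂(ρ.prod ρ).prod (ρ.prod ρ) =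
      partition ρ T Y ^ 2 * pairInt ρ T Y F := by
  rw [← integral_pairWeight_fst, ← integral_prod_swap]
  simp only [Prod.fst_swap, Prod.snd_swap, mul_comm (pairWeight T Y _) (pairWeight T Y _)]

/-- The product of four weights is symmetric under exchange of the second and third replica, which
turns the pair (1,3) into (1,2). -/
theorem integral_pairWeight_cross (hT : Measurable T) (Y : Fin N → Fin M → ℝ) {F : X × X → ℝ}
    (hF : Measurable F) :
    ∫ q, pairWeight T Y q.1 * pairWeight T Y q.2 * F (q.1.1, q.2.1)
      ∂(ρ.prod ρ).prod (ρ.prod ρ) = partition ρ T Y ^ 2 * pairInt ρ T Y F := by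
  rw [← integral_pairWeight_fst, ← integral_comp_measurePreserving
    (measurePreserving_prodProdProdComm ρ ρ ρ ρ) (by
      apply Measurable.stronglyMeasurable
      fun_prop)]
  congr 1
  ext q
  simp only [pairWeight]
  ring

theorem integral_pairWeight_sumPairs (hT : Measurable T) (Y : Fin N → Fin M → ℝ)
    {F : X × X → ℝ} (hF : Measurable F) {c : ℝ} (hc : ∀ p, |F p| ≤ c) :
    Integrable (fun q => pairWeight T Y q.1 * pairWeight T Y q.2 * sumPairs F q)
      ((ρ.prod ρ).prod (ρ.prod ρ)) ∧
    ∫ q, pairWeight T Y q.1 * pairWeight T Y q.2 * sumPairs F q ∂(ρ.prod ρ).prod (ρ.prod ρ) =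
      6 * (partition ρ T Y ^ 2 * pairInt ρ T Y F) := by
  have hint : ∀ f : (X × X) × (X × X) → X × X, Measurable f →
      Integrable (fun q => pairWeight T Y q.1 * pairWeight T Y q.2 * F (f q))
        ((ρ.prod ρ).prod (ρ.prod ρ)) := fun f hf =>
    integrable_of_abs_le (c := Real.exp (dot Y Y) * Real.exp (dot Y Y) * c) (by fun_prop)
      fun q => by
        have h1 := pairWeight_pos T Y q.1
        have h2 := pairWeight_pos T Y q.2
        rw [abs_mul, abs_of_pos (mul_pos h1 h2)]
        exact mul_le_mul (mul_le_mul (pairWeight_le _ _ _) (pairWeight_le _ _ _) h2.le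
          (Real.exp_pos _).le) (hc _) (abs_nonneg _) (by positivity)
  have hswap : MeasurePreserving (Prod.swap : X × X → X × X) (ρ.prod ρ) (ρ.prod ρ) :=
    Measure.measurePreserving_swap
  have hpw : ∀ a b : X, pairWeight T Y (b, a) = pairWeight T Y (a, b) := fun a b => mul_comm _ _
  -- The other mixed pairs arise from (1,3) by swapping replicas inside one or both of the two
  -- pairs, which leaves both pair weights unchanged.
  have cross : ∀ f : (X × X) × (X × X) → (X × X) × (X × X),
      MeasurePreserving f ((ρ.prod ρ).prod (ρ.prod ρ)) ((ρ.prod ρ).prod (ρ.prod ρ)) →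
      (∀ q, pairWeight T Y (f q).1 = pairWeight T Y q.1) →
      (∀ q, pairWeight T Y (f q).2 = pairWeight T Y q.2) →
      ∫ q, pairWeight T Y q.1 * pairWeight T Y q.2 * F ((f q).1.1, (f q).2.1)
        ∂(ρ.prod ρ).prod (ρ.prod ρ) = partition ρ T Y ^ 2 * pairInt ρ T Y F := by
    intro f hf h1 h2
    have h := integral_comp_measurePreserving hf
      (g := fun q => pairWeight T Y q.1 * pairWeight T Y q.2 * F (q.1.1, q.2.1)) (by
        apply Measurable.stronglyMeasurable
        fun_prop)
    simp only [h1, h2] at h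
    rw [h, integral_pairWeight_cross ρ hT Y hF]
  have h13 := integral_pairWeight_cross ρ hT Y hF
  have h14 := cross _ ((MeasurePreserving.id _).prod hswap) (fun _ => rfl) (fun _ => hpw _ _)
  have h23 := cross _ (hswap.prod (MeasurePreserving.id _)) (fun _ => hpw _ _) (fun _ => rfl)
  have h24 := cross _ (hswap.prod hswap) (fun _ => hpw _ _) (fun _ => hpw _ _)
  have i1 := hint (fun q => q.1) (by fun_prop)
  have i2 := hint (fun q => q.2) (by fun_prop)
  have i13 := hint (fun q => (q.1.1, q.2.1)) (by fun_prop)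
  have i14 := hint (fun q => (q.1.1, q.2.2)) (by fun_prop)
  have i23 := hint (fun q => (q.1.2, q.2.1)) (by fun_prop)
  have i24 := hint (fun q => (q.1.2, q.2.2)) (by fun_prop)
  simp only [sumPairs, mul_add]
  refine ⟨((((i1.add i2).add i13).add i14).add i23).add i24, ?_⟩
  refine (integral_add' ((((i1.add i2).add i13).add i14).add i23) i24).trans ?_
  rw [integral_add' (((i1.add i2).add i13).add i14) i23,
    integral_add' ((i1.add i2).add i13) i14, integral_add' (i1.add i2) i13,
    integral_add' i1 i2, integral_pairWeight_fst, integral_pairWeight_snd]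
  simp only [Prod.map_fst, Prod.map_snd, Prod.fst_swap, id] at h14 h23 h24
  rw [h13, h14, h23, h24]
  ring

/-- A kernel of total mass at most the partition function is integrable. -/
theorem integrable_uncurry_of_integral_norm_le (hT : Measurable T) {A F : Type*}
    [MeasurableSpace A] (α : Measure A) [SFinite α] [NormedAddCommGroup F]
    {G : (Fin N → Fin M → ℝ) → A → F} (hG : StronglyMeasurable (Function.uncurry G))
    (hint : ∀ Y, Integrable (G Y) α) (hle : ∀ Y, ∫ a, ‖G Y a‖ ∂α ≤ partition ρ T Y) :
    Integrable (Function.uncurry G) ((noise N M).prod α) := by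
  rw [integrable_prod_iff hG.aestronglyMeasurable]
  refine ⟨Filter.Eventually.of_forall hint, (integrable_partition ρ hT).mono'
    hG.norm.integral_prod_right.aestronglyMeasurable (Filter.Eventually.of_forall fun Y => ?_)⟩
  rw [Real.norm_of_nonneg (integral_nonneg fun _ => norm_nonneg _)]
  exact hle Y

end FourReplicas

/-! ### The cavity extension by one coordinate -/

/-- The signal `T x` of a reduced system is extended by `η e • τ x`, where `e` is an additional
bounded centred coordinate of unit variance and `τ` takes values orthogonal to those of `T`. -/
structure IsCavity {N M : ℕ} {X E : Type*} [MeasurableSpace X] [MeasurableSpace E]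
    (P : Measure E) (T τ : X → Fin N → Fin M → ℝ) (η : E → ℝ) (b K : ℝ) : Prop where
  measurable_signal : Measurable T
  measurable_field : Measurable τ
  measurable_coord : Measurable η
  orthogonal : ∀ x y, dot (τ y) (T x) = 0
  field_le : ∀ x, dot (τ x) (τ x) ≤ b
  coord_le : ∀ e, |η e| ≤ K
  mean_zero : ∫ e, η e ∂P = 0
  unit_variance : ∫ e, η e ^ 2 ∂P = 1

/-- The signal of the extended system. -/
def extSignal {N M : ℕ} {X E : Type*} (T τ : X → Fin N → Fin M → ℝ) (η : E → ℝ) (z : X × E) :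
    Fin N → Fin M → ℝ := T z.1 + η z.2 • τ z.1

/-- The additional signal of two replicas. -/
def pairField {N M : ℕ} {X E : Type*} (τ : X → Fin N → Fin M → ℝ) (η : E → ℝ) (p : X × X)
    (ε : E × E) : Fin N → Fin M → ℝ := η ε.1 • τ p.1 + η ε.2 • τ p.2

/-- The inner product of the additional signals of two replicas, without the new coordinate. -/
def fieldOverlap {N M : ℕ} {X : Type*} (τ : X → Fin N → Fin M → ℝ) (p : X × X) : ℝ :=
  dot (τ p.1) (τ p.2)

namespace IsCavity

variable {N M : ℕ} {X E : Type*} [MeasurableSpace X] [MeasurableSpace E] {P : Measure E}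
  {T τ : X → Fin N → Fin M → ℝ} {η : E → ℝ} {b K : ℝ}

theorem measurable_extSignal (h : IsCavity P T τ η b K) : Measurable (extSignal T τ η) := by
  have h1 := h.measurable_signal
  have h2 := h.measurable_field
  have h3 := h.measurable_coord
  unfold extSignal
  fun_prop

theorem measurable_pairField (h : IsCavity P T τ η b K) :
    Measurable (Function.uncurry (pairField τ η)) := by
  have h2 := h.measurable_field
  have h3 := h.measurable_coord
  unfold pairField Function.uncurry
  fun_prop

theorem measurable_fieldOverlap (h : IsCavity P T τ η b K) : Measurable (fieldOverlap τ) := by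
  have h2 := h.measurable_field
  unfold fieldOverlap
  fun_prop

theorem abs_fieldOverlap_le (h : IsCavity P T τ η b K) (p : X × X) : |fieldOverlap τ p| ≤ b :=
  abs_dot_le _ _ (h.field_le _) (h.field_le _)

theorem pairField_orthogonal (h : IsCavity P T τ η b K) (p : X × X) (ε : E × E) (x : X) :
    dot (pairField τ η p ε) (T x) = 0 := by
  simp [pairField, dot_add_left, dot_smul_left, h.orthogonal]

theorem coord_bound_nonneg (h : IsCavity P T τ η b K) (e : E) : 0 ≤ K :=
  (abs_nonneg _).trans (h.coord_le e)

theorem tilt_extSignal (h : IsCavity P T τ η b K) (Y : Fin N → Fin M → ℝ) (z : X × E) :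
    tilt Y (extSignal T τ η z) = tilt Y (T z.1) * tilt Y (η z.2 • τ z.1) := by
  rw [extSignal, tilt_add_of_dot_eq_zero]
  rw [dot_smul_right, dot_comm, h.orthogonal, mul_zero]

/-- The tilts by the two new fields merge into one tilt by their sum, and the cross term of the
square is the coupling between the new coordinates. -/
theorem pairWeight_extSignal (h : IsCavity P T τ η b K) (Y : Fin N → Fin M → ℝ) (p : X × X)
    (ε : E × E) :
    pairWeight (extSignal T τ η) Y ((p.1, ε.1), (p.2, ε.2)) =
      tilt Y (pairField τ η p ε) * Real.exp (η ε.1 * η ε.2 * fieldOverlap τ p) *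
        pairWeight T Y p := by
  simp only [pairWeight, h.tilt_extSignal, pairField]
  have := tilt_mul_tilt Y (η ε.1 • τ p.1) (η ε.2 • τ p.2)
  rw [dot_smul_left, dot_smul_right, ← mul_assoc] at this
  rw [fieldOverlap, ← this]
  ring

theorem abs_coupling_le (h : IsCavity P T τ η b K) (p : X × X) (e e' : E) :
    |η e * η e' * fieldOverlap τ p| ≤ K ^ 2 * b := by
  rw [abs_mul, abs_mul, sq]
  have hK := h.coord_bound_nonneg e
  exact mul_le_mul (mul_le_mul (h.coord_le _) (h.coord_le _) (abs_nonneg _) hK)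
    (h.abs_fieldOverlap_le p) (abs_nonneg _) (mul_nonneg hK hK)

variable (ρ : Measure X) [IsProbabilityMeasure ρ] [IsProbabilityMeasure P]

/-- The new fields are orthogonal to the reduced signal. This is the invariance needed to integrate
out their tilt. -/
theorem partition_shift (h : IsCavity P T τ η b K) (Y : Fin N → Fin M → ℝ) (p : X × X)
    (ε : E × E) : partition ρ T (Y + pairField τ η p ε) = partition ρ T Y := by
  simp only [partition, tilt_shift_of_dot_eq_zero _ _ _ (h.pairField_orthogonal p ε _)]

theorem pairWeight_shift (h : IsCavity P T τ η b K) (Y : Fin N → Fin M → ℝ) (p p' : X × X)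
    (ε : E × E) : pairWeight T (Y + pairField τ η p ε) p' = pairWeight T Y p' := by
  simp only [pairWeight, tilt_shift_of_dot_eq_zero _ _ _ (h.pairField_orthogonal p ε _)]

/-- The integrand over the new coordinates of two replicas, apart from the Gaussian tilt. -/
def kernel (τ : X → Fin N → Fin M → ℝ) (η : E → ℝ) (Q : X × X → E × E → ℝ) (p : X × X)
    (ε : E × E) : ℝ := Q p ε * Real.exp (η ε.1 * η ε.2 * fieldOverlap τ p)

theorem measurable_kernel (h : IsCavity P T τ η b K) {Q : X × X → E × E → ℝ}
    (hQ : Measurable (Function.uncurry Q)) :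
    Measurable (Function.uncurry (kernel τ η Q)) := by
  have h1 := h.measurable_fieldOverlap
  have h3 := h.measurable_coord
  have : Function.uncurry (kernel τ η Q) = fun z : (X × X) × (E × E) =>
      Function.uncurry Q z * Real.exp (η z.2.1 * η z.2.2 * fieldOverlap τ z.1) := rfl
  rw [this]
  fun_prop

theorem abs_kernel_le (h : IsCavity P T τ η b K) {Q : X × X → E × E → ℝ} {c : ℝ}
    (hc : ∀ p ε, |Q p ε| ≤ c) (p : X × X) (ε : E × E) :
    |kernel τ η Q p ε| ≤ c * Real.exp (K ^ 2 * b) := by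
  rw [kernel, abs_mul, abs_of_pos (Real.exp_pos _)]
  have hc0 : 0 ≤ c := (abs_nonneg _).trans (hc p ε)
  exact mul_le_mul (hc p ε) (Real.exp_le_exp.2 ((le_abs_self _).trans (h.abs_coupling_le p _ _)))
    (Real.exp_pos _).le hc0

/-- A function of two replicas of the reduced system and their new coordinates, as a function of
two replicas of the extended system. -/
def lift (Q : X × X → E × E → ℝ) (z : (X × E) × (X × E)) : ℝ :=
  Q (z.1.1, z.2.1) (z.1.2, z.2.2)

theorem measurable_lift {Q : X × X → E × E → ℝ} (hQ : Measurable (Function.uncurry Q)) :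
    Measurable (lift Q) :=
  hQ.comp (f := fun z : (X × E) × (X × E) => ((z.1.1, z.2.1), (z.1.2, z.2.2))) (by fun_prop)

theorem pairInt_lift (h : IsCavity P T τ η b K) (Y : Fin N → Fin M → ℝ)
    {Q : X × X → E × E → ℝ} (hQ : Measurable (Function.uncurry Q)) {c : ℝ}
    (hc : ∀ p ε, |Q p ε| ≤ c) :
    pairInt (ρ.prod P) (extSignal T τ η) Y (lift Q) =
      ∫ p, (∫ ε, tilt Y (pairField τ η p ε) * kernel τ η Q p ε ∂P.prod P) * pairWeight T Y p
        ∂ρ.prod ρ := by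
  have h1 := h.measurable_extSignal
  have h2 := measurable_lift hQ
  have hmp := measurePreserving_prodProdProdComm ρ ρ P P
  have hint := integrable_pairWeight_mul (ρ.prod P) h1 Y h2 (c := c) fun z => hc _ _
  rw [pairInt, ← integral_comp_measurePreserving hmp (by
    apply Measurable.stronglyMeasurable
    fun_prop), integral_prod]
  · refine integral_congr_ae (Filter.Eventually.of_forall fun p => ?_)
    simp only []
    rw [← integral_mul_const]
    refine integral_congr_ae (Filter.Eventually.of_forall fun ε => ?_)
    simp only [h.pairWeight_extSignal, lift, kernel]
    ring
  · exact hmp.integrable_comp_of_integrable hint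

theorem integrable_pairWeight (hT : Measurable T) (Y : Fin N → Fin M → ℝ) :
    Integrable (fun p => pairWeight T Y p) (ρ.prod ρ) := by
  simpa using integrable_pairWeight_mul ρ hT Y (F := fun _ => 1) measurable_const (c := 1) (by simp)

theorem integral_pairWeight (Y : Fin N → Fin M → ℝ) :
    ∫ p, pairWeight T Y p ∂ρ.prod ρ = partition ρ T Y ^ 2 := by
  simpa [pairInt] using pairInt_const (T := T) ρ Y 1

/-- Main term: the phase of the reduced system does not see the new coordinates. -/
theorem norm_integral_phase_reduced_le (h : IsCavity P T τ η b K) (s : ℝ)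
    {Q : X × X → E × E → ℝ} (hQ : Measurable (Function.uncurry Q)) {c : ℝ}
    (hc : ∀ p ε, |Q p ε| ≤ c) {F : X × X → ℝ} (hF : Measurable F) {c' : ℝ}
    (hc' : ∀ p, |F p| ≤ c') (hle : ∀ p, |∫ ε, kernel τ η Q p ε ∂P.prod P| ≤ F p) :
    Integrable (fun Y => phaseFun s (partition ρ T Y) *
      (pairInt (ρ.prod P) (extSignal T τ η) Y (lift Q) : ℂ)) (noise N M) ∧
    ‖∫ Y, phaseFun s (partition ρ T Y) *
      (pairInt (ρ.prod P) (extSignal T τ η) Y (lift Q) : ℂ) ∂noise N M‖ ≤ nishimori ρ T F := by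
  have hT := h.measurable_signal
  set G : (Fin N → Fin M → ℝ) → X × X → ℂ := fun Y p =>
    phaseFun s (partition ρ T Y) * (pairWeight T Y p : ℂ) with hGdef
  have hGm : StronglyMeasurable (Function.uncurry G) := by
    apply Measurable.stronglyMeasurable
    have := measurable_partition ρ hT
    have hcast : Measurable fun z : (Fin N → Fin M → ℝ) × (X × X) => (pairWeight T z.1 z.2 : ℂ) :=
      Complex.measurable_ofReal.comp (by fun_prop)
    unfold Function.uncurry
    exact Measurable.mul (by fun_prop) hcast
  have hGn : ∀ Y p, ‖G Y p‖ = (partition ρ T Y)⁻¹ * pairWeight T Y p := fun Y p => by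
    rw [hGdef, norm_mul, norm_phaseFun (partition_pos ρ hT Y), Complex.norm_real,
      Real.norm_of_nonneg (pairWeight_pos _ _ _).le]
  have hGi : Integrable (Function.uncurry G) ((noise N M).prod (ρ.prod ρ)) := by
    refine integrable_uncurry_of_integral_norm_le ρ hT _ hGm (fun Y => ?_) fun Y => ?_
    · exact ((integrable_pairWeight ρ hT Y).ofReal).const_mul _
    · simp only [hGn]
      rw [integral_const_mul, integral_pairWeight]
      have := partition_pos ρ hT Y
      exact (by field_simp : _ = partition ρ T Y).le
  -- Phase and weights of the reduced system are invariant along the new fields, so the tilt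
  -- disappears and the kernel is averaged over the new coordinates alone.
  obtain ⟨h1, h2⟩ := integral_tilt_of_invariant (ρ.prod ρ) (P.prod P) h.measurable_pairField hGm
    (fun Y p ε => by simp only [hGdef, h.partition_shift ρ, h.pairWeight_shift]) hGi
    (h.measurable_kernel hQ) (h.abs_kernel_le hc)
  have hrew : ∀ Y, ∫ p, (∫ ε, tilt Y (pairField τ η p ε) * kernel τ η Q p ε ∂P.prod P) • G Y p
      ∂ρ.prod ρ = phaseFun s (partition ρ T Y) *
      (pairInt (ρ.prod P) (extSignal T τ η) Y (lift Q) : ℂ) := fun Y => by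
    rw [h.pairInt_lift ρ Y hQ hc, ← integral_complex_ofReal, ← integral_const_mul]
    refine integral_congr_ae (Filter.Eventually.of_forall fun p => ?_)
    simp only [hGdef, Complex.real_smul, Complex.ofReal_mul]
    ring
  simp only [hrew] at h1 h2
  refine ⟨h1, ?_⟩
  rw [h2]
  refine norm_integral_le_of_norm_le (integrable_nishimori ρ hT hF hc')
    (Filter.Eventually.of_forall fun Y => ?_)
  have hint := (integrable_pairWeight_mul ρ hT Y hF hc').const_mul (partition ρ T Y)⁻¹
  rw [pairInt, ← integral_const_mul]
  refine norm_integral_le_of_norm_le hint (Filter.Eventually.of_forall fun p => ?_)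
  rw [norm_smul, hGn, Real.norm_eq_abs, mul_comm, ← mul_assoc]
  exact mul_le_mul_of_nonneg_left (hle p)
    (mul_nonneg (inv_nonneg.2 (partition_pos ρ hT Y).le) (pairWeight_pos _ _ _).le)

/-- The chi-square distance between the extended and the reduced system. -/
theorem integral_sq_partition_sub_le (h : IsCavity P T τ η b K)
    {F : X × X → ℝ} (hF : Measurable F) {c' : ℝ} (hc' : ∀ p, |F p| ≤ c')
    (hle : ∀ p, ∫ ε, kernel τ η (fun _ _ => 1) p ε ∂P.prod P ≤ 1 + F p) :
    Integrable (fun Y => (partition (ρ.prod P) (extSignal T τ η) Y - partition ρ T Y) ^ 2 /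
      partition ρ T Y) (noise N M) ∧
    ∫ Y, (partition (ρ.prod P) (extSignal T τ η) Y - partition ρ T Y) ^ 2 / partition ρ T Y
      ∂noise N M ≤ nishimori ρ T F := by
  have hT := h.measurable_signal
  have hS := h.measurable_extSignal
  have hone : Measurable (Function.uncurry fun (_ : X × X) (_ : E × E) => (1 : ℝ)) :=
    measurable_const
  set G : (Fin N → Fin M → ℝ) → X × X → ℝ := fun Y p =>
    (partition ρ T Y)⁻¹ * pairWeight T Y p with hGdef
  have hpos := partition_pos ρ hT
  have hGm : StronglyMeasurable (Function.uncurry G) := by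
    apply Measurable.stronglyMeasurable
    have := measurable_partition ρ hT
    unfold Function.uncurry
    fun_prop
  have hGi : Integrable (Function.uncurry G) ((noise N M).prod (ρ.prod ρ)) := by
    refine integrable_uncurry_of_integral_norm_le ρ hT _ hGm (fun Y => ?_) fun Y => ?_
    · exact (integrable_pairWeight ρ hT Y).const_mul _
    · simp only [hGdef, norm_mul, norm_inv, Real.norm_of_nonneg (hpos Y).le,
        Real.norm_of_nonneg (pairWeight_pos _ _ _).le]
      rw [integral_const_mul, integral_pairWeight]
      have := hpos Y
      exact (by field_simp : _ = partition ρ T Y).le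
  obtain ⟨h1, h2⟩ := integral_tilt_of_invariant (ρ.prod ρ) (P.prod P) h.measurable_pairField hGm
    (fun Y p ε => by simp only [hGdef, h.partition_shift ρ, h.pairWeight_shift]) hGi
    (h.measurable_kernel hone) (h.abs_kernel_le (c := 1) (by simp))
  have hrew : ∀ Y, ∫ p, (∫ ε, tilt Y (pairField τ η p ε) * kernel τ η (fun _ _ => 1) p ε
      ∂P.prod P) • G Y p ∂ρ.prod ρ =
      (partition ρ T Y)⁻¹ * partition (ρ.prod P) (extSignal T τ η) Y ^ 2 := fun Y => by
    have e1 := pairInt_const (T := extSignal T τ η) (ρ.prod P) Y 1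
    rw [mul_one] at e1
    rw [← e1, show (fun _ : (X × E) × (X × E) => (1 : ℝ)) = lift (fun _ _ => 1) from rfl,
      h.pairInt_lift ρ Y hone (c := 1) (by simp), ← integral_const_mul]
    refine integral_congr_ae (Filter.Eventually.of_forall fun p => ?_)
    simp only [hGdef, smul_eq_mul]
    ring
  simp only [hrew] at h1 h2
  have i1 := integrable_partition (ρ.prod P) hS
  have i2 := integrable_partition ρ hT
  -- Both partition functions have mean one under the noise, so the chi-square distance is ∫ L²/L' -
  -- 1, and L² is a pair integral to which the tilt integration applies.
  have hexp : ∀ Y, (partition (ρ.prod P) (extSignal T τ η) Y - partition ρ T Y) ^ 2 /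
      partition ρ T Y = ((partition ρ T Y)⁻¹ * partition (ρ.prod P) (extSignal T τ η) Y ^ 2 -
        2 * partition (ρ.prod P) (extSignal T τ η) Y) + partition ρ T Y := fun Y => by
    have := (hpos Y).ne'
    field_simp
    ring
  simp only [hexp]
  refine ⟨(h1.sub (i1.const_mul 2)).add i2, ?_⟩
  have hsplit := integral_add (h1.sub (i1.const_mul 2)) i2
  rw [integral_sub' h1 (i1.const_mul 2), integral_const_mul, integral_partition _ hS,
    integral_partition _ hT, h2] at hsplit
  refine hsplit.trans_le ?_
  have h3 : ∫ Y, ∫ p, (∫ ε, kernel τ η (fun _ _ => 1) p ε ∂P.prod P) • G Y p ∂ρ.prod ρ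
      ∂noise N M ≤ nishimori ρ T fun p => 1 + F p := by
    have hF1 : Measurable fun p => 1 + F p := by fun_prop
    have hF1c : ∀ p, |1 + F p| ≤ 1 + c' := fun p => by
      have := abs_add_le 1 (F p)
      rw [abs_one] at this
      linarith [hc' p]
    refine integral_mono_of_nonneg (Filter.Eventually.of_forall fun Y => ?_)
      (integrable_nishimori ρ hT hF1 hF1c) (Filter.Eventually.of_forall fun Y => ?_)
    · exact integral_nonneg fun p => mul_nonneg (integral_nonneg fun ε => by
        simp only [kernel, one_mul]; exact (Real.exp_pos _).le)
        (mul_nonneg (inv_nonneg.2 (hpos Y).le) (pairWeight_pos _ _ _).le)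
    · have hint := (integrable_pairWeight_mul ρ hT Y hF1 hF1c).const_mul (partition ρ T Y)⁻¹
      simp only [pairInt]
      rw [← integral_const_mul]
      refine integral_mono_of_nonneg (Filter.Eventually.of_forall fun p => ?_) hint
        (Filter.Eventually.of_forall fun p => ?_)
      · exact mul_nonneg (integral_nonneg fun ε => by
          simp only [kernel, one_mul]; exact (Real.exp_pos _).le)
          (mul_nonneg (inv_nonneg.2 (hpos Y).le) (pairWeight_pos _ _ _).le)
      · have := mul_le_mul_of_nonneg_right (hle p)
          (mul_nonneg (inv_nonneg.2 (hpos Y).le) (pairWeight_pos T Y p).le)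
        simp only [hGdef, smul_eq_mul]
        linarith
  rw [nishimori_add ρ hT measurable_const (c := 1) (by simp) hF hc', nishimori_const ρ hT] at h3
  linarith

end IsCavity

/-! ### Comparing the phases of the full and the reduced system -/

namespace IsCavity

variable {N M : ℕ} {X E : Type*} [MeasurableSpace X] [MeasurableSpace E] {P : Measure E}
  {T τ : X → Fin N → Fin M → ℝ} {η : E → ℝ} {b K : ℝ} [IsProbabilityMeasure P]

theorem abs_dot_smul_field_le (h : IsCavity P T τ η b K) (x x' : X) (e e' : E) :
    |dot (η e • τ x) (η e' • τ x')| ≤ K ^ 2 * b := by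
  rw [dot_smul_left, dot_smul_right, ← mul_assoc]
  exact h.abs_coupling_le (x, x') e e'

theorem abs_dot_pairField_le (h : IsCavity P T τ η b K) (p p' : X × X) (ε ε' : E × E) :
    |dot (pairField τ η p ε) (pairField τ η p' ε')| ≤ 4 * (K ^ 2 * b) := by
  simp only [pairField, dot_add_left, dot_add_right]
  have h1 := abs_le.1 (h.abs_dot_smul_field_le p.1 p'.1 ε.1 ε'.1)
  have h2 := abs_le.1 (h.abs_dot_smul_field_le p.1 p'.2 ε.1 ε'.2)
  have h3 := abs_le.1 (h.abs_dot_smul_field_le p.2 p'.1 ε.2 ε'.1)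
  have h4 := abs_le.1 (h.abs_dot_smul_field_le p.2 p'.2 ε.2 ε'.2)
  rw [abs_le]
  constructor <;> linarith

/-- The integrand over the new coordinates of four replicas, apart from the Gaussian tilt. -/
def kernelSq (τ : X → Fin N → Fin M → ℝ) (η : E → ℝ) (Q : X × X → E × E → ℝ)
    (q : (X × X) × (X × X)) (ε : (E × E) × (E × E)) : ℝ :=
  kernel τ η Q q.1 ε.1 * kernel τ η Q q.2 ε.2 *
    Real.exp (dot (pairField τ η q.1 ε.1) (pairField τ η q.2 ε.2))

theorem measurable_kernelSq (h : IsCavity P T τ η b K) {Q : X × X → E × E → ℝ}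
    (hQ : Measurable (Function.uncurry Q)) :
    Measurable (Function.uncurry (kernelSq τ η Q)) := by
  have h1 := h.measurable_kernel hQ
  have h2 := h.measurable_pairField
  have : Function.uncurry (kernelSq τ η Q) =
      fun z : ((X × X) × (X × X)) × ((E × E) × (E × E)) =>
      Function.uncurry (kernel τ η Q) (z.1.1, z.2.1) *
        Function.uncurry (kernel τ η Q) (z.1.2, z.2.2) *
      Real.exp (dot (Function.uncurry (pairField τ η) (z.1.1, z.2.1))
        (Function.uncurry (pairField τ η) (z.1.2, z.2.2))) := rfl
  rw [this]
  fun_prop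

theorem abs_kernelSq_le (h : IsCavity P T τ η b K) {Q : X × X → E × E → ℝ} {c : ℝ}
    (hc : ∀ p ε, |Q p ε| ≤ c) (q : (X × X) × (X × X)) (ε : (E × E) × (E × E)) :
    |kernelSq τ η Q q ε| ≤ (c * Real.exp (K ^ 2 * b)) * (c * Real.exp (K ^ 2 * b)) *
      Real.exp (4 * (K ^ 2 * b)) := by
  have hc0 : 0 ≤ c := (abs_nonneg _).trans (hc q.1 ε.1)
  rw [kernelSq, abs_mul, abs_mul, abs_of_pos (Real.exp_pos _)]
  exact mul_le_mul (mul_le_mul (h.abs_kernel_le hc _ _) (h.abs_kernel_le hc _ _) (abs_nonneg _)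
    (by positivity)) (Real.exp_le_exp.2 ((le_abs_self _).trans (h.abs_dot_pairField_le _ _ _ _)))
    (Real.exp_pos _).le (by positivity)

variable (ρ : Measure X) [IsProbabilityMeasure ρ]

/-- Squaring introduces two further replicas. Merging the tilts of the two pairs leaves a factor
exp⟨field, field⟩, which is absorbed in `kernelSq`. -/
theorem pairInt_lift_sq (h : IsCavity P T τ η b K) (Y : Fin N → Fin M → ℝ)
    {Q : X × X → E × E → ℝ} (hQ : Measurable (Function.uncurry Q)) {c : ℝ}
    (hc : ∀ p ε, |Q p ε| ≤ c) :
    pairInt (ρ.prod P) (extSignal T τ η) Y (lift Q) ^ 2 =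
      ∫ q, (∫ ε, tilt Y (pairField τ η q.1 ε.1 + pairField τ η q.2 ε.2) * kernelSq τ η Q q ε
        ∂(P.prod P).prod (P.prod P)) * (pairWeight T Y q.1 * pairWeight T Y q.2)
        ∂(ρ.prod ρ).prod (ρ.prod ρ) := by
  rw [h.pairInt_lift ρ Y hQ hc, sq, ← integral_prod_mul]
  refine integral_congr_ae (Filter.Eventually.of_forall fun q => ?_)
  simp only []
  rw [mul_mul_mul_comm, ← integral_prod_mul]
  congr 1
  refine integral_congr_ae (Filter.Eventually.of_forall fun ε => ?_)
  simp only [kernelSq]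
  rw [mul_mul_mul_comm, tilt_mul_tilt]
  ring

/-- Four replica weights have mass L'⁴. Division by L'³ therefore leaves the planted weight L', and
each of the six pairs contributes the same two-replica average. -/
theorem integral_sq_pairInt_lift_le (h : IsCavity P T τ η b K)
    {Q : X × X → E × E → ℝ} (hQ : Measurable (Function.uncurry Q)) {c : ℝ}
    (hc : ∀ p ε, |Q p ε| ≤ c) {F : X × X → ℝ} (hF : Measurable F) {c' : ℝ}
    (hc' : ∀ p, |F p| ≤ c')
    (hle : ∀ q, |∫ ε, kernelSq τ η Q q ε ∂(P.prod P).prod (P.prod P)| ≤ sumPairs F q) :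
    Integrable (fun Y => pairInt (ρ.prod P) (extSignal T τ η) Y (lift Q) ^ 2 /
      partition ρ T Y ^ 3) (noise N M) ∧
    ∫ Y, pairInt (ρ.prod P) (extSignal T τ η) Y (lift Q) ^ 2 / partition ρ T Y ^ 3 ∂noise N M ≤
      6 * nishimori ρ T F := by
  have hT := h.measurable_signal
  set G : (Fin N → Fin M → ℝ) → (X × X) × (X × X) → ℝ := fun Y q =>
    (partition ρ T Y ^ 3)⁻¹ * (pairWeight T Y q.1 * pairWeight T Y q.2) with hGdef
  have hpos := partition_pos ρ hT
  have hGpos : ∀ Y q, 0 < G Y q := fun Y q => mul_pos (inv_pos.2 (pow_pos (hpos Y) 3))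
    (mul_pos (pairWeight_pos _ _ _) (pairWeight_pos _ _ _))
  have hGm : StronglyMeasurable (Function.uncurry G) := by
    apply Measurable.stronglyMeasurable
    have := measurable_partition ρ hT
    unfold Function.uncurry
    fun_prop
  have hGi : Integrable (Function.uncurry G)
      ((noise N M).prod ((ρ.prod ρ).prod (ρ.prod ρ))) := by
    refine integrable_uncurry_of_integral_norm_le ρ hT _ hGm (fun Y => ?_) fun Y => ?_
    · exact ((integrable_pairWeight ρ hT Y).mul_prod (integrable_pairWeight ρ hT Y)).const_mul _
    · simp only [Real.norm_of_nonneg (hGpos _ _).le]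
      rw [hGdef, integral_const_mul, integral_prod_mul, integral_pairWeight]
      have := hpos Y
      exact (by field_simp : _ = partition ρ T Y).le
  have ht : Measurable (Function.uncurry fun (q : (X × X) × (X × X)) (ε : (E × E) × (E × E)) =>
      pairField τ η q.1 ε.1 + pairField τ η q.2 ε.2) := by
    have h2 := h.measurable_pairField
    have e1 : (Function.uncurry fun (q : (X × X) × (X × X)) (ε : (E × E) × (E × E)) =>
      pairField τ η q.1 ε.1 + pairField τ η q.2 ε.2) = fun z =>
        Function.uncurry (pairField τ η) (z.1.1, z.2.1) +
        Function.uncurry (pairField τ η) (z.1.2, z.2.2) := rfl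
    rw [e1]
    fun_prop
  obtain ⟨h1, h2⟩ := integral_tilt_of_invariant ((ρ.prod ρ).prod (ρ.prod ρ))
    ((P.prod P).prod (P.prod P)) ht hGm
    (fun Y q ε => by
      simp only [hGdef, ← add_assoc, h.partition_shift ρ, h.pairWeight_shift]) hGi
    (h.measurable_kernelSq hQ) (h.abs_kernelSq_le hc)
  have hrew : ∀ Y, ∫ q, (∫ ε, tilt Y (pairField τ η q.1 ε.1 + pairField τ η q.2 ε.2) *
      kernelSq τ η Q q ε ∂(P.prod P).prod (P.prod P)) • G Y q ∂(ρ.prod ρ).prod (ρ.prod ρ) =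
      pairInt (ρ.prod P) (extSignal T τ η) Y (lift Q) ^ 2 / partition ρ T Y ^ 3 := fun Y => by
    rw [h.pairInt_lift_sq ρ Y hQ hc, div_eq_inv_mul, ← integral_const_mul]
    refine integral_congr_ae (Filter.Eventually.of_forall fun q => ?_)
    simp only [hGdef, smul_eq_mul]
    ring
  simp only [hrew] at h1 h2
  refine ⟨h1, ?_⟩
  rw [h2, nishimori, ← integral_const_mul]
  refine (le_abs_self _).trans ?_
  rw [← Real.norm_eq_abs]
  refine norm_integral_le_of_norm_le ((integrable_nishimori ρ hT hF hc').const_mul 6)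
    (Filter.Eventually.of_forall fun Y => ?_)
  obtain ⟨i1, i2⟩ := integral_pairWeight_sumPairs ρ hT Y hF hc'
  have e1 : 6 * ((partition ρ T Y)⁻¹ * pairInt ρ T Y F) =
      ∫ q, (partition ρ T Y ^ 3)⁻¹ * (pairWeight T Y q.1 * pairWeight T Y q.2 * sumPairs F q)
        ∂(ρ.prod ρ).prod (ρ.prod ρ) := by
    rw [integral_const_mul, i2]
    have := hpos Y
    field_simp
  rw [e1]
  refine norm_integral_le_of_norm_le (i1.const_mul _) (Filter.Eventually.of_forall fun q => ?_)
  rw [norm_smul, Real.norm_eq_abs, Real.norm_of_nonneg (hGpos Y q).le]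
  calc _ ≤ sumPairs F q * G Y q := mul_le_mul_of_nonneg_right (hle q) (hGpos Y q).le
    _ = _ := by simp only [hGdef]; ring

/-- With σ = |τ|², the exponent of the new tilt is -σ/2 plus a variable of mean zero, because η is
centred with unit variance. The inequality eˣ ≥ 1 + x then bounds the average from below by
exp(-σ/2). -/
theorem partition_le_extSignal (h : IsCavity P T τ η b K) (Y : Fin N → Fin M → ℝ) :
    Real.exp (-(b / 2)) * partition ρ T Y ≤ partition (ρ.prod P) (extSignal T τ η) Y := by
  have hT := h.measurable_signal
  have hη := h.measurable_coord
  have hτ := h.measurable_field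
  have hS := h.measurable_extSignal
  rw [partition, partition, integral_prod _ (integrable_tilt (ρ.prod P) hS Y),
    ← integral_const_mul]
  refine integral_mono ((integrable_tilt ρ hT Y).const_mul _)
    (integrable_tilt (ρ.prod P) hS Y).integral_prod_left fun x => ?_
  simp only [h.tilt_extSignal]
  rw [integral_const_mul, mul_comm]
  refine mul_le_mul_of_nonneg_left ?_ (tilt_pos _ _).le
  have i1 : Integrable η P := integrable_of_abs_le hη h.coord_le
  have i2 : Integrable (fun e => η e ^ 2) P :=
    integrable_of_abs_le (c := K ^ 2) (by fun_prop) fun e => by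
      rw [abs_pow]; exact pow_le_pow_left₀ (abs_nonneg _) (h.coord_le e) 2
  set σ := dot (τ x) (τ x)
  have hσ : σ ≤ b := h.field_le x
  have hlow : ∫ e, Real.exp (-(σ / 2)) * (1 + η e * dot Y (τ x) + (σ / 2 - η e ^ 2 * (σ / 2))) ∂P =
      Real.exp (-(σ / 2)) := by
    have j1 : Integrable (fun e => 1 + η e * dot Y (τ x)) P :=
      (integrable_const _).add (i1.mul_const _)
    have j2 : Integrable (fun e => σ / 2 - η e ^ 2 * (σ / 2)) P :=
      (integrable_const _).sub (i2.mul_const _)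
    rw [integral_const_mul, integral_add j1 j2, integral_add (integrable_const _) (i1.mul_const _),
      integral_sub (integrable_const _) (i2.mul_const _), integral_mul_const, integral_mul_const,
      h.mean_zero, h.unit_variance]
    simp
  calc Real.exp (-(b / 2)) ≤ Real.exp (-(σ / 2)) := Real.exp_le_exp.2 (by linarith)
    _ ≤ _ := by
      rw [← hlow]
      refine integral_mono ?_ (integrable_of_abs_le (by fun_prop) fun e =>
        (abs_of_pos (tilt_pos _ _)).trans_le (tilt_le Y (η e • τ x))) fun e => ?_
      · exact (((integrable_const _).add (i1.mul_const _)).add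
          ((integrable_const _).sub (i2.mul_const _))).const_mul _
      · simp only [tilt, dot_smul_left, dot_smul_right]
        have := Real.add_one_le_exp (η e * dot Y (τ x) + (σ / 2 - η e ^ 2 * (σ / 2)))
        calc _ ≤ Real.exp (-(σ / 2)) *
              Real.exp (η e * dot Y (τ x) + (σ / 2 - η e ^ 2 * (σ / 2))) := by
              gcongr
              linarith
          _ = _ := by
              rw [← Real.exp_add]
              congr 1
              simp only [σ]
              ring

/-- The observable of the extended system is controlled by quantities of the reduced system. -/
theorem norm_obs_lift_le (h : IsCavity P T τ η b K) (hb : 0 ≤ b) (s : ℝ) {δ : ℝ} (hδ : 0 < δ)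
    {Q : X × X → E × E → ℝ} (hQ : Measurable (Function.uncurry Q)) {c : ℝ}
    (hc : ∀ p ε, |Q p ε| ≤ c)
    {F₁ : X × X → ℝ} (hF₁ : Measurable F₁) {c₁ : ℝ} (hc₁ : ∀ p, |F₁ p| ≤ c₁)
    (hle₁ : ∀ p, |∫ ε, kernel τ η Q p ε ∂P.prod P| ≤ F₁ p)
    {F₂ : X × X → ℝ} (hF₂ : Measurable F₂) {c₂ : ℝ} (hc₂ : ∀ p, |F₂ p| ≤ c₂)
    (hle₂ : ∀ p, ∫ ε, kernel τ η (fun _ _ => 1) p ε ∂P.prod P ≤ 1 + F₂ p)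
    {F₃ : X × X → ℝ} (hF₃ : Measurable F₃) {c₃ : ℝ} (hc₃ : ∀ p, |F₃ p| ≤ c₃)
    (hle₃ : ∀ q, |∫ ε, kernelSq τ η Q q ε ∂(P.prod P).prod (P.prod P)| ≤ sumPairs F₃ q) :
    ‖obs (ρ.prod P) (extSignal T τ η) s (lift Q)‖ ≤ nishimori ρ T F₁ +
      (1 + |s|) * Real.exp (b / 2) *
        (δ * nishimori ρ T F₂ + δ⁻¹ * (6 * nishimori ρ T F₃)) := by
  have hT := h.measurable_signal
  have hS := h.measurable_extSignal
  obtain ⟨i1, e1⟩ := h.norm_integral_phase_reduced_le ρ s hQ hc hF₁ hc₁ hle₁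
  obtain ⟨i2, e2⟩ := h.integral_sq_partition_sub_le ρ hF₂ hc₂ hle₂
  obtain ⟨i3, e3⟩ := h.integral_sq_pairInt_lift_le ρ hQ hc hF₃ hc₃ hle₃
  have i0 := integrable_obs (ρ.prod P) hS s (measurable_lift hQ) (c := c) fun z => hc _ _
  have hsplit : obs (ρ.prod P) (extSignal T τ η) s (lift Q) =
      ∫ Y, phaseFun s (partition ρ T Y) *
        (pairInt (ρ.prod P) (extSignal T τ η) Y (lift Q) : ℂ) ∂noise N M +
      ∫ Y, (phaseFun s (partition (ρ.prod P) (extSignal T τ η) Y) *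
        (pairInt (ρ.prod P) (extSignal T τ η) Y (lift Q) : ℂ) - phaseFun s (partition ρ T Y) *
        (pairInt (ρ.prod P) (extSignal T τ η) Y (lift Q) : ℂ)) ∂noise N M := by
    rw [integral_sub i0 i1, obs]
    ring
  rw [hsplit]
  refine (norm_add_le _ _).trans (add_le_add e1 ?_)
  have i4 := ((i2.const_mul δ).add (i3.const_mul δ⁻¹)).const_mul ((1 + |s|) * Real.exp (b / 2))
  refine (norm_integral_le_of_norm_le i4 (Filter.Eventually.of_forall fun Y => ?_)).trans ?_
  · have hpos := partition_pos ρ hT Y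
    have hlip := norm_phaseFun_sub_le s (Real.exp_pos (-(b / 2))) (Real.exp_le_one_iff.2 (by linarith)) hpos
      (h.partition_le_extSignal ρ Y)
    rw [← sub_mul, norm_mul, Complex.norm_real, Real.norm_eq_abs]
    set L := partition (ρ.prod P) (extSignal T τ η) Y
    set L' := partition ρ T Y
    set n := pairInt (ρ.prod P) (extSignal T τ η) Y (lift Q)
    calc _ ≤ (1 + |s|) / Real.exp (-(b / 2)) * (|L - L'| / L' ^ 2) * |n| := by gcongr
      _ = (1 + |s|) * Real.exp (b / 2) * (|L - L'| * |n| / L' ^ 2) := by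
        rw [Real.exp_neg, div_inv_eq_mul]; ring
      -- Weighted Young inequality: |L - L'| |n| / L'² is at most δ (L - L')²/L' + δ⁻¹ n²/L'³. The
      -- weight δ stays free because the two terms scale differently with N.
      _ ≤ _ := by
        refine mul_le_mul_of_nonneg_left ?_ (by positivity)
        simp only [Pi.add_apply]
        rw [← sq_abs (L - L'), ← sq_abs n]
        have e : δ * (|L - L'| ^ 2 / L') + δ⁻¹ * (|n| ^ 2 / L' ^ 3) - |L - L'| * |n| / L' ^ 2 =
            (δ⁻¹ / L') * ((δ * |L - L'| - |n| / L') ^ 2 + δ * |L - L'| * |n| / L') := by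
          field_simp
          ring
        have : 0 ≤ (δ⁻¹ / L') * ((δ * |L - L'| - |n| / L') ^ 2 + δ * |L - L'| * |n| / L') := by
          positivity
        linarith
  · rw [integral_const_mul]
    refine mul_le_mul_of_nonneg_left ?_ (by positivity)
    have := integral_add (i2.const_mul δ) (i3.const_mul δ⁻¹)
    rw [integral_const_mul, integral_const_mul] at this
    refine this.trans_le ?_
    gcongr

end IsCavity

/-! ### Taylor expansion in the coupling of the new coordinates -/

theorem abs_exp_sub_one_le_mul_exp (x : ℝ) : |Real.exp x - 1| ≤ |x| * Real.exp |x| := by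
  have h := Complex.norm_exp_sub_sum_le_norm_mul_exp (x : ℂ) 1
  simp only [Finset.range_one, Finset.sum_singleton, pow_zero, Nat.factorial_zero, Nat.cast_one,
    div_one, pow_one, Complex.norm_real, Real.norm_eq_abs] at h
  rwa [← Complex.ofReal_exp, ← Complex.ofReal_one, ← Complex.ofReal_sub, Complex.norm_real] at h

theorem abs_exp_sub_one_sub_le_mul_exp (x : ℝ) :
    |Real.exp x - 1 - x| ≤ x ^ 2 * Real.exp |x| := by
  have h := Complex.norm_exp_sub_sum_le_norm_mul_exp (x : ℂ) 2
  simp only [Finset.sum_range_succ, Finset.range_zero, Finset.sum_empty, zero_add, pow_zero,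
    Nat.factorial_zero, Nat.cast_one, div_one, pow_one, Nat.factorial_one, Complex.norm_real,
    Real.norm_eq_abs, sq_abs] at h
  rwa [← Complex.ofReal_exp, ← Complex.ofReal_one, ← Complex.ofReal_add, ← Complex.ofReal_sub,
    Complex.norm_real, Real.norm_eq_abs, ← sub_sub] at h

/-- A bounded centred coordinate of unit variance. -/
structure IsCoord {E : Type*} [MeasurableSpace E] (P : Measure E) (η : E → ℝ) (K : ℝ) : Prop where
  measurable_coord : Measurable η
  coord_le : ∀ e, |η e| ≤ K
  mean_zero : ∫ e, η e ∂P = 0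
  unit_variance : ∫ e, η e ^ 2 ∂P = 1

namespace IsCoord

variable {E : Type*} [MeasurableSpace E] {P : Measure E} [IsProbabilityMeasure P] {η : E → ℝ}
  {K : ℝ}

theorem integral_quadratic (h : IsCoord P η K) (A B C : ℝ) :
    ∫ e, (A + B * η e + C * η e ^ 2) ∂P = A + C := by
  have hη := h.measurable_coord
  have i1 : Integrable η P := integrable_of_abs_le hη h.coord_le
  have i2 : Integrable (fun e => η e ^ 2) P :=
    integrable_of_abs_le (c := K ^ 2) (by fun_prop) fun e => by
      rw [abs_pow]; exact pow_le_pow_left₀ (abs_nonneg _) (h.coord_le e) 2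
  have j1 : Integrable (fun e => A + B * η e) P := (integrable_const _).add (i1.const_mul _)
  rw [integral_add j1 (i2.const_mul _), integral_add (integrable_const _) (i1.const_mul _),
    integral_const_mul, integral_const_mul, h.mean_zero, h.unit_variance]
  simp

theorem integral_eq_of_quadratic (h : IsCoord P η K) {f : E → ℝ} (A B C : ℝ)
    (hf : ∀ e, f e = A + B * η e + C * η e ^ 2) : ∫ e, f e ∂P = A + C := by
  simp only [hf, h.integral_quadratic]

theorem integral_two {f : E → E → ℝ} (hf : Measurable fun z : E × E => f z.1 z.2) {c : ℝ}
    (hc : ∀ e e', |f e e'| ≤ c) :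
    ∫ z, f z.1 z.2 ∂P.prod P = ∫ e₁, ∫ e₂, f e₁ e₂ ∂P ∂P :=
  integral_prod _ (integrable_of_abs_le hf fun _ => hc _ _)

theorem integral_four {f : E → E → E → E → ℝ}
    (hf : Measurable fun z : (E × E) × (E × E) => f z.1.1 z.1.2 z.2.1 z.2.2) {c : ℝ}
    (hc : ∀ e₁ e₂ e₃ e₄, |f e₁ e₂ e₃ e₄| ≤ c) :
    ∫ z, f z.1.1 z.1.2 z.2.1 z.2.2 ∂(P.prod P).prod (P.prod P) =
      ∫ e₁, ∫ e₂, ∫ e₃, ∫ e₄, f e₁ e₂ e₃ e₄ ∂P ∂P ∂P ∂P := by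
  have hint : Integrable (fun z : (E × E) × (E × E) => f z.1.1 z.1.2 z.2.1 z.2.2)
      ((P.prod P).prod (P.prod P)) := integrable_of_abs_le hf fun _ => hc _ _ _ _
  rw [integral_prod _ hint, integral_prod _ hint.integral_prod_left]
  refine integral_congr_ae (Filter.Eventually.of_forall fun e₁ => ?_)
  refine integral_congr_ae (Filter.Eventually.of_forall fun e₂ => ?_)
  exact integral_two (f := f e₁ e₂)
    (hf.comp (f := fun z : E × E => ((e₁, e₂), z)) (by fun_prop)) (hc _ _)

theorem abs_mul_le (h : IsCoord P η K) (e e' : E) : |η e * η e'| ≤ K ^ 2 := by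
  rw [abs_mul, sq]
  exact mul_le_mul (h.coord_le _) (h.coord_le _) (abs_nonneg _)
    ((abs_nonneg _).trans (h.coord_le e))

theorem abs_mul_mul_le (h : IsCoord P η K) (e e' : E) {r b : ℝ} (hr : |r| ≤ b) :
    |η e * η e' * r| ≤ K ^ 2 * b := by
  rw [abs_mul]
  exact mul_le_mul (h.abs_mul_le _ _) hr (abs_nonneg _) (sq_nonneg _)

theorem abs_mul_sub_le (h : IsCoord P η K) (e e' : E) {r b : ℝ} (hr : |r| ≤ b) :
    |η e * η e' - r| ≤ K ^ 2 + b :=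
  (abs_sub _ _).trans (add_le_add (h.abs_mul_le _ _) hr)

theorem remainder_two_le (h : IsCoord P η K) {r b : ℝ} (hr : |r| ≤ b) (e e' : E) :
    |Real.exp (η e * η e' * r) - 1 - η e * η e' * r| ≤
      K ^ 4 * Real.exp (K ^ 2 * b) * r ^ 2 := by
  refine (abs_exp_sub_one_sub_le_mul_exp _).trans ?_
  have h1 : (η e * η e' * r) ^ 2 ≤ K ^ 4 * r ^ 2 := by
    rw [mul_pow, ← sq_abs (η e * η e')]
    have := pow_le_pow_left₀ (abs_nonneg _) (h.abs_mul_le e e') 2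
    calc _ ≤ (K ^ 2) ^ 2 * r ^ 2 := mul_le_mul_of_nonneg_right this (sq_nonneg _)
      _ = _ := by ring
  calc _ ≤ (K ^ 4 * r ^ 2) * Real.exp (K ^ 2 * b) :=
        mul_le_mul h1 (Real.exp_le_exp.2 (h.abs_mul_mul_le e e' hr)) (Real.exp_pos _).le
          (by positivity)
    _ = _ := by ring

theorem abs_integral_sub_le {A : Type*} [MeasurableSpace A] (α : Measure A)
    [IsProbabilityMeasure α] {f g : A → ℝ} (hf : Measurable f) (hg : Measurable g) {c c' d : ℝ}
    (hfc : ∀ a, |f a| ≤ c) (hgc : ∀ a, |g a| ≤ c') (hd : ∀ a, |f a - g a| ≤ d) :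
    |∫ a, f a ∂α - ∫ a, g a ∂α| ≤ d := by
  rw [← integral_sub (integrable_of_abs_le hf hfc) (integrable_of_abs_le hg hgc),
    ← Real.norm_eq_abs]
  refine (norm_integral_le_of_norm_le (integrable_const d)
    (Filter.Eventually.of_forall hd)).trans_eq ?_
  simp

theorem abs_exp_two_le (h : IsCoord P η K) {r b : ℝ} (hr : |r| ≤ b) (e e' : E) :
    |Real.exp (η e * η e' * r)| ≤ Real.exp (K ^ 2 * b) := by
  rw [abs_of_pos (Real.exp_pos _)]
  exact Real.exp_le_exp.2 ((le_abs_self _).trans (h.abs_mul_mul_le _ _ hr))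

/-- The linear term has mean zero, since the two coordinates are independent and centred, so the
excess over one is quadratic in r. -/
theorem integral_exp_le (h : IsCoord P η K) {r b : ℝ} (hr : |r| ≤ b) :
    ∫ z, Real.exp (η z.1 * η z.2 * r) ∂P.prod P ≤ 1 + K ^ 4 * Real.exp (K ^ 2 * b) * r ^ 2 := by
  have hη := h.measurable_coord
  have hlin : ∫ z, (1 + η z.1 * η z.2 * r) ∂P.prod P = 1 := by
    rw [integral_two (f := fun e e' => 1 + η e * η e' * r) (by fun_prop) (c := 1 + K ^ 2 * b)
      fun e e' => (abs_add_le _ _).trans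
        (add_le_add (by simp) (h.abs_mul_mul_le e e' hr))]
    rw [h.integral_eq_of_quadratic 1 0 0 fun e => ?_]
    · simp
    · rw [h.integral_eq_of_quadratic 1 (η e * r) 0 fun e' => by ring]
      ring
  have := abs_integral_sub_le (P.prod P) (f := fun z => Real.exp (η z.1 * η z.2 * r))
    (g := fun z => 1 + η z.1 * η z.2 * r) (by fun_prop) (by fun_prop)
    (fun z => h.abs_exp_two_le hr _ _) (c' := 1 + K ^ 2 * b)
    (fun z => (abs_add_le _ _).trans
        (add_le_add (by simp) (h.abs_mul_mul_le _ _ hr)))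
    (d := K ^ 4 * Real.exp (K ^ 2 * b) * r ^ 2) fun z => by
      rw [← sub_sub]; exact h.remainder_two_le hr _ _
  rw [hlin] at this
  linarith [(abs_le.1 this).2]

/-- Unit variance makes the mean of (η η')² r equal to r, which cancels the subtracted r. All
contributions up to first order vanish. -/
theorem abs_integral_sub_mul_exp_le (h : IsCoord P η K) {r b : ℝ} (hr : |r| ≤ b) :
    |∫ z, (η z.1 * η z.2 - r) * Real.exp (η z.1 * η z.2 * r) ∂P.prod P| ≤
      (K ^ 2 + b) * (K ^ 4 * Real.exp (K ^ 2 * b)) * r ^ 2 := by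
  have hη := h.measurable_coord
  have hb : 0 ≤ b := (abs_nonneg _).trans hr
  have hbd : ∀ e e', |(η e * η e' - r) * (1 + η e * η e' * r)| ≤
      (K ^ 2 + b) * (1 + K ^ 2 * b) := fun e e' => by
    rw [abs_mul]
    exact mul_le_mul (h.abs_mul_sub_le _ _ hr) ((abs_add_le _ _).trans
        (add_le_add (by simp) (h.abs_mul_mul_le e e' hr))) (abs_nonneg _) (by positivity)
  have hlin : ∫ z, (η z.1 * η z.2 - r) * (1 + η z.1 * η z.2 * r) ∂P.prod P = 0 := by
    rw [integral_two (f := fun e e' => (η e * η e' - r) * (1 + η e * η e' * r)) (by fun_prop) hbd]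
    rw [h.integral_eq_of_quadratic (-r) 0 r fun e => ?_]
    · simp
    · rw [h.integral_eq_of_quadratic (-r) (η e - r ^ 2 * η e) (η e ^ 2 * r) fun e' => by ring]
      ring
  have := abs_integral_sub_le (P.prod P)
    (f := fun z => (η z.1 * η z.2 - r) * Real.exp (η z.1 * η z.2 * r))
    (g := fun z => (η z.1 * η z.2 - r) * (1 + η z.1 * η z.2 * r)) (by fun_prop) (by fun_prop)
    (c := (K ^ 2 + b) * Real.exp (K ^ 2 * b))
    (fun z => by
      rw [abs_mul]
      exact mul_le_mul (h.abs_mul_sub_le _ _ hr) (h.abs_exp_two_le hr _ _) (abs_nonneg _)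
        (by positivity)) (fun z => hbd _ _)
    (d := (K ^ 2 + b) * (K ^ 4 * Real.exp (K ^ 2 * b)) * r ^ 2) fun z => by
      rw [← mul_sub, ← sub_sub, abs_mul, mul_assoc (K ^ 2 + b)]
      exact mul_le_mul (h.abs_mul_sub_le _ _ hr) (h.remainder_two_le hr _ _) (abs_nonneg _)
        (by positivity)
  rwa [hlin, sub_zero] at this

/-- Only the zeroth order cancels here, so the bound is linear in r. This suffices because the term
is later divided by N. -/
theorem abs_integral_sq_sub_one_mul_exp_le (h : IsCoord P η K) {r b : ℝ} (hr : |r| ≤ b) :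
    |∫ z, ((η z.1 * η z.2) ^ 2 - 1) * Real.exp (η z.1 * η z.2 * r) ∂P.prod P| ≤
      (K ^ 4 + 1) * (K ^ 2 * Real.exp (K ^ 2 * b)) * |r| := by
  have hη := h.measurable_coord
  have hbd : ∀ e e', |(η e * η e') ^ 2 - 1| ≤ K ^ 4 + 1 := fun e e' => by
    refine (abs_sub _ _).trans (add_le_add ?_ (by simp))
    rw [abs_pow]
    exact (pow_le_pow_left₀ (abs_nonneg _) (h.abs_mul_le e e') 2).trans_eq (by ring)
  have hlin : ∫ z, ((η z.1 * η z.2) ^ 2 - 1) ∂P.prod P = 0 := by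
    rw [integral_two (f := fun e e' => (η e * η e') ^ 2 - 1) (by fun_prop) hbd]
    rw [h.integral_eq_of_quadratic (-1) 0 1 fun e => ?_]
    · simp
    · rw [h.integral_eq_of_quadratic (-1) 0 (η e ^ 2) fun e' => by ring]
      ring
  have := abs_integral_sub_le (P.prod P)
    (f := fun z => ((η z.1 * η z.2) ^ 2 - 1) * Real.exp (η z.1 * η z.2 * r))
    (g := fun z => (η z.1 * η z.2) ^ 2 - 1) (by fun_prop) (by fun_prop)
    (c := (K ^ 4 + 1) * Real.exp (K ^ 2 * b))
    (fun z => by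
      rw [abs_mul]
      exact mul_le_mul (hbd _ _) (h.abs_exp_two_le hr _ _) (abs_nonneg _)
        (by positivity)) (fun z => hbd _ _)
    (d := (K ^ 4 + 1) * (K ^ 2 * Real.exp (K ^ 2 * b)) * |r|) fun z => by
      rw [← mul_sub_one, abs_mul, mul_assoc (K ^ 4 + 1)]
      refine mul_le_mul (hbd _ _) ?_ (abs_nonneg _) (by positivity)
      refine (abs_exp_sub_one_le_mul_exp _).trans ?_
      have h1 : |η z.1 * η z.2 * r| ≤ K ^ 2 * |r| := h.abs_mul_mul_le _ _ le_rfl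
      calc _ ≤ (K ^ 2 * |r|) * Real.exp (K ^ 2 * b) :=
            mul_le_mul h1 (Real.exp_le_exp.2 (h.abs_mul_mul_le _ _ hr)) (Real.exp_pos _).le
              (by positivity)
        _ = _ := by ring
  rwa [hlin, sub_zero] at this

/-- The exponent coupling four coordinates. -/
def quartic (s t u v w z a b c d : ℝ) : ℝ :=
  a * b * s + c * d * t + a * c * u + a * d * v + b * c * w + b * d * z

theorem abs_quartic_le (h : IsCoord P η K) {s t u v w z b : ℝ} (hs : |s| ≤ b) (ht : |t| ≤ b)
    (hu : |u| ≤ b) (hv : |v| ≤ b) (hw : |w| ≤ b) (hz : |z| ≤ b) (e₁ e₂ e₃ e₄ : E) :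
    |quartic s t u v w z (η e₁) (η e₂) (η e₃) (η e₄)| ≤ 6 * (K ^ 2 * b) := by
  have h1 := abs_le.1 (h.abs_mul_mul_le e₁ e₂ hs)
  have h2 := abs_le.1 (h.abs_mul_mul_le e₃ e₄ ht)
  have h3 := abs_le.1 (h.abs_mul_mul_le e₁ e₃ hu)
  have h4 := abs_le.1 (h.abs_mul_mul_le e₁ e₄ hv)
  have h5 := abs_le.1 (h.abs_mul_mul_le e₂ e₃ hw)
  have h6 := abs_le.1 (h.abs_mul_mul_le e₂ e₄ hz)
  rw [quartic, abs_le]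
  constructor <;> linarith

theorem quartic_sq_le (h : IsCoord P η K) (s t u v w z : ℝ) (e₁ e₂ e₃ e₄ : E) :
    quartic s t u v w z (η e₁) (η e₂) (η e₃) (η e₄) ^ 2 ≤
      6 * K ^ 4 * (s ^ 2 + t ^ 2 + u ^ 2 + v ^ 2 + w ^ 2 + z ^ 2) := by
  have hsq : ∀ (e e' : E) (r : ℝ), (η e * η e' * r) ^ 2 ≤ K ^ 4 * r ^ 2 := fun e e' r => by
    rw [mul_pow, ← sq_abs (η e * η e')]
    have := pow_le_pow_left₀ (abs_nonneg _) (h.abs_mul_le e e') 2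
    calc _ ≤ (K ^ 2) ^ 2 * r ^ 2 := mul_le_mul_of_nonneg_right this (sq_nonneg _)
      _ = _ := by ring
  have hsix : ∀ a b c d e f : ℝ, (a + b + c + d + e + f) ^ 2 ≤
      6 * (a ^ 2 + b ^ 2 + c ^ 2 + d ^ 2 + e ^ 2 + f ^ 2) := fun a b c d e f => by
    nlinarith [sq_nonneg (a - b), sq_nonneg (a - c), sq_nonneg (a - d), sq_nonneg (a - e),
      sq_nonneg (a - f), sq_nonneg (b - c), sq_nonneg (b - d), sq_nonneg (b - e),
      sq_nonneg (b - f), sq_nonneg (c - d), sq_nonneg (c - e), sq_nonneg (c - f),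
      sq_nonneg (d - e), sq_nonneg (d - f), sq_nonneg (e - f)]
  refine (hsix _ _ _ _ _ _).trans ?_
  linarith [hsq e₁ e₂ s, hsq e₃ e₄ t, hsq e₁ e₃ u, hsq e₁ e₄ v, hsq e₂ e₃ w, hsq e₂ e₄ z]

/-- A monomial containing some coordinate to the first power has mean zero. The survivors are s t
from the constant and -s t from each of the terms -s c d and -t a b. -/
theorem integral_quartic (h : IsCoord P η K) (s t u v w z : ℝ) :
    ∫ e₁, ∫ e₂, ∫ e₃, ∫ e₄, (η e₁ * η e₂ - s) * (η e₃ * η e₄ - t) *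
      (1 + quartic s t u v w z (η e₁) (η e₂) (η e₃) (η e₄)) ∂P ∂P ∂P ∂P = -(t * s) := by
  have h4 : ∀ e₁ e₂ e₃, ∫ e₄, (η e₁ * η e₂ - s) * (η e₃ * η e₄ - t) *
      (1 + quartic s t u v w z (η e₁) (η e₂) (η e₃) (η e₄)) ∂P =
      (η e₁ * η e₂ - s) * (-t * (1 + η e₁ * η e₂ * s + η e₁ * η e₃ * u + η e₂ * η e₃ * w) +
        η e₃ * (η e₃ * t + η e₁ * v + η e₂ * z)) := fun e₁ e₂ e₃ => by
    rw [h.integral_eq_of_quadratic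
      ((η e₁ * η e₂ - s) * (-t * (1 + η e₁ * η e₂ * s + η e₁ * η e₃ * u + η e₂ * η e₃ * w)))
      ((η e₁ * η e₂ - s) * (η e₃ * (1 + η e₁ * η e₂ * s + η e₁ * η e₃ * u + η e₂ * η e₃ * w) -
        t * (η e₃ * t + η e₁ * v + η e₂ * z)))
      ((η e₁ * η e₂ - s) * (η e₃ * (η e₃ * t + η e₁ * v + η e₂ * z)))
      fun e₄ => by simp only [quartic]; ring]
    ring
  have h3 : ∀ e₁ e₂, ∫ e₃, (η e₁ * η e₂ - s) *
      (-t * (1 + η e₁ * η e₂ * s + η e₁ * η e₃ * u + η e₂ * η e₃ * w) +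
        η e₃ * (η e₃ * t + η e₁ * v + η e₂ * z)) ∂P =
      -(t * s) * (η e₁ ^ 2 * η e₂ ^ 2 - s * (η e₁ * η e₂)) := fun e₁ e₂ => by
    rw [h.integral_eq_of_quadratic ((η e₁ * η e₂ - s) * (-t * (1 + η e₁ * η e₂ * s)))
      ((η e₁ * η e₂ - s) * (-t * (η e₁ * u + η e₂ * w) + η e₁ * v + η e₂ * z))
      ((η e₁ * η e₂ - s) * t) fun e₃ => by ring]
    ring
  have h2 : ∀ e₁, ∫ e₂, -(t * s) * (η e₁ ^ 2 * η e₂ ^ 2 - s * (η e₁ * η e₂)) ∂P =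
      -(t * s) * η e₁ ^ 2 := fun e₁ => by
    rw [h.integral_eq_of_quadratic 0 (t * s * s * η e₁) (-(t * s) * η e₁ ^ 2)
      fun e₂ => by ring]
    ring
  simp only [h4, h3, h2]
  rw [h.integral_eq_of_quadratic 0 0 (-(t * s)) fun e => by ring]
  ring

/-- The first-order expansion leaves only -(t s), so both this term and the Taylor remainder are
quadratic in the six pair overlaps. -/
theorem abs_integral_quartic_exp_le (h : IsCoord P η K) {s t u v w z b : ℝ} (hs : |s| ≤ b)
    (ht : |t| ≤ b) (hu : |u| ≤ b) (hv : |v| ≤ b) (hw : |w| ≤ b) (hz : |z| ≤ b) :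
    |∫ x, (η x.1.1 * η x.1.2 - s) * (η x.2.1 * η x.2.2 - t) *
      Real.exp (quartic s t u v w z (η x.1.1) (η x.1.2) (η x.2.1) (η x.2.2))
      ∂(P.prod P).prod (P.prod P)| ≤
      (1 + (K ^ 2 + b) ^ 2 * (6 * K ^ 4 * Real.exp (6 * (K ^ 2 * b)))) *
        (s ^ 2 + t ^ 2 + u ^ 2 + v ^ 2 + w ^ 2 + z ^ 2) := by
  have hη := h.measurable_coord
  have hb : 0 ≤ b := (abs_nonneg _).trans hs
  have hq := h.abs_quartic_le hs ht hu hv hw hz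
  have hqm : Measurable fun x : (E × E) × (E × E) =>
      quartic s t u v w z (η x.1.1) (η x.1.2) (η x.2.1) (η x.2.2) := by
    unfold quartic
    fun_prop
  have hpre : ∀ e₁ e₂ e₃ e₄, |(η e₁ * η e₂ - s) * (η e₃ * η e₄ - t)| ≤ (K ^ 2 + b) ^ 2 :=
    fun e₁ e₂ e₃ e₄ => by
      rw [abs_mul, sq (K ^ 2 + b)]
      exact mul_le_mul (h.abs_mul_sub_le _ _ hs) (h.abs_mul_sub_le _ _ ht) (abs_nonneg _)
        (by positivity)
  have hbd : ∀ e₁ e₂ e₃ e₄, |(η e₁ * η e₂ - s) * (η e₃ * η e₄ - t) *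
      (1 + quartic s t u v w z (η e₁) (η e₂) (η e₃) (η e₄))| ≤
      (K ^ 2 + b) ^ 2 * (1 + 6 * (K ^ 2 * b)) := fun e₁ e₂ e₃ e₄ => by
    rw [abs_mul]
    exact mul_le_mul (hpre _ _ _ _) ((abs_add_le _ _).trans
      (add_le_add (by simp) (hq _ _ _ _))) (abs_nonneg _) (by positivity)
  have hlin := integral_four (P := P) (f := fun e₁ e₂ e₃ e₄ =>
    (η e₁ * η e₂ - s) * (η e₃ * η e₄ - t) *
      (1 + quartic s t u v w z (η e₁) (η e₂) (η e₃) (η e₄))) (by fun_prop) hbd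
  rw [h.integral_quartic] at hlin
  have := abs_integral_sub_le ((P.prod P).prod (P.prod P))
    (f := fun x => (η x.1.1 * η x.1.2 - s) * (η x.2.1 * η x.2.2 - t) *
      Real.exp (quartic s t u v w z (η x.1.1) (η x.1.2) (η x.2.1) (η x.2.2)))
    (g := fun x => (η x.1.1 * η x.1.2 - s) * (η x.2.1 * η x.2.2 - t) *
      (1 + quartic s t u v w z (η x.1.1) (η x.1.2) (η x.2.1) (η x.2.2)))
    (by fun_prop) (by fun_prop) (c := (K ^ 2 + b) ^ 2 * Real.exp (6 * (K ^ 2 * b)))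
    (fun x => by
      rw [abs_mul, abs_of_pos (Real.exp_pos _)]
      exact mul_le_mul (hpre _ _ _ _) (Real.exp_le_exp.2 ((le_abs_self _).trans (hq _ _ _ _)))
        (Real.exp_pos _).le (by positivity)) (fun x => hbd _ _ _ _)
    (d := (K ^ 2 + b) ^ 2 * (6 * K ^ 4 * (s ^ 2 + t ^ 2 + u ^ 2 + v ^ 2 + w ^ 2 + z ^ 2) *
      Real.exp (6 * (K ^ 2 * b)))) fun x => by
      rw [← mul_sub, ← sub_sub, abs_mul]
      refine mul_le_mul (hpre _ _ _ _) ?_ (abs_nonneg _) (by positivity)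
      refine (abs_exp_sub_one_sub_le_mul_exp _).trans ?_
      exact mul_le_mul (h.quartic_sq_le _ _ _ _ _ _ _ _ _ _)
        (Real.exp_le_exp.2 (hq _ _ _ _)) (Real.exp_pos _).le (by positivity)
  rw [hlin] at this
  have hst : |(-(t * s))| ≤ s ^ 2 + t ^ 2 + u ^ 2 + v ^ 2 + w ^ 2 + z ^ 2 := by
    rw [abs_le]
    constructor <;> nlinarith [sq_nonneg (s - t), sq_nonneg (s + t), sq_nonneg u, sq_nonneg v,
      sq_nonneg w, sq_nonneg z]
  have h3 := abs_sub_abs_le_abs_sub (∫ x, (η x.1.1 * η x.1.2 - s) * (η x.2.1 * η x.2.2 - t) *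
      Real.exp (quartic s t u v w z (η x.1.1) (η x.1.2) (η x.2.1) (η x.2.2))
      ∂(P.prod P).prod (P.prod P)) (-(t * s))
  linarith

end IsCoord

/-! ### Cavity estimates at scale r = √N -/

/-- A constant bounding the error terms of the cavity method. -/
def cavityConst (s b K : ℝ) : ℝ :=
  (K ^ 2 + b) * (K ^ 4 * Real.exp (K ^ 2 * b)) + (K ^ 4 + 1) * (K ^ 2 * Real.exp (K ^ 2 * b)) +
    (1 + |s|) * Real.exp (b / 2) * (K ^ 4 * Real.exp (K ^ 2 * b) +
      12 * (1 + (K ^ 2 + b) ^ 2 * (6 * K ^ 4 * Real.exp (6 * (K ^ 2 * b)))) +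
      6 * (((K ^ 4 + 1) * Real.exp (K ^ 2 * b)) * ((K ^ 4 + 1) * Real.exp (K ^ 2 * b)) *
        Real.exp (4 * (K ^ 2 * b))))

theorem cavityConst_nonneg (s : ℝ) {b : ℝ} (hb : 0 ≤ b) (K : ℝ) : 0 ≤ cavityConst s b K := by
  unfold cavityConst
  positivity

namespace IsCavity

variable {N M : ℕ} {X E : Type*} [MeasurableSpace X] [MeasurableSpace E] {P : Measure E}
  {T τ : X → Fin N → Fin M → ℝ} {η : E → ℝ} {b K : ℝ} [IsProbabilityMeasure P]

theorem isCoord (h : IsCavity P T τ η b K) : IsCoord P η K :=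
  ⟨h.measurable_coord, h.coord_le, h.mean_zero, h.unit_variance⟩

/-- The dominating function in the moment estimates. -/
def momentFun (τ : X → Fin N → Fin M → ℝ) (r : ℝ) (φ : X × X → ℝ) (p : X × X) : ℝ :=
  1 + r ^ 4 * (φ p ^ 4 + fieldOverlap τ p ^ 4)

theorem measurable_momentFun (h : IsCavity P T τ η b K) (r : ℝ) {φ : X × X → ℝ}
    (hφ : Measurable φ) : Measurable (momentFun τ r φ) := by
  have := h.measurable_fieldOverlap
  unfold momentFun
  fun_prop

theorem one_le_momentFun (τ : X → Fin N → Fin M → ℝ) (r : ℝ) (φ : X × X → ℝ) (p : X × X) :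
    1 ≤ momentFun τ r φ p := by
  unfold momentFun
  have : 0 ≤ r ^ 4 * (φ p ^ 4 + fieldOverlap τ p ^ 4) := by positivity
  linarith

theorem abs_const_mul_momentFun_le (h : IsCavity P T τ η b K) (r : ℝ) {φ : X × X → ℝ} {c : ℝ}
    (hc : ∀ p, |φ p| ≤ c) (a : ℝ) (p : X × X) :
    |a * momentFun τ r φ p| ≤ |a| * (1 + r ^ 4 * (c ^ 4 + b ^ 4)) := by
  rw [abs_mul, abs_of_pos (zero_lt_one.trans_le (one_le_momentFun τ r φ p))]
  unfold momentFun
  have h1 := pow_le_pow_left₀ (abs_nonneg _) (hc p) 4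
  have h2 := pow_le_pow_left₀ (abs_nonneg _) (h.abs_fieldOverlap_le p) 4
  rw [Even.pow_abs (by decide)] at h1 h2
  gcongr

section Young

variable {r : ℝ} (φ : X × X → ℝ) (p : X × X)

/-- When φ and the field overlap are of order 1/r, `momentFun` is of order one. Young's inequality
for rφ and r²S² extracts the third power of 1/r. -/
theorem abs_mul_sq_le_momentFun (hr : 0 < r) :
    |φ p| * fieldOverlap τ p ^ 2 ≤ momentFun τ r φ p / r ^ 3 := by
  rw [le_div_iff₀ (by positivity), momentFun]
  have h1 : (φ p) ^ 4 = |φ p| ^ 4 := (Even.pow_abs (by decide) _).symm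
  have h2 : (fieldOverlap τ p) ^ 4 = (fieldOverlap τ p ^ 2) ^ 2 := by ring
  rw [h1, h2]
  have : ∀ x y : ℝ, 0 ≤ x → 0 ≤ y → x * y ≤ 1 + (x ^ 4 + y ^ 2) := fun x y hx hy => by
    nlinarith [sq_nonneg (x - y), sq_nonneg (x ^ 2 - 1)]
  have h3 := this (r * |φ p|) (r ^ 2 * fieldOverlap τ p ^ 2) (by positivity) (by positivity)
  calc _ = (r * |φ p|) * (r ^ 2 * fieldOverlap τ p ^ 2) := by ring
    _ ≤ _ := h3
    _ = _ := by ring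

theorem sq_le_momentFun (hr : 0 < r) : fieldOverlap τ p ^ 2 ≤ momentFun τ r φ p / r ^ 2 := by
  rw [le_div_iff₀ (by positivity), momentFun]
  have h1 : 0 ≤ r ^ 4 * φ p ^ 4 := by positivity
  nlinarith [sq_nonneg (r ^ 2 * fieldOverlap τ p ^ 2 - 1), sq_nonneg (r ^ 2 * fieldOverlap τ p ^ 2)]

theorem abs_le_momentFun (hr : 0 < r) : |fieldOverlap τ p| ≤ momentFun τ r φ p / r := by
  rw [le_div_iff₀ hr]
  have h1 := sq_le_momentFun (τ := τ) φ p hr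
  have h2 := one_le_momentFun τ r φ p
  rw [le_div_iff₀ (by positivity), ← sq_abs] at h1
  nlinarith [sq_nonneg (|fieldOverlap τ p| * r - 1), abs_nonneg (fieldOverlap τ p)]

theorem pow_four_le_momentFun (hr : 0 < r) :
    φ p ^ 4 + fieldOverlap τ p ^ 4 ≤ momentFun τ r φ p / r ^ 4 := by
  rw [le_div_iff₀ (by positivity), momentFun]
  linarith

/-- Young's inequality turns all products into fourth powers, which are two-replica quantities. The
six overlap squares each spend φ⁴/4 on both given pairs, hence the factor 2. -/
theorem abs_mul_mul_sum_sq_le (q : (X × X) × (X × X)) :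
    |φ q.1 * φ q.2| * (fieldOverlap τ q.1 ^ 2 + fieldOverlap τ q.2 ^ 2 +
      fieldOverlap τ (q.1.1, q.2.1) ^ 2 + fieldOverlap τ (q.1.1, q.2.2) ^ 2 +
      fieldOverlap τ (q.1.2, q.2.1) ^ 2 + fieldOverlap τ (q.1.2, q.2.2) ^ 2) ≤
      sumPairs (fun p => 2 * (φ p ^ 4 + fieldOverlap τ p ^ 4)) q := by
  have hφ : |φ q.1 * φ q.2| ^ 2 ≤ (φ q.1 ^ 4 + φ q.2 ^ 4) / 2 := by
    rw [sq_abs]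
    nlinarith [sq_nonneg (φ q.1 ^ 2 - φ q.2 ^ 2)]
  have hx : ∀ x : ℝ, |φ q.1 * φ q.2| * x ^ 2 ≤ (φ q.1 ^ 4 + φ q.2 ^ 4) / 4 + x ^ 4 / 2 :=
    fun x => by nlinarith [sq_nonneg (|φ q.1 * φ q.2| - x ^ 2)]
  have hp : ∀ x : ℝ, 0 ≤ x ^ 4 := fun x => by positivity
  simp only [sumPairs]
  linarith [hx (fieldOverlap τ q.1), hx (fieldOverlap τ q.2), hx (fieldOverlap τ (q.1.1, q.2.1)),
    hx (fieldOverlap τ (q.1.1, q.2.2)), hx (fieldOverlap τ (q.1.2, q.2.1)),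
    hx (fieldOverlap τ (q.1.2, q.2.2)), hp (φ (q.1.1, q.2.1)), hp (φ (q.1.1, q.2.2)),
    hp (φ (q.1.2, q.2.1)), hp (φ (q.1.2, q.2.2)), hp (fieldOverlap τ q.1),
    hp (fieldOverlap τ q.2), hp (fieldOverlap τ (q.1.1, q.2.1)),
    hp (fieldOverlap τ (q.1.1, q.2.2)), hp (fieldOverlap τ (q.1.2, q.2.1)),
    hp (fieldOverlap τ (q.1.2, q.2.2)), hp (φ q.1), hp (φ q.2)]

end Young

theorem sumPairs_const_mul (a : ℝ) (F : X × X → ℝ) (q : (X × X) × (X × X)) :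
    sumPairs (fun p => a * F p) q = a * sumPairs F q := by
  simp only [sumPairs]
  ring

theorem sumPairs_mono {F G : X × X → ℝ} (h : ∀ p, F p ≤ G p) (q : (X × X) × (X × X)) :
    sumPairs F q ≤ sumPairs G q := by
  simp only [sumPairs]
  linarith [h q.1, h q.2, h (q.1.1, q.2.1), h (q.1.1, q.2.2), h (q.1.2, q.2.1), h (q.1.2, q.2.2)]

theorem kernelSq_eq (Q : X × X → E × E → ℝ) (q : (X × X) × (X × X)) (ε : (E × E) × (E × E)) :
    kernelSq τ η Q q ε = Q q.1 ε.1 * Q q.2 ε.2 *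
      Real.exp (IsCoord.quartic (fieldOverlap τ q.1) (fieldOverlap τ q.2)
        (fieldOverlap τ (q.1.1, q.2.1)) (fieldOverlap τ (q.1.1, q.2.2))
        (fieldOverlap τ (q.1.2, q.2.1)) (fieldOverlap τ (q.1.2, q.2.2))
        (η ε.1.1) (η ε.1.2) (η ε.2.1) (η ε.2.2)) := by
  rw [kernelSq, kernel, kernel, mul_mul_mul_comm, ← Real.exp_add, mul_assoc, ← Real.exp_add]
  congr 2
  simp only [IsCoord.quartic, pairField, dot_add_left, dot_add_right, dot_smul_left,
    dot_smul_right, fieldOverlap]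
  ring

variable (ρ : Measure X) [IsProbabilityMeasure ρ]

/-- The cavity equation for an observable that contains the two new coordinates. -/
theorem norm_obs_sub_le (h : IsCavity P T τ η b K) (hb : 0 ≤ b) (s : ℝ) {r : ℝ} (hr : 0 < r)
    {φ : X × X → ℝ} (hφ : Measurable φ) {c : ℝ} (hc : ∀ p, |φ p| ≤ c) {m : ℝ}
    (hm : nishimori ρ T (momentFun τ r φ) ≤ m) :
    ‖obs (ρ.prod P) (extSignal T τ η) s
      (lift fun p ε => (η ε.1 * η ε.2 - fieldOverlap τ p) * φ p)‖ ≤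
      cavityConst s b K * m / r ^ 3 := by
  have hη := h.measurable_coord
  have hS := h.measurable_fieldOverlap
  have hco := h.isCoord
  have hΨ := h.measurable_momentFun r hφ
  set Ψ := momentFun τ r φ with hΨdef
  have hE0 : 0 ≤ nishimori ρ T Ψ := by
    refine integral_nonneg fun Y => mul_nonneg
      (inv_nonneg.2 (partition_pos ρ h.measurable_signal Y).le) (pairInt_nonneg ρ Y fun p => ?_)
    exact zero_le_one.trans (one_le_momentFun τ r φ p)
  have hm0 : 0 ≤ m := hE0.trans hm
  set c₁ := (K ^ 2 + b) * (K ^ 4 * Real.exp (K ^ 2 * b)) with hc₁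
  set c₂ := K ^ 4 * Real.exp (K ^ 2 * b) with hc₂
  set c₄ := 1 + (K ^ 2 + b) ^ 2 * (6 * K ^ 4 * Real.exp (6 * (K ^ 2 * b))) with hc₄
  have hc₁0 : 0 ≤ c₁ := by positivity
  have hc₂0 : 0 ≤ c₂ := by positivity
  have hc₄0 : 0 ≤ c₄ := by positivity
  -- The chi-square term is of order r⁻² and the four-replica term of order r⁻⁴. The weight δ = 1/r
  -- brings both to r⁻³, the order of the main term.
  have hmain := h.norm_obs_lift_le ρ hb s (δ := r⁻¹) (inv_pos.2 hr)
    (Q := fun p ε => (η ε.1 * η ε.2 - fieldOverlap τ p) * φ p)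
    (by unfold Function.uncurry; fun_prop) (c := (K ^ 2 + b) * c)
    (fun p ε => by
      rw [abs_mul]
      exact mul_le_mul (hco.abs_mul_sub_le _ _ (h.abs_fieldOverlap_le p)) (hc p) (abs_nonneg _)
        (by positivity))
    (F₁ := fun p => c₁ / r ^ 3 * Ψ p) (by fun_prop) (h.abs_const_mul_momentFun_le r hc _)
    (fun p => by
      have e1 : ∀ ε : E × E, kernel τ η
          (fun p ε => (η ε.1 * η ε.2 - fieldOverlap τ p) * φ p) p ε =
          φ p * ((η ε.1 * η ε.2 - fieldOverlap τ p) *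
            Real.exp (η ε.1 * η ε.2 * fieldOverlap τ p)) := fun ε => by
        simp only [kernel]; ring
      simp only [e1]
      rw [integral_const_mul, abs_mul]
      calc _ ≤ |φ p| * (c₁ * fieldOverlap τ p ^ 2) := by
            gcongr
            exact hco.abs_integral_sub_mul_exp_le (h.abs_fieldOverlap_le p)
        _ = c₁ * (|φ p| * fieldOverlap τ p ^ 2) := by ring
        _ ≤ c₁ * (Ψ p / r ^ 3) := by
            gcongr
            exact abs_mul_sq_le_momentFun φ p hr
        _ = _ := by ring)
    (F₂ := fun p => c₂ / r ^ 2 * Ψ p) (by fun_prop) (h.abs_const_mul_momentFun_le r hc _)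
    (fun p => by
      simp only [kernel, one_mul]
      refine (hco.integral_exp_le (h.abs_fieldOverlap_le p)).trans ?_
      have := mul_le_mul_of_nonneg_left (sq_le_momentFun (τ := τ) φ p hr) hc₂0
      calc _ ≤ 1 + c₂ * (Ψ p / r ^ 2) := by linarith
        _ = _ := by ring)
    (F₃ := fun p => 2 * c₄ / r ^ 4 * Ψ p) (by fun_prop) (h.abs_const_mul_momentFun_le r hc _)
    (fun q => by
      have e1 : ∀ ε : (E × E) × (E × E), kernelSq τ η
          (fun p ε => (η ε.1 * η ε.2 - fieldOverlap τ p) * φ p) q ε =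
          (φ q.1 * φ q.2) * ((η ε.1.1 * η ε.1.2 - fieldOverlap τ q.1) *
            (η ε.2.1 * η ε.2.2 - fieldOverlap τ q.2) *
            Real.exp (IsCoord.quartic (fieldOverlap τ q.1) (fieldOverlap τ q.2)
              (fieldOverlap τ (q.1.1, q.2.1)) (fieldOverlap τ (q.1.1, q.2.2))
              (fieldOverlap τ (q.1.2, q.2.1)) (fieldOverlap τ (q.1.2, q.2.2))
              (η ε.1.1) (η ε.1.2) (η ε.2.1) (η ε.2.2))) := fun ε => by
        rw [kernelSq_eq]; ring
      simp only [e1]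
      rw [integral_const_mul, abs_mul]
      have e2 := hco.abs_integral_quartic_exp_le (h.abs_fieldOverlap_le q.1)
        (h.abs_fieldOverlap_le q.2) (h.abs_fieldOverlap_le (q.1.1, q.2.1))
        (h.abs_fieldOverlap_le (q.1.1, q.2.2)) (h.abs_fieldOverlap_le (q.1.2, q.2.1))
        (h.abs_fieldOverlap_le (q.1.2, q.2.2))
      refine (mul_le_mul_of_nonneg_left e2 (abs_nonneg _)).trans ?_
      rw [← hc₄, mul_left_comm]
      refine (mul_le_mul_of_nonneg_left (abs_mul_mul_sum_sq_le φ q) hc₄0).trans ?_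
      rw [← sumPairs_const_mul]
      refine sumPairs_mono (fun p => ?_) q
      have := mul_le_mul_of_nonneg_left (pow_four_le_momentFun (τ := τ) φ p hr)
        (mul_nonneg zero_le_two hc₄0)
      calc _ = 2 * c₄ * (φ p ^ 4 + fieldOverlap τ p ^ 4) := by ring
        _ ≤ _ := this
        _ = _ := by ring)
  refine hmain.trans ?_
  rw [nishimori_const_mul, nishimori_const_mul, nishimori_const_mul]
  calc _ ≤ c₁ / r ^ 3 * m + (1 + |s|) * Real.exp (b / 2) *
        (r⁻¹ * (c₂ / r ^ 2 * m) + r⁻¹⁻¹ * (6 * (2 * c₄ / r ^ 4 * m))) := by gcongr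
    _ = (c₁ + (1 + |s|) * Real.exp (b / 2) * (c₂ + 12 * c₄)) * m / r ^ 3 := by
        field_simp
        ring
    _ ≤ _ := by
        gcongr
        rw [cavityConst, ← hc₁, ← hc₂, ← hc₄]
        have h1 : 0 ≤ (K ^ 4 + 1) * (K ^ 2 * Real.exp (K ^ 2 * b)) := by positivity
        have h2 : 0 ≤ (1 + |s|) * Real.exp (b / 2) * (6 * (((K ^ 4 + 1) * Real.exp (K ^ 2 * b)) *
          ((K ^ 4 + 1) * Real.exp (K ^ 2 * b)) * Real.exp (4 * (K ^ 2 * b)))) := by positivity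
        linarith

/-- The new coordinates of two replicas decouple. -/
theorem norm_obs_sq_sub_one_le (h : IsCavity P T τ η b K) (hb : 0 ≤ b) (s : ℝ) {r : ℝ}
    (hr : 0 < r) {φ : X × X → ℝ} (hφ : Measurable φ) {c : ℝ} (hc : ∀ p, |φ p| ≤ c) {m : ℝ}
    (hm : nishimori ρ T (momentFun τ r φ) ≤ m) :
    ‖obs (ρ.prod P) (extSignal T τ η) s (lift fun _ ε => (η ε.1 * η ε.2) ^ 2 - 1)‖ ≤
      cavityConst s b K * m / r := by
  have hη := h.measurable_coord
  have hS := h.measurable_fieldOverlap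
  have hco := h.isCoord
  have hΨ := h.measurable_momentFun r hφ
  set Ψ := momentFun τ r φ with hΨdef
  have hE0 : 0 ≤ nishimori ρ T Ψ := by
    refine integral_nonneg fun Y => mul_nonneg
      (inv_nonneg.2 (partition_pos ρ h.measurable_signal Y).le) (pairInt_nonneg ρ Y fun p => ?_)
    exact zero_le_one.trans (one_le_momentFun τ r φ p)
  have hm0 : 0 ≤ m := hE0.trans hm
  set c₁ := (K ^ 4 + 1) * (K ^ 2 * Real.exp (K ^ 2 * b)) with hc₁
  set c₂ := K ^ 4 * Real.exp (K ^ 2 * b) with hc₂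
  set c₅ := ((K ^ 4 + 1) * Real.exp (K ^ 2 * b)) * ((K ^ 4 + 1) * Real.exp (K ^ 2 * b)) *
        Real.exp (4 * (K ^ 2 * b)) with hc₅
  have hc₁0 : 0 ≤ c₁ := by positivity
  have hc₂0 : 0 ≤ c₂ := by positivity
  have hc₅0 : 0 ≤ c₅ := by positivity
  have hQ : Measurable (Function.uncurry fun (_ : X × X) (ε : E × E) =>
      (η ε.1 * η ε.2) ^ 2 - 1) := by unfold Function.uncurry; fun_prop
  have hQc : ∀ (p : X × X) (ε : E × E), |(η ε.1 * η ε.2) ^ 2 - 1| ≤ K ^ 4 + 1 := fun p ε => by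
    refine (abs_sub _ _).trans (add_le_add ?_ (by simp))
    rw [abs_pow]
    exact (pow_le_pow_left₀ (abs_nonneg _) (hco.abs_mul_le _ _) 2).trans_eq (by ring)
  -- Here the four-replica term is only bounded, while the chi-square term is of order r⁻². The
  -- weight δ = r balances them at 1/r.
  have hmain := h.norm_obs_lift_le ρ hb s (δ := r) hr hQ hQc
    (F₁ := fun p => c₁ / r * Ψ p) (by fun_prop) (h.abs_const_mul_momentFun_le r hc _)
    (fun p => by
      simp only [kernel]
      calc _ ≤ c₁ * |fieldOverlap τ p| :=
            hco.abs_integral_sq_sub_one_mul_exp_le (h.abs_fieldOverlap_le p)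
        _ ≤ c₁ * (Ψ p / r) := by
            gcongr
            exact abs_le_momentFun φ p hr
        _ = _ := by ring)
    (F₂ := fun p => c₂ / r ^ 2 * Ψ p) (by fun_prop) (h.abs_const_mul_momentFun_le r hc _)
    (fun p => by
      simp only [kernel, one_mul]
      refine (hco.integral_exp_le (h.abs_fieldOverlap_le p)).trans ?_
      have := mul_le_mul_of_nonneg_left (sq_le_momentFun (τ := τ) φ p hr) hc₂0
      calc _ ≤ 1 + c₂ * (Ψ p / r ^ 2) := by linarith
        _ = _ := by ring)
    (F₃ := fun p => c₅ * Ψ p) (by fun_prop) (h.abs_const_mul_momentFun_le r hc _)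
    (fun q => by
      have e1 : |∫ ε, kernelSq τ η (fun _ ε => (η ε.1 * η ε.2) ^ 2 - 1) q ε
          ∂(P.prod P).prod (P.prod P)| ≤ c₅ := by
        rw [← Real.norm_eq_abs]
        refine (norm_integral_le_of_norm_le (integrable_const c₅)
          (Filter.Eventually.of_forall fun ε => h.abs_kernelSq_le hQc q ε)).trans_eq ?_
        simp
      have hp := fun p => mul_le_mul_of_nonneg_left (one_le_momentFun τ r φ p) hc₅0
      simp only [sumPairs]
      linarith [hp q.1, hp q.2, hp (q.1.1, q.2.1), hp (q.1.1, q.2.2), hp (q.1.2, q.2.1),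
        hp (q.1.2, q.2.2)])
  refine hmain.trans ?_
  rw [nishimori_const_mul, nishimori_const_mul, nishimori_const_mul]
  calc _ ≤ c₁ / r * m + (1 + |s|) * Real.exp (b / 2) *
        (r * (c₂ / r ^ 2 * m) + r⁻¹ * (6 * (c₅ * m))) := by gcongr
    _ = (c₁ + (1 + |s|) * Real.exp (b / 2) * (c₂ + 6 * c₅)) * m / r := by
        field_simp
    _ ≤ _ := by
        gcongr
        rw [cavityConst, ← hc₁, ← hc₂, ← hc₅]
        have h1 : 0 ≤ (K ^ 2 + b) * (K ^ 4 * Real.exp (K ^ 2 * b)) := by positivity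
        have h2 : 0 ≤ (1 + |s|) * Real.exp (b / 2) * (12 *
          (1 + (K ^ 2 + b) ^ 2 * (6 * K ^ 4 * Real.exp (6 * (K ^ 2 * b))))) := by positivity
        linarith

end IsCavity

/-! ### Planted averages and the second moment -/

section SecondMoment

variable {N M : ℕ} {X : Type*} [MeasurableSpace X] (ρ : Measure X) [IsProbabilityMeasure ρ]
  {T : X → Fin N → Fin M → ℝ}

/-- Two merged tilts integrate to one over the noise and leave exp⟨T, T'⟩. The invariant integrand
is the constant one, so a one-point parameter space suffices. -/
theorem integral_pairInt (hT : Measurable T) {B : ℝ} (hB : ∀ p : X × X, dot (T p.1) (T p.2) ≤ B)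
    {F : X × X → ℝ} (hF : Measurable F) {c : ℝ} (hc : ∀ p, |F p| ≤ c) :
    Integrable (fun Y => pairInt ρ T Y F) (noise N M) ∧
    ∫ Y, pairInt ρ T Y F ∂noise N M =
      ∫ p, F p * Real.exp (dot (T p.1) (T p.2)) ∂ρ.prod ρ := by
  obtain ⟨h1, h2⟩ := integral_tilt_of_invariant (N := N) (M := M) (F := ℝ)
    (Measure.dirac ()) (ρ.prod ρ) (t := fun _ p => T p.1 + T p.2)
    (by unfold Function.uncurry; fun_prop) (G := fun _ _ => 1)
    (by unfold Function.uncurry; exact stronglyMeasurable_const) (fun _ _ _ => rfl)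
    (by unfold Function.uncurry; exact integrable_const _)
    (B := fun _ p => F p * Real.exp (dot (T p.1) (T p.2))) (by unfold Function.uncurry; fun_prop)
    (c := c * Real.exp B) (fun _ p => by
      rw [abs_mul, abs_of_pos (Real.exp_pos _)]
      exact mul_le_mul (hc p) (Real.exp_le_exp.2 (hB p)) (Real.exp_pos _).le
        ((abs_nonneg _).trans (hc p)))
  have hrew : ∀ Y, ∫ p, tilt Y (T p.1 + T p.2) * (F p * Real.exp (dot (T p.1) (T p.2)))
      ∂ρ.prod ρ = pairInt ρ T Y F := fun Y => by
    rw [pairInt]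
    refine integral_congr_ae (Filter.Eventually.of_forall fun p => ?_)
    simp only [pairWeight, tilt_mul_tilt]
    ring
  simp only [smul_eq_mul, mul_one, integral_dirac, hrew] at h1 h2
  refine ⟨h1, h2.trans ?_⟩
  simp

/-- The planted Gibbs expectation is controlled by the second moment of the likelihood ratio. -/
theorem nishimori_le_second_moment (hT : Measurable T) {B : ℝ}
    (hB : ∀ p : X × X, dot (T p.1) (T p.2) ≤ B)
    {F : X × X → ℝ} (hF : Measurable F) {c : ℝ} (hc : ∀ p, |F p| ≤ c) :
    nishimori ρ T F ≤ (1 + ∫ p, F p ^ 2 * Real.exp (dot (T p.1) (T p.2)) ∂ρ.prod ρ) / 2 := by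
  have hc2 : ∀ p, |F p ^ 2| ≤ c ^ 2 := fun p => by
    rw [abs_pow]; exact pow_le_pow_left₀ (abs_nonneg _) (hc p) 2
  obtain ⟨h1, h2⟩ := integral_pairInt ρ hT hB (F := fun p => F p ^ 2) (by fun_prop) hc2
  rw [← h2]
  have i1 : Integrable (fun Y => (1 + pairInt ρ T Y fun p => F p ^ 2) / 2) (noise N M) :=
    ((integrable_const _).add h1).div_const 2
  have e1 : (1 + ∫ Y, pairInt ρ T Y (fun p => F p ^ 2) ∂noise N M) / 2 =
      ∫ Y, (1 + pairInt ρ T Y fun p => F p ^ 2) / 2 ∂noise N M := by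
    rw [integral_div, integral_add (integrable_const _) h1]
    simp
  rw [e1, nishimori]
  refine integral_mono (integrable_nishimori ρ hT hF hc) i1 fun Y => ?_
  have hpos := partition_pos ρ hT Y
  set L := partition ρ T Y
  -- Pointwise AM–GM with the random weight L: after averaging and multiplying by 1/L, the first
  -- term becomes the constant 1/2 and the second loses its normalisation altogether.
  have hF2 : ∀ p, F p ≤ L⁻¹ / 2 + L / 2 * F p ^ 2 := fun p => by
    have : 0 ≤ (1 - L * F p) ^ 2 / (2 * L) := by positivity
    have e : (1 - L * F p) ^ 2 / (2 * L) = L⁻¹ / 2 + L / 2 * F p ^ 2 - F p := by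
      field_simp
      ring
    linarith
  have hcm : ∀ p, |L / 2 * F p ^ 2| ≤ |L / 2| * c ^ 2 := fun p => by
    rw [abs_mul]; exact mul_le_mul_of_nonneg_left (hc2 p) (abs_nonneg _)
  have hm := pairInt_mono ρ hT Y hF hc (G := fun p => L⁻¹ / 2 + L / 2 * F p ^ 2) (by fun_prop)
    (c' := |L⁻¹ / 2| + |L / 2| * c ^ 2)
    (fun p => (abs_add_le _ _).trans (add_le_add le_rfl (hcm p))) hF2
  rw [pairInt_add ρ hT Y measurable_const (c := |L⁻¹ / 2|) (fun _ => le_rfl) (by fun_prop) hcm,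
    pairInt_const, pairInt_const_mul] at hm
  calc L⁻¹ * pairInt ρ T Y F ≤
        L⁻¹ * (L ^ 2 * (L⁻¹ / 2) + L / 2 * pairInt ρ T Y fun p => F p ^ 2) := by gcongr
    _ = _ := by
      field_simp

end SecondMoment

/-! ### Exponential moments of products of sub-Gaussian variables -/

section SubGaussian

theorem integral_exp_sq_gaussianReal {c : ℝ} (hc : c < 1) :
    Integrable (fun g => Real.exp (c * g ^ 2 / 2)) (gaussianReal 0 1) ∧
    ∫ g, Real.exp (c * g ^ 2 / 2) ∂gaussianReal 0 1 = 1 / √(1 - c) := by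
  have hc' : 0 < 1 - c := by linarith
  have hpdf : ∀ g, gaussianPDFReal 0 1 g * Real.exp (c * g ^ 2 / 2) =
      (√(2 * Real.pi))⁻¹ * Real.exp (-((1 - c) / 2) * g ^ 2) := fun g => by
    simp only [gaussianPDFReal, NNReal.coe_one, mul_one, sub_zero]
    rw [mul_assoc, ← Real.exp_add]
    ring_nf
  constructor
  · rw [gaussianReal_of_var_ne_zero _ one_ne_zero,
      integrable_withDensity_iff_integrable_smul' (by fun_prop) (by simp [gaussianPDF])]
    simp only [toReal_gaussianPDF, smul_eq_mul, hpdf]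
    exact (integrable_exp_neg_mul_sq (by linarith)).const_mul _
  · rw [integral_gaussianReal_eq_integral_smul one_ne_zero]
    simp only [smul_eq_mul, hpdf]
    rw [integral_const_mul, integral_gaussian, ← Real.sqrt_inv, ← Real.sqrt_mul (by positivity),
      one_div, ← Real.sqrt_inv]
    congr 1
    field_simp

variable {A : Type*} [MeasurableSpace A] (α : Measure A) [IsProbabilityMeasure α]

/-- Gaussian linearisation: exp(c S²/2) is the mean of exp(√c S g) over a standard Gaussian g. After
exchanging the integrals the sub-Gaussian bound leaves the Gaussian integral of exp(c a g²/2). -/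
theorem integral_exp_sq_le {S : A → ℝ} (hS : Measurable S) {B : ℝ} (hB : ∀ x, |S x| ≤ B) {a : ℝ}
    (hsub : ∀ t, ∫ x, Real.exp (t * S x) ∂α ≤ Real.exp (t ^ 2 * a / 2)) {c : ℝ} (hc : 0 ≤ c)
    (hca : c * a < 1) : ∫ x, Real.exp (c * S x ^ 2 / 2) ∂α ≤ 1 / √(1 - c * a) := by
  have hlin : ∀ x, Real.exp (c * S x ^ 2 / 2) =
      ∫ g, Real.exp (√c * S x * g) ∂gaussianReal 0 1 := fun x => by
    have := congrFun (mgf_fun_id_gaussianReal (μ := 0) (v := 1)) (√c * S x)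
    simp only [mgf] at this
    rw [this]
    simp only [NNReal.coe_one, mul_pow, Real.sq_sqrt hc]
    ring_nf
  have hint : Integrable (fun p : A × ℝ => Real.exp (√c * S p.1 * p.2))
      (α.prod (gaussianReal 0 1)) := by
    have h1 : Integrable (fun g => Real.exp ((√c * B) * g) + Real.exp (-(√c * B) * g))
        (gaussianReal 0 1) :=
      (integrable_exp_mul_gaussianReal _).add (integrable_exp_mul_gaussianReal _)
    have h2 := h1.comp_snd (μ := α)
    refine h2.mono' (by fun_prop) (Filter.Eventually.of_forall fun p => ?_)
    rw [Real.norm_of_nonneg (Real.exp_pos _).le]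
    have h3 : √c * S p.1 * p.2 ≤ √c * B * |p.2| := by
      rw [mul_assoc, mul_assoc]
      refine mul_le_mul_of_nonneg_left ?_ (Real.sqrt_nonneg _)
      refine (le_abs_self _).trans ?_
      rw [abs_mul]
      exact mul_le_mul_of_nonneg_right (hB _) (abs_nonneg _)
    refine (Real.exp_le_exp.2 h3).trans ?_
    rcases abs_cases p.2 with ⟨h, _⟩ | ⟨h, _⟩ <;> rw [h]
    · exact le_add_of_nonneg_right (Real.exp_pos _).le
    · rw [mul_neg, ← neg_mul]
      exact le_add_of_nonneg_left (Real.exp_pos _).le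
  obtain ⟨j1, j2⟩ := integral_exp_sq_gaussianReal hca
  simp only [hlin]
  rw [integral_integral_swap hint, ← j2]
  refine integral_mono hint.integral_prod_right j1 fun g => ?_
  calc ∫ x, Real.exp (√c * S x * g) ∂α = ∫ x, Real.exp ((√c * g) * S x) ∂α := by
        congr 1; ext x; ring_nf
    _ ≤ _ := hsub _
    _ = _ := by rw [mul_pow, Real.sq_sqrt hc]; ring_nf

/-- A bound for the moments of bilinear exponential tilts of sub-Gaussian variables. -/
def momentConst (D δ : ℝ) : ℝ := 24 * (4 * D / δ) ^ 4 * (1 / √(δ / 2))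

/-- Integrating T first turns the bilinear exponent into a quadratic one in S. The polynomial factor
is absorbed by a small additional quadratic exponent, paid for by half of the gap δ. -/
theorem integral_pow_mul_exp_le {A' : Type*} [MeasurableSpace A'] (α' : Measure A')
    [IsProbabilityMeasure α'] {S : A → ℝ} (hS : Measurable S) {B : ℝ} (hB : ∀ x, |S x| ≤ B)
    {T : A' → ℝ} (hT : Measurable T) {B' : ℝ} (hB' : ∀ x, |T x| ≤ B') {a b : ℝ} (hb : 0 ≤ b)
    (hsub : ∀ t, ∫ x, Real.exp (t * S x) ∂α ≤ Real.exp (t ^ 2 * a / 2))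
    (hsub' : ∀ t, ∫ x, Real.exp (t * T x) ∂α' ≤ Real.exp (t ^ 2 * b / 2))
    {lam δ D n : ℝ} (hδ : 0 < δ) (hD : 0 < D) (hn : 0 < n) (hlam : lam ^ 2 * (a * b) ≤ 1 - δ)
    (ha : a ≤ D * n) :
    ∫ z, ((S z.1 ^ 2 / n) ^ 2) ^ 2 * Real.exp (lam * (S z.1 * T z.2)) ∂α.prod α' ≤
      momentConst D δ := by
  have hexpb : ∀ (x : A) (y : A'), Real.exp (lam * (S x * T y)) ≤ Real.exp (|lam| * (B * B')) :=
    fun x y => Real.exp_le_exp.2 <| by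
      refine (le_abs_self _).trans ?_
      rw [abs_mul, abs_mul]
      exact mul_le_mul_of_nonneg_left (mul_le_mul (hB _) (hB' _) (abs_nonneg _)
        ((abs_nonneg _).trans (hB x))) (abs_nonneg _)
  have hpow : ∀ x, ((S x ^ 2 / n) ^ 2) ^ 2 ≤ ((B ^ 2 / n) ^ 2) ^ 2 := fun x => by
    have := pow_le_pow_left₀ (abs_nonneg _) (hB x) 2
    rw [sq_abs] at this
    gcongr
  have hint : Integrable (fun z : A × A' =>
      ((S z.1 ^ 2 / n) ^ 2) ^ 2 * Real.exp (lam * (S z.1 * T z.2))) (α.prod α') :=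
    integrable_of_abs_le (c := ((B ^ 2 / n) ^ 2) ^ 2 * Real.exp (|lam| * (B * B')))
      (by fun_prop) fun z => by
        rw [abs_of_nonneg (by positivity)]
        exact mul_le_mul (hpow _) (hexpb _ _) (Real.exp_pos _).le (by positivity)
  -- Chosen so that the additional exponent contributes at most 2κD = δ/2 to c a.
  set κ := δ / (4 * D) with hκ
  have hκ0 : 0 < κ := by positivity
  have hpe : ∀ x : ℝ, 0 ≤ x → (x ^ 2) ^ 2 ≤ 24 / κ ^ 4 * Real.exp (κ * x) := fun x hx => by
    have := Real.pow_div_factorial_le_exp (κ * x) (by positivity) 4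
    rw [div_le_iff₀ (by positivity)] at this
    rw [div_mul_eq_mul_div, le_div_iff₀ (by positivity)]
    calc (x ^ 2) ^ 2 * κ ^ 4 = (κ * x) ^ 4 := by ring
      _ ≤ _ := this
      _ = _ := by norm_num [Nat.factorial]; ring
  set c := lam ^ 2 * b + 2 * κ / n with hc
  have hc0 : 0 ≤ c := by positivity
  have hca : c * a ≤ 1 - δ / 2 := by
    have h1 : 2 * κ / n * a ≤ 2 * κ / n * (D * n) := by gcongr
    have h2 : 2 * κ / n * (D * n) = δ / 2 := by rw [hκ]; field_simp; norm_num
    calc c * a = lam ^ 2 * (a * b) + 2 * κ / n * a := by rw [hc]; ring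
      _ ≤ 1 - δ / 2 := by linarith
  have hSb : Integrable (fun x => Real.exp (c * S x ^ 2 / 2)) α :=
    integrable_of_abs_le (c := Real.exp (c * B ^ 2 / 2)) (by fun_prop) fun x => by
      rw [abs_of_pos (Real.exp_pos _)]
      have := pow_le_pow_left₀ (abs_nonneg _) (hB x) 2
      rw [sq_abs] at this
      gcongr
  rw [integral_prod _ hint]
  calc _ ≤ ∫ x, 24 / κ ^ 4 * Real.exp (c * S x ^ 2 / 2) ∂α := by
        refine integral_mono hint.integral_prod_left (hSb.const_mul _) fun x => ?_
        simp only []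
        rw [integral_const_mul]
        have h1 : ∫ y, Real.exp (lam * (S x * T y)) ∂α' ≤
            Real.exp ((lam * S x) ^ 2 * b / 2) := by
          simp only [← mul_assoc]
          exact hsub' _
        calc _ ≤ (24 / κ ^ 4 * Real.exp (κ * (S x ^ 2 / n))) *
              Real.exp ((lam * S x) ^ 2 * b / 2) :=
              mul_le_mul (hpe _ (by positivity)) h1 (integral_nonneg fun _ => (Real.exp_pos _).le)
                (by positivity)
          _ = _ := by
              rw [mul_assoc, ← Real.exp_add]
              congr 2
              rw [hc]
              ring
    _ ≤ 24 / κ ^ 4 * (1 / √(1 - c * a)) := by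
        rw [integral_const_mul]
        gcongr
        exact integral_exp_sq_le α hS hB hsub hc0 (by linarith)
    _ ≤ momentConst D δ := by
        rw [momentConst]
        have : 24 / κ ^ 4 = 24 * (4 * D / δ) ^ 4 := by
          rw [hκ]; field_simp
        rw [this]
        gcongr
        linarith

end SubGaussian

/-! ### Hoeffding bounds for overlaps -/

namespace IsCoord

variable {P : Measure ℝ} [IsProbabilityMeasure P] {f : ℝ → ℝ} {K : ℝ}

theorem bound_nonneg (h : IsCoord P f K) : 0 ≤ K := (abs_nonneg _).trans (h.coord_le 0)

/-- A variable bounded by K has second moment at most K², and here the second moment is one. -/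
theorem one_le_bound (h : IsCoord P f K) : 1 ≤ K := by
  have hf := h.measurable_coord
  have h1 : ∫ e, f e ^ 2 ∂P ≤ ∫ _, K ^ 2 ∂P := by
    have hsq : ∀ e, f e ^ 2 ≤ K ^ 2 := fun e => by
      rw [← sq_abs]; exact pow_le_pow_left₀ (abs_nonneg _) (h.coord_le e) 2
    exact integral_mono (integrable_of_abs_le (c := K ^ 2) (by fun_prop) fun e => by
      rw [abs_of_nonneg (sq_nonneg _)]; exact hsq e) (integrable_const _) hsq
  rw [h.unit_variance] at h1
  simp only [integral_const, probReal_univ, one_smul] at h1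
  nlinarith [h.bound_nonneg]

/-- Hoeffding's lemma on an interval of length 2K, whose variance proxy is K². -/
theorem integral_exp_mul_le (h : IsCoord P f K) (t : ℝ) :
    ∫ e, Real.exp (t * f e) ∂P ≤ Real.exp (t ^ 2 * K ^ 2 / 2) := by
  have h1 := (hasSubgaussianMGF_of_mem_Icc_of_integral_eq_zero (μ := P) (X := f) (a := -K) (b := K)
    h.measurable_coord.aemeasurable
    (Filter.Eventually.of_forall fun e => abs_le.1 (h.coord_le e)) h.mean_zero).mgf_le t
  rw [mgf] at h1
  refine h1.trans_eq ?_
  congr 1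
  simp only [sub_neg_eq_add, NNReal.coe_pow, NNReal.coe_div, coe_nnnorm, Real.norm_eq_abs,
    NNReal.coe_ofNat]
  rw [abs_of_nonneg (by linarith [h.bound_nonneg])]
  ring

/-- Products of the coordinates of two replicas, summed over a set of sites. -/
def siteSum {n : ℕ} (f : ℝ → ℝ) (I : Finset (Fin n)) (z : (Fin n → ℝ) × (Fin n → ℝ)) : ℝ :=
  ∑ i ∈ I, f (z.1 i) * f (z.2 i)

theorem measurable_siteSum (h : IsCoord P f K) {n : ℕ} (I : Finset (Fin n)) :
    Measurable (siteSum f I) := by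
  have := h.measurable_coord
  unfold siteSum
  fun_prop

theorem abs_siteSum_le (h : IsCoord P f K) {n : ℕ} (I : Finset (Fin n))
    (z : (Fin n → ℝ) × (Fin n → ℝ)) : |siteSum f I z| ≤ n * K ^ 2 := by
  unfold siteSum
  refine (Finset.abs_sum_le_sum_abs _ _).trans ?_
  calc _ ≤ ∑ _i ∈ I, K ^ 2 := Finset.sum_le_sum fun i _ => h.abs_mul_le _ _
    _ = I.card * K ^ 2 := by simp
    _ ≤ n * K ^ 2 := by
      gcongr
      simpa using I.card_le_univ

/-- With the first replica fixed, the sum has independent terms f(x_i) f(y_i), each with variance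
proxy at most K⁴. Sites outside I get coefficient zero, so a bound with all n sites serves every I.
-/
theorem integral_exp_siteSum_le (h : IsCoord P f K) {n : ℕ} (I : Finset (Fin n)) (t : ℝ) :
    ∫ z, Real.exp (t * siteSum f I z)
      ∂(Measure.pi fun _ : Fin n => P).prod (Measure.pi fun _ : Fin n => P) ≤
      Real.exp (t ^ 2 * (n * K ^ 4) / 2) := by
  have hm := h.measurable_siteSum I
  have hint : Integrable (fun z => Real.exp (t * siteSum f I z))
      ((Measure.pi fun _ : Fin n => P).prod (Measure.pi fun _ : Fin n => P)) :=
    integrable_of_abs_le (c := Real.exp (|t| * (n * K ^ 2))) (by fun_prop) fun z => by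
      rw [abs_of_pos (Real.exp_pos _)]
      refine Real.exp_le_exp.2 ((le_abs_self _).trans ?_)
      rw [abs_mul]
      exact mul_le_mul_of_nonneg_left (h.abs_siteSum_le I z) (abs_nonneg _)
  rw [integral_prod _ hint]
  have hinner : ∀ x : Fin n → ℝ, ∫ y, Real.exp (t * siteSum f I (x, y))
      ∂(Measure.pi fun _ : Fin n => P) ≤ Real.exp (t ^ 2 * (n * K ^ 4) / 2) := fun x => by
    have hprod : ∀ y : Fin n → ℝ, Real.exp (t * siteSum f I (x, y)) =
        ∏ i, Real.exp ((if i ∈ I then t * f (x i) else 0) * f (y i)) := fun y => by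
      rw [← Real.exp_sum, siteSum, Finset.mul_sum]
      congr 1
      simp only [ite_mul, zero_mul, Finset.sum_ite_mem, Finset.univ_inter, mul_assoc]
    simp only [hprod]
    rw [integral_fintype_prod_eq_prod
      (fun i e => Real.exp ((if i ∈ I then t * f (x i) else 0) * f e))]
    calc _ ≤ ∏ _i : Fin n, Real.exp (t ^ 2 * K ^ 4 / 2) := by
          refine Finset.prod_le_prod (fun i _ => integral_nonneg fun _ => (Real.exp_pos _).le)
            fun i _ => (h.integral_exp_mul_le _).trans (Real.exp_le_exp.2 ?_)
          split_ifs
          · have h1 : f (x i) ^ 2 ≤ K ^ 2 := by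
              rw [← sq_abs]; exact pow_le_pow_left₀ (abs_nonneg _) (h.coord_le _) 2
            have h2 : t ^ 2 * f (x i) ^ 2 * K ^ 2 ≤ t ^ 2 * K ^ 2 * K ^ 2 := by gcongr
            calc _ = t ^ 2 * f (x i) ^ 2 * K ^ 2 / 2 := by ring
              _ ≤ t ^ 2 * K ^ 2 * K ^ 2 / 2 := by linarith
              _ = _ := by ring
          · have : 0 ≤ t ^ 2 * K ^ 4 / 2 := by positivity
            simpa using this
      _ = _ := by
          rw [← Real.exp_sum]
          simp
          ring
  calc _ ≤ ∫ _, Real.exp (t ^ 2 * (n * K ^ 4) / 2) ∂(Measure.pi fun _ : Fin n => P) :=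
        integral_mono hint.integral_prod_left (integrable_const _) hinner
    _ = _ := by simp

end IsCoord

instance isProbabilityMeasure_prior (Pu Pv : Measure ℝ) [IsProbabilityMeasure Pu]
    [IsProbabilityMeasure Pv] (N M : ℕ) : IsProbabilityMeasure (prior Pu Pv N M) := by
  unfold prior; infer_instance

/-! ### The masked rank-one model and its overlap moments -/

section Model

variable {N M : ℕ}

/-- The unnormalized overlap of the first components over a set of sites. -/
def sumU (f : ℝ → ℝ) (I : Finset (Fin N)) (p : Config N M × Config N M) : ℝ :=
  IsCoord.siteSum f I (p.1.1, p.2.1)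

/-- The unnormalized overlap of the second components over a set of sites. -/
def sumV (g : ℝ → ℝ) (J : Finset (Fin M)) (p : Config N M × Config N M) : ℝ :=
  IsCoord.siteSum g J (p.1.2, p.2.2)

/-- The rank-one signal, restricted to a set of rows and a set of columns. -/
def maskSignal (lam : ℝ) (f g : ℝ → ℝ) (I : Finset (Fin N)) (J : Finset (Fin M))
    (x : Config N M) : Fin N → Fin M → ℝ := fun i j =>
  lam * ((if i ∈ I then f (x.1 i) else 0) * (if j ∈ J then g (x.2 j) else 0))

theorem dot_rankOne (lam : ℝ) (a a' : Fin N → ℝ) (c c' : Fin M → ℝ) :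
    dot (fun i j => lam * (a i * c j)) (fun i j => lam * (a' i * c' j)) =
      lam ^ 2 * ((∑ i, a i * a' i) * ∑ j, c j * c' j) := by
  rw [dot, Finset.sum_mul_sum, Finset.mul_sum]
  refine Finset.sum_congr rfl fun i _ => ?_
  rw [Finset.mul_sum]
  exact Finset.sum_congr rfl fun j _ => by ring

theorem dot_maskSignal (lam : ℝ) (f g : ℝ → ℝ) (I : Finset (Fin N)) (J : Finset (Fin M))
    (p : Config N M × Config N M) :
    dot (maskSignal lam f g I J p.1) (maskSignal lam f g I J p.2) =
      lam ^ 2 * (sumU f I p * sumV g J p) := by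
  refine (dot_rankOne lam _ _ _ _).trans ?_
  have hite : ∀ {n : ℕ} (I : Finset (Fin n)) (a c : Fin n → ℝ),
      ∑ i, (if i ∈ I then a i else 0) * (if i ∈ I then c i else 0) = ∑ i ∈ I, a i * c i :=
    fun I a c => by
      rw [← Finset.univ_inter I, ← Finset.sum_ite_mem]
      refine Finset.sum_congr rfl fun i _ => ?_
      by_cases hi : i ∈ I <;> simp [hi]
  rw [hite, hite]
  rfl

variable {Pu Pv : Measure ℝ} [IsProbabilityMeasure Pu] [IsProbabilityMeasure Pv] {f g : ℝ → ℝ}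
  {Ku Kv : ℝ}

theorem measurable_maskSignal (hf : IsCoord Pu f Ku) (hg : IsCoord Pv g Kv) (lam : ℝ)
    (I : Finset (Fin N)) (J : Finset (Fin M)) : Measurable (maskSignal lam f g I J) := by
  have h1 := hf.measurable_coord
  have h2 := hg.measurable_coord
  unfold maskSignal
  refine measurable_pi_lambda _ fun i => measurable_pi_lambda _ fun j => ?_
  split_ifs <;> fun_prop

theorem measurable_sumU (hf : IsCoord Pu f Ku) (I : Finset (Fin N)) :
    Measurable (sumU (M := M) f I) := by
  have := hf.measurable_siteSum I
  unfold sumU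
  fun_prop

theorem measurable_sumV (hg : IsCoord Pv g Kv) (J : Finset (Fin M)) :
    Measurable (sumV (N := N) g J) := by
  have := hg.measurable_siteSum J
  unfold sumV
  fun_prop

theorem abs_sumU_le (hf : IsCoord Pu f Ku) (I : Finset (Fin N)) (p : Config N M × Config N M) :
    |sumU f I p| ≤ N * Ku ^ 2 := hf.abs_siteSum_le I _

theorem abs_sumV_le (hg : IsCoord Pv g Kv) (J : Finset (Fin M)) (p : Config N M × Config N M) :
    |sumV g J p| ≤ M * Kv ^ 2 := hg.abs_siteSum_le J _

theorem dot_maskSignal_le (hf : IsCoord Pu f Ku) (hg : IsCoord Pv g Kv) (lam : ℝ)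
    (I : Finset (Fin N)) (J : Finset (Fin M)) (p : Config N M × Config N M) :
    dot (maskSignal lam f g I J p.1) (maskSignal lam f g I J p.2) ≤
      lam ^ 2 * ((N * Ku ^ 2) * (M * Kv ^ 2)) := by
  rw [dot_maskSignal]
  refine mul_le_mul_of_nonneg_left ((le_abs_self _).trans ?_) (sq_nonneg _)
  rw [abs_mul]
  exact mul_le_mul (abs_sumU_le hf I p) (abs_sumV_le hg J p) (abs_nonneg _) (by positivity)

theorem integral_prior_prior (F : ((Fin N → ℝ) × (Fin N → ℝ)) × ((Fin M → ℝ) × (Fin M → ℝ)) → ℝ)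
    (hF : Measurable F) :
    ∫ p, F ((p.1.1, p.2.1), (p.1.2, p.2.2)) ∂(prior Pu Pv N M).prod (prior Pu Pv N M) =
      ∫ z, F z ∂((Measure.pi fun _ : Fin N => Pu).prod (Measure.pi fun _ : Fin N => Pu)).prod
        ((Measure.pi fun _ : Fin M => Pv).prod (Measure.pi fun _ : Fin M => Pv)) :=
  integral_comp_measurePreserving (measurePreserving_prodProdProdComm _ _ _ _)
    hF.stronglyMeasurable

theorem abs_sq_div_sq_le {x B n : ℝ} (hx : |x| ≤ B) (hn : 0 < n) :
    |(x ^ 2 / n) ^ 2| ≤ (B ^ 2 / n) ^ 2 := by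
  rw [abs_of_nonneg (sq_nonneg _)]
  have := pow_le_pow_left₀ (abs_nonneg _) hx 2
  rw [sq_abs] at this
  gcongr

/-- Fourth moments of the overlap of the first components in a masked system. -/
theorem nishimori_sumU_le (hf : IsCoord Pu f Ku) (hg : IsCoord Pv g Kv) {lam δ D n : ℝ}
    (I : Finset (Fin N)) (J : Finset (Fin M)) (hδ : 0 < δ) (hD : 0 < D) (hn : 0 < n)
    (hlam : (lam ^ 2) ^ 2 * ((N * Ku ^ 4) * (M * Kv ^ 4)) ≤ 1 - δ) (ha : N * Ku ^ 4 ≤ D * n) :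
    nishimori (prior Pu Pv N M) (maskSignal lam f g I J) (fun p => (sumU f I p ^ 2 / n) ^ 2) ≤
      (1 + momentConst D δ) / 2 := by
  have h1 := measurable_sumU (M := M) hf I
  have h2 := hf.measurable_siteSum I
  have h3 := hg.measurable_siteSum J
  refine (nishimori_le_second_moment _ (measurable_maskSignal hf hg lam I J)
    (dot_maskSignal_le hf hg lam I J) (by fun_prop) (c := ((N * Ku ^ 2) ^ 2 / n) ^ 2)
    fun p => abs_sq_div_sq_le (abs_sumU_le hf I p) hn).trans ?_
  have := integral_pow_mul_exp_le ((Measure.pi fun _ : Fin N => Pu).prod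
    (Measure.pi fun _ : Fin N => Pu)) ((Measure.pi fun _ : Fin M => Pv).prod
    (Measure.pi fun _ : Fin M => Pv)) h2 (hf.abs_siteSum_le I) h3 (hg.abs_siteSum_le J)
    (by positivity) (hf.integral_exp_siteSum_le I) (hg.integral_exp_siteSum_le J) hδ hD hn hlam ha
  rw [← integral_prior_prior _ (by fun_prop)] at this
  simp only [dot_maskSignal, sumU, sumV]
  linarith

/-- Fourth moments of the overlap of the second components in a masked system. -/
theorem nishimori_sumV_le (hf : IsCoord Pu f Ku) (hg : IsCoord Pv g Kv) {lam δ D n : ℝ}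
    (I : Finset (Fin N)) (J : Finset (Fin M)) (hδ : 0 < δ) (hD : 0 < D) (hn : 0 < n)
    (hlam : (lam ^ 2) ^ 2 * ((N * Ku ^ 4) * (M * Kv ^ 4)) ≤ 1 - δ) (ha : M * Kv ^ 4 ≤ D * n) :
    nishimori (prior Pu Pv N M) (maskSignal lam f g I J) (fun p => (sumV g J p ^ 2 / n) ^ 2) ≤
      (1 + momentConst D δ) / 2 := by
  have h1 := measurable_sumV (N := N) hg J
  have h2 := hf.measurable_siteSum I
  have h3 := hg.measurable_siteSum J
  refine (nishimori_le_second_moment _ (measurable_maskSignal hf hg lam I J)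
    (dot_maskSignal_le hf hg lam I J) (by fun_prop) (c := ((M * Kv ^ 2) ^ 2 / n) ^ 2)
    fun p => abs_sq_div_sq_le (abs_sumV_le hg J p) hn).trans ?_
  have := integral_pow_mul_exp_le ((Measure.pi fun _ : Fin M => Pv).prod
    (Measure.pi fun _ : Fin M => Pv)) ((Measure.pi fun _ : Fin N => Pu).prod
    (Measure.pi fun _ : Fin N => Pu)) h3 (hg.abs_siteSum_le J) h2 (hf.abs_siteSum_le I)
    (by positivity) (hg.integral_exp_siteSum_le J) (hf.integral_exp_siteSum_le I) hδ hD hn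
    (by rw [mul_comm (M * Kv ^ 4)]; exact hlam) ha
  rw [← integral_prod_swap] at this
  simp only [Prod.fst_swap, Prod.snd_swap] at this
  rw [← integral_prior_prior _ (by fun_prop)] at this
  simp only [dot_maskSignal, sumU, sumV, mul_comm (IsCoord.siteSum f I _)]
  linarith

end Model

/-! ### Resampling one coordinate -/

/-- The overwritten entry becomes a dummy variable that is integrated out. The reduced system thus
lives on the full configuration space and no index has to be removed. -/
theorem measurePreserving_update {n : ℕ} (P : Measure ℝ) [IsProbabilityMeasure P] (i : Fin n) :
    MeasurePreserving (fun z : (Fin n → ℝ) × ℝ => Function.update z.1 i z.2)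
      ((Measure.pi fun _ : Fin n => P).prod P) (Measure.pi fun _ : Fin n => P) := by
  have hm : Measurable fun z : (Fin n → ℝ) × ℝ => Function.update z.1 i z.2 := by
    refine measurable_pi_lambda _ fun k => ?_
    by_cases hk : k = i
    · subst hk; simpa using measurable_snd
    · simp only [Function.update_of_ne hk]; fun_prop
  refine ⟨hm, (Measure.pi_eq fun s hs => ?_).symm⟩
  have hpre : (fun z : (Fin n → ℝ) × ℝ => Function.update z.1 i z.2) ⁻¹' (Set.univ.pi s) =
      (Set.univ.pi fun k => if k = i then Set.univ else s k) ×ˢ s i := by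
    ext z
    simp only [Set.mem_preimage, Set.mem_pi, Set.mem_univ, true_imp_iff, Set.mem_prod]
    constructor
    · refine fun h => ⟨fun k => ?_, by simpa using h i⟩
      by_cases hk : k = i
      · simp [hk]
      · simpa [hk] using h k
    · rintro ⟨h1, h2⟩ k
      by_cases hk : k = i
      · subst hk; simpa using h2
      · simpa [hk] using h1 k
  rw [Measure.map_apply hm (MeasurableSet.univ_pi hs), hpre, Measure.prod_prod, Measure.pi_pi,
    ← Finset.prod_erase_mul _ _ (Finset.mem_univ i), ← Finset.prod_erase_mul _ _ (Finset.mem_univ i)]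
  simp only [if_true, measure_univ, mul_one]
  congr 1
  exact Finset.prod_congr rfl fun k hk => by rw [if_neg (Finset.ne_of_mem_erase hk)]

section Resample

variable {N M : ℕ}

/-- Replace one coordinate of the first component. -/
def updateU (i : Fin N) (z : Config N M × ℝ) : Config N M := (Function.update z.1.1 i z.2, z.1.2)

/-- Replace one coordinate of the second component. -/
def updateV (j : Fin M) (z : Config N M × ℝ) : Config N M := (z.1.1, Function.update z.1.2 j z.2)

variable (Pu Pv : Measure ℝ) [IsProbabilityMeasure Pu] [IsProbabilityMeasure Pv]

theorem measurePreserving_updateV (j : Fin M) :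
    MeasurePreserving (updateV j) ((prior Pu Pv N M).prod Pv) (prior Pu Pv N M) :=
  ((MeasurePreserving.id _).prod (measurePreserving_update Pv j)).comp
    (measurePreserving_prodAssoc _ _ _)

theorem measurePreserving_updateU (i : Fin N) :
    MeasurePreserving (updateU i) ((prior Pu Pv N M).prod Pu) (prior Pu Pv N M) :=
  (Measure.measurePreserving_swap.comp
    ((MeasurePreserving.id (Measure.pi fun _ : Fin M => Pv)).prod
      (measurePreserving_update Pu i))).comp
    ((measurePreserving_prodAssoc _ _ _).comp
      ((Measure.measurePreserving_swap (μ := Measure.pi fun _ : Fin N => Pu)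
        (ν := Measure.pi fun _ : Fin M => Pv)).prod (MeasurePreserving.id Pu)))

theorem obs_comp {X X' : Type*} [MeasurableSpace X] [MeasurableSpace X'] {ρ : Measure X}
    {ρ' : Measure X'} [IsProbabilityMeasure ρ] [IsProbabilityMeasure ρ'] {φ : X' → X}
    (hφ : MeasurePreserving φ ρ' ρ) {T : X → Fin N → Fin M → ℝ} (hT : Measurable T) (s : ℝ)
    {Q : X × X → ℝ} (hQ : Measurable Q) :
    obs ρ T s Q = obs ρ' (T ∘ φ) s (fun z => Q (φ z.1, φ z.2)) := by
  have h1 : ∀ Y, partition ρ T Y = partition ρ' (T ∘ φ) Y := fun Y =>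
    (integral_comp_measurePreserving hφ (g := fun x => tilt Y (T x))
      (Measurable.stronglyMeasurable (by fun_prop))).symm
  have h2 : ∀ Y, pairInt ρ T Y Q = pairInt ρ' (T ∘ φ) Y (fun z => Q (φ z.1, φ z.2)) := fun Y =>
    (integral_comp_measurePreserving (hφ.prod hφ) (g := fun p => pairWeight T Y p * Q p)
      (Measurable.stronglyMeasurable (by fun_prop))).symm
  simp only [obs, h1, h2]

end Resample

/-! ### Cavity equations for one row and one column -/

section ModelCavity

variable {N M : ℕ} {Pu Pv : Measure ℝ} [IsProbabilityMeasure Pu] [IsProbabilityMeasure Pv]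
  {f g : ℝ → ℝ} {Ku Kv : ℝ}

/-- The signal in a single row. -/
def rowField (lam : ℝ) (g : ℝ → ℝ) (i : Fin N) (x : Config N M) : Fin N → Fin M → ℝ :=
  fun k j => lam * ((if k = i then 1 else 0) * g (x.2 j))

/-- The signal in a single column. -/
def colField (lam : ℝ) (f : ℝ → ℝ) (j : Fin M) (x : Config N M) : Fin N → Fin M → ℝ :=
  fun i k => lam * (f (x.1 i) * (if k = j then 1 else 0))

theorem dot_rowField (lam : ℝ) (g : ℝ → ℝ) (i : Fin N) (x y : Config N M) :
    dot (rowField lam g i x) (rowField lam g i y) = lam ^ 2 * sumV g Finset.univ (x, y) := by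
  refine (dot_rankOne lam _ _ _ _).trans ?_
  simp [sumV, IsCoord.siteSum]

theorem dot_colField (lam : ℝ) (f : ℝ → ℝ) (j : Fin M) (x y : Config N M) :
    dot (colField lam f j x) (colField lam f j y) = lam ^ 2 * sumU f Finset.univ (x, y) := by
  refine (dot_rankOne lam _ _ _ _).trans ?_
  simp [sumU, IsCoord.siteSum]

theorem dot_rowField_maskSignal (lam : ℝ) (f g : ℝ → ℝ) (i : Fin N) (x y : Config N M) :
    dot (rowField lam g i y) (maskSignal lam f g (Finset.univ.erase i) Finset.univ x) = 0 := by
  refine (dot_rankOne lam _ _ _ _).trans ?_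
  rw [Finset.sum_eq_zero fun k _ => by by_cases hk : k = i <;> simp [hk], zero_mul, mul_zero]

theorem dot_colField_maskSignal (lam : ℝ) (f g : ℝ → ℝ) (j : Fin M) (x y : Config N M) :
    dot (colField lam f j y) (maskSignal lam f g Finset.univ (Finset.univ.erase j) x) = 0 := by
  refine (dot_rankOne lam _ _ _ _).trans ?_
  rw [Finset.sum_eq_zero (f := fun k => (if k = j then (1 : ℝ) else 0) *
    if k ∈ Finset.univ.erase j then g (x.2 k) else 0) fun k _ => by
      by_cases hk : k = j <;> simp [hk], mul_zero, mul_zero]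

theorem isCavity_row (hf : IsCoord Pu f Ku) (hg : IsCoord Pv g Kv) {lam b : ℝ} (i : Fin N)
    (hb : lam ^ 2 * (M * Kv ^ 2) ≤ b) :
    IsCavity (X := Config N M) Pu (maskSignal lam f g (Finset.univ.erase i) Finset.univ)
      (rowField lam g i) f b Ku where
  measurable_signal := measurable_maskSignal hf hg lam _ _
  measurable_field := by
    have := hg.measurable_coord
    unfold rowField
    fun_prop
  measurable_coord := hf.measurable_coord
  orthogonal x y := dot_rowField_maskSignal lam f g i x y
  field_le x := by
    rw [dot_rowField]
    exact (mul_le_mul_of_nonneg_left ((le_abs_self _).trans (abs_sumV_le hg _ _))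
      (sq_nonneg _)).trans hb
  coord_le := hf.coord_le
  mean_zero := hf.mean_zero
  unit_variance := hf.unit_variance

theorem isCavity_col (hf : IsCoord Pu f Ku) (hg : IsCoord Pv g Kv) {lam b : ℝ} (j : Fin M)
    (hb : lam ^ 2 * (N * Ku ^ 2) ≤ b) :
    IsCavity (X := Config N M) Pv (maskSignal lam f g Finset.univ (Finset.univ.erase j))
      (colField lam f j) g b Kv where
  measurable_signal := measurable_maskSignal hf hg lam _ _
  measurable_field := by
    have := hf.measurable_coord
    unfold colField
    fun_prop
  measurable_coord := hg.measurable_coord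
  orthogonal x y := dot_colField_maskSignal lam f g j x y
  field_le x := by
    rw [dot_colField]
    exact (mul_le_mul_of_nonneg_left ((le_abs_self _).trans (abs_sumU_le hf _ _))
      (sq_nonneg _)).trans hb
  coord_le := hg.coord_le
  mean_zero := hg.mean_zero
  unit_variance := hg.unit_variance

/-- After resampling u_i the signal is that of the other rows plus the fresh coordinate times row i,
which is the form required by `IsCavity`. -/
theorem maskSignal_comp_updateU (lam : ℝ) (f g : ℝ → ℝ) (i : Fin N) :
    maskSignal lam f g Finset.univ Finset.univ ∘ updateU i =
      extSignal (X := Config N M) (maskSignal lam f g (Finset.univ.erase i) Finset.univ)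
        (rowField lam g i) f := by
  ext z k j
  by_cases hk : k = i
  · subst hk
    simp [maskSignal, updateU, extSignal, rowField]
    ring
  · simp [maskSignal, updateU, extSignal, rowField, hk]

theorem maskSignal_comp_updateV (lam : ℝ) (f g : ℝ → ℝ) (j : Fin M) :
    maskSignal lam f g Finset.univ Finset.univ ∘ updateV j =
      extSignal (X := Config N M) (maskSignal lam f g Finset.univ (Finset.univ.erase j))
        (colField lam f j) g := by
  ext z i k
  by_cases hk : k = j
  · subst hk
    simp [maskSignal, updateV, extSignal, colField]
    ring
  · simp [maskSignal, updateV, extSignal, colField, hk]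

/-- The standing assumptions on the parameters, with `r = √N`. -/
structure Regime (N M : ℕ) (β Ku Kv b m δ D r lam : ℝ) : Prop where
  r_pos : 0 < r
  r_sq : r ^ 2 = N
  beta_nonneg : 0 ≤ β
  lam_sq : lam ^ 2 = β / N
  delta_pos : 0 < δ
  D_pos : 0 < D
  subcritical : (lam ^ 2) ^ 2 * ((N * Ku ^ 4) * (M * Kv ^ 4)) ≤ 1 - δ
  u_le : N * Ku ^ 4 ≤ D * N
  v_le : M * Kv ^ 4 ≤ D * N
  row_le : lam ^ 2 * (M * Kv ^ 2) ≤ b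
  col_le : lam ^ 2 * (N * Ku ^ 2) ≤ b
  moment_le : 1 + (1 + β ^ 4) * (1 + momentConst D δ) ≤ m

variable {β b m δ D r lam : ℝ}

theorem Regime.natCast_pos (R : Regime N M β Ku Kv b m δ D r lam) : (0 : ℝ) < N := by
  rw [← R.r_sq]; exact pow_pos R.r_pos 2

theorem Regime.b_nonneg (R : Regime N M β Ku Kv b m δ D r lam) : 0 ≤ b :=
  (by have := sq_nonneg lam; positivity : (0 : ℝ) ≤ lam ^ 2 * (N * Ku ^ 2)).trans R.col_le

theorem momentConst_nonneg (hD : 0 < D) (hδ : 0 < δ) : 0 ≤ momentConst D δ := by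
  unfold momentConst; positivity

/-- Stated for arbitrary masks, because the cavity estimates evaluate moments in systems with one
row or one column deleted. The coefficients accommodate both `momentFun` and the full overlaps. -/
theorem nishimori_moment_le (hf : IsCoord Pu f Ku) (hg : IsCoord Pv g Kv)
    (R : Regime N M β Ku Kv b m δ D r lam) (I : Finset (Fin N)) (J : Finset (Fin M))
    {c c' : ℝ} (hc : 0 ≤ c) (hc' : 0 ≤ c') (hcc : c + c' ≤ 2 * (1 + β ^ 4)) :
    nishimori (prior Pu Pv N M) (maskSignal lam f g I J)
      (fun p => 1 + (c * (sumU f I p ^ 2 / N) ^ 2 + c' * (sumV g J p ^ 2 / N) ^ 2)) ≤ m := by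
  have hN := R.natCast_pos
  have h1 := measurable_sumU (M := M) hf I
  have h2 := measurable_sumV (N := N) hg J
  have hT := measurable_maskSignal (N := N) (M := M) hf hg lam I J
  have b1 : ∀ p, |c * (sumU f I p ^ 2 / N) ^ 2| ≤ c * ((N * Ku ^ 2) ^ 2 / N) ^ 2 :=
    fun p : Config N M × Config N M => by
      rw [abs_mul, abs_of_nonneg hc]
      exact mul_le_mul_of_nonneg_left (abs_sq_div_sq_le (abs_sumU_le hf I p) hN) hc
  have b2 : ∀ p, |c' * (sumV g J p ^ 2 / N) ^ 2| ≤ c' * ((M * Kv ^ 2) ^ 2 / N) ^ 2 :=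
    fun p : Config N M × Config N M => by
      rw [abs_mul, abs_of_nonneg hc']
      exact mul_le_mul_of_nonneg_left (abs_sq_div_sq_le (abs_sumV_le hg J p) hN) hc'
  rw [nishimori_add _ hT measurable_const (c := 1) (by simp) (by fun_prop)
      (fun p => (abs_add_le _ _).trans (add_le_add (b1 p) (b2 p))),
    nishimori_add _ hT (by fun_prop) b1 (by fun_prop) b2, nishimori_const _ hT,
    nishimori_const_mul, nishimori_const_mul]
  have m1 := nishimori_sumU_le hf hg I J R.delta_pos R.D_pos hN R.subcritical R.u_le
  have m2 := nishimori_sumV_le hf hg I J R.delta_pos R.D_pos hN R.subcritical R.v_le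
  have hmc := momentConst_nonneg R.D_pos R.delta_pos
  calc _ ≤ 1 + (c * ((1 + momentConst D δ) / 2) + c' * ((1 + momentConst D δ) / 2)) := by gcongr
    _ = 1 + (c + c') * ((1 + momentConst D δ) / 2) := by ring
    _ ≤ 1 + 2 * (1 + β ^ 4) * ((1 + momentConst D δ) / 2) := by gcongr
    _ = 1 + (1 + β ^ 4) * (1 + momentConst D δ) := by ring
    _ ≤ m := R.moment_le

theorem norm_obs_row_le (hf : IsCoord Pu f Ku) (hg : IsCoord Pv g Kv)
    (R : Regime N M β Ku Kv b m δ D r lam) (s : ℝ) (i : Fin N) :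
    ‖obs (prior Pu Pv N M) (maskSignal lam f g Finset.univ Finset.univ) s
      (fun p => (f (p.1.1 i) * f (p.2.1 i) - β * (sumV g Finset.univ p / N)) *
        (sumV g Finset.univ p / N))‖ ≤ cavityConst s b Ku * m / r ^ 3 := by
  have hN := R.natCast_pos
  have h1 := hf.measurable_coord
  have h2 := measurable_sumV (N := N) hg (Finset.univ : Finset (Fin M))
  have hT := measurable_maskSignal (N := N) (M := M) hf hg lam Finset.univ Finset.univ
  have hcav := isCavity_row (N := N) hf hg i R.row_le
  have hS : ∀ p, fieldOverlap (rowField (M := M) lam g i) p =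
      β * (sumV g Finset.univ p / N) := fun p => by
    rw [fieldOverlap, dot_rowField, R.lam_sq]; ring
  rw [obs_comp (measurePreserving_updateU Pu Pv i) hT s (by fun_prop), maskSignal_comp_updateU]
  have hQ : (fun z : (Config N M × ℝ) × (Config N M × ℝ) =>
      (f ((updateU i z.1).1 i) * f ((updateU i z.2).1 i) -
        β * (sumV g Finset.univ (updateU i z.1, updateU i z.2) / N)) *
        (sumV g Finset.univ (updateU i z.1, updateU i z.2) / N)) =
      IsCavity.lift fun p ε => (f ε.1 * f ε.2 - fieldOverlap (rowField lam g i) p) *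
        (sumV g Finset.univ p / N) := by
    ext z
    simp only [IsCavity.lift, hS, updateU, Function.update_self]
    rfl
  rw [hQ]
  refine hcav.norm_obs_sub_le (prior Pu Pv N M) R.b_nonneg s R.r_pos
    (φ := fun p => sumV g Finset.univ p / N) (by fun_prop) (c := M * Kv ^ 2 / N) (fun p => by
      rw [abs_div, abs_of_pos hN]
      gcongr
      exact abs_sumV_le hg _ _) ?_
  -- Both φ = R^v and the field overlap β R^v involve only v, so the moment function is 1 + (1 + β⁴)
  -- N² (R^v)⁴.
  refine le_trans (le_of_eq ?_) (nishimori_moment_le hf hg R (Finset.univ.erase i) Finset.univ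
    (c := 0) (c' := 1 + β ^ 4) le_rfl (by positivity)
    (by have : 0 ≤ β ^ 4 := by positivity
        linarith))
  congr 1
  ext p
  simp only [IsCavity.momentFun, hS, ← R.r_sq]
  have := R.r_pos
  field_simp
  ring

/-- The cofactor must not depend on the isolated coordinate v_j, so site j is erased from R^v. The
second estimate handles the diagonal term that the erasure leaves behind. -/
theorem norm_obs_col_le (hf : IsCoord Pu f Ku) (hg : IsCoord Pv g Kv)
    (R : Regime N M β Ku Kv b m δ D r lam) (s : ℝ) (j : Fin M) :
    ‖obs (prior Pu Pv N M) (maskSignal lam f g Finset.univ Finset.univ) s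
      (fun p => (g (p.1.2 j) * g (p.2.2 j) - β * (sumU f Finset.univ p / N)) *
        (sumV g (Finset.univ.erase j) p / N))‖ ≤ cavityConst s b Kv * m / r ^ 3 ∧
    ‖obs (prior Pu Pv N M) (maskSignal lam f g Finset.univ Finset.univ) s
      (fun p => (g (p.1.2 j) * g (p.2.2 j)) ^ 2 - 1)‖ ≤ cavityConst s b Kv * m / r := by
  have hN := R.natCast_pos
  have h1 := hg.measurable_coord
  have h2 := measurable_sumV (N := N) hg (Finset.univ.erase j : Finset (Fin M))
  have h3 := measurable_sumU (M := M) hf (Finset.univ : Finset (Fin N))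
  have hT := measurable_maskSignal (N := N) (M := M) hf hg lam Finset.univ Finset.univ
  have hcav := isCavity_col (M := M) hf hg j R.col_le
  have hS : ∀ p, fieldOverlap (colField (N := N) lam f j) p =
      β * (sumU f Finset.univ p / N) := fun p => by
    rw [fieldOverlap, dot_colField, R.lam_sq]; ring
  have hφ : Measurable fun p : Config N M × Config N M =>
      sumV g (Finset.univ.erase j) p / N := by fun_prop
  have hφc : ∀ p : Config N M × Config N M,
      |sumV g (Finset.univ.erase j) p / N| ≤ M * Kv ^ 2 / N := fun p => by
    rw [abs_div, abs_of_pos hN]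
    gcongr
    exact abs_sumV_le hg _ _
  have hm : nishimori (prior Pu Pv N M)
      (maskSignal lam f g Finset.univ (Finset.univ.erase j))
      (IsCavity.momentFun (colField lam f j) r
        fun p => sumV g (Finset.univ.erase j) p / N) ≤ m := by
    refine le_trans (le_of_eq ?_) (nishimori_moment_le hf hg R Finset.univ (Finset.univ.erase j)
      (c := β ^ 4) (c' := 1) (by positivity) zero_le_one
      (by have : 0 ≤ β ^ 4 := by positivity
          linarith))
    congr 1
    ext p
    simp only [IsCavity.momentFun, hS, ← R.r_sq]
    have := R.r_pos
    field_simp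
    ring
  constructor
  · rw [obs_comp (measurePreserving_updateV Pu Pv j) hT s (by fun_prop), maskSignal_comp_updateV]
    have hQ : (fun z : (Config N M × ℝ) × (Config N M × ℝ) =>
        (g ((updateV j z.1).2 j) * g ((updateV j z.2).2 j) -
          β * (sumU f Finset.univ (updateV j z.1, updateV j z.2) / N)) *
          (sumV g (Finset.univ.erase j) (updateV j z.1, updateV j z.2) / N)) =
        IsCavity.lift fun p ε => (g ε.1 * g ε.2 - fieldOverlap (colField lam f j) p) *
          (sumV g (Finset.univ.erase j) p / N) := by
      ext z
      have hs : sumV g (Finset.univ.erase j) (updateV j z.1, updateV j z.2) =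
          sumV g (Finset.univ.erase j) (z.1.1, z.2.1) := by
        simp only [sumV, IsCoord.siteSum, updateV]
        refine Finset.sum_congr rfl fun k hk => ?_
        rw [Function.update_of_ne (Finset.ne_of_mem_erase hk),
          Function.update_of_ne (Finset.ne_of_mem_erase hk)]
      rw [hs]
      simp only [IsCavity.lift, hS, updateV, Function.update_self]
      rfl
    rw [hQ]
    exact hcav.norm_obs_sub_le (prior Pu Pv N M) R.b_nonneg s R.r_pos hφ hφc hm
  · rw [obs_comp (measurePreserving_updateV Pu Pv j) hT s (by fun_prop), maskSignal_comp_updateV]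
    have hQ : (fun z : (Config N M × ℝ) × (Config N M × ℝ) =>
        (g ((updateV j z.1).2 j) * g ((updateV j z.2).2 j)) ^ 2 - 1) =
        IsCavity.lift (fun (_ : Config N M × Config N M) ε => (g ε.1 * g ε.2) ^ 2 - 1) := by
      ext z
      simp only [IsCavity.lift, updateV, Function.update_self]
    rw [hQ]
    exact hcav.norm_obs_sq_sub_one_le (prior Pu Pv N M) R.b_nonneg s R.r_pos hφ hφc hm

end ModelCavity

/-! ### Assembling the linear system -/

theorem obs_finset_sum {N M : ℕ} {X ι : Type*} [MeasurableSpace X] (ρ : Measure X)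
    [IsProbabilityMeasure ρ] {T : X → Fin N → Fin M → ℝ} (hT : Measurable T) (s : ℝ)
    (I : Finset ι) {F : ι → X × X → ℝ} (hF : ∀ i, Measurable (F i)) {c : ℝ}
    (hc : ∀ i p, |F i p| ≤ c) :
    obs ρ T s (fun p => ∑ i ∈ I, F i p) = ∑ i ∈ I, obs ρ T s (F i) := by
  classical
  induction I using Finset.induction_on with
  | empty => simp [obs, pairInt]
  | insert i I hi ih =>
    simp only [Finset.sum_insert hi]
    rw [obs_add ρ hT s (hF i) (hc i) (Finset.measurable_sum _ fun i _ => hF i)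
      (c' := ∑ _i ∈ I, c) (fun p => (Finset.abs_sum_le_sum_abs _ _).trans
        (Finset.sum_le_sum fun i _ => hc i p)), ih]

section Assembly

variable {N M : ℕ} {Pu Pv : Measure ℝ} [IsProbabilityMeasure Pu] [IsProbabilityMeasure Pv]
  {f g : ℝ → ℝ} {Ku Kv : ℝ} {β b m δ D r lam : ℝ}

/-- The observable in the full system. -/
def fullObs (Pu Pv : Measure ℝ) {N M : ℕ} (lam : ℝ) (f g : ℝ → ℝ) (s : ℝ)
    (Q : Config N M × Config N M → ℝ) : ℂ :=
  obs (prior Pu Pv N M) (maskSignal lam f g Finset.univ Finset.univ) s Q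

/-- The overlap of the first components. -/
def fullU {N M : ℕ} (f : ℝ → ℝ) (p : Config N M × Config N M) : ℝ := sumU f Finset.univ p / N

/-- The overlap of the second components. -/
def fullV {N M : ℕ} (g : ℝ → ℝ) (p : Config N M × Config N M) : ℝ := sumV g Finset.univ p / N

theorem measurable_fullU (hf : IsCoord Pu f Ku) : Measurable (fullU (N := N) (M := M) f) :=
  (measurable_sumU hf _).div_const _

theorem measurable_fullV (hg : IsCoord Pv g Kv) : Measurable (fullV (N := N) (M := M) g) :=
  (measurable_sumV hg _).div_const _

theorem abs_fullU_le (hf : IsCoord Pu f Ku) (hN : (0 : ℝ) < N) (p : Config N M × Config N M) :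
    |fullU f p| ≤ Ku ^ 2 := by
  rw [fullU, abs_div, abs_of_pos hN, div_le_iff₀ hN, mul_comm]
  exact abs_sumU_le hf _ p

theorem abs_fullV_le (hg : IsCoord Pv g Kv) (hN : (0 : ℝ) < N) (p : Config N M × Config N M) :
    |fullV g p| ≤ M * Kv ^ 2 / N := by
  rw [fullV, abs_div, abs_of_pos hN]
  gcongr
  exact abs_sumV_le hg _ p

theorem abs_mul_le_mul {x y c d : ℝ} (hx : |x| ≤ c) (hy : |y| ≤ d) : |x * y| ≤ c * d := by
  rw [abs_mul]
  exact mul_le_mul hx hy (abs_nonneg _) ((abs_nonneg _).trans hx)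

theorem norm_fullObs_one_le (hf : IsCoord Pu f Ku) (hg : IsCoord Pv g Kv) (lam s : ℝ) :
    ‖fullObs Pu Pv (N := N) (M := M) lam f g s fun _ => 1‖ ≤ 1 := by
  have hT := measurable_maskSignal (N := N) (M := M) hf hg lam Finset.univ Finset.univ
  refine (norm_obs_le _ hT s measurable_const (c := 1) (by simp)).trans_eq ?_
  simp only [abs_one]
  exact nishimori_const _ hT 1

theorem norm_fullObs_le (hf : IsCoord Pu f Ku) (hg : IsCoord Pv g Kv) (lam s : ℝ)
    {Q : Config N M × Config N M → ℝ} (hQ : Measurable Q) {c : ℝ} (hc : ∀ p, |Q p| ≤ c) :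
    ‖fullObs Pu Pv lam f g s Q‖ ≤ c := by
  have hT := measurable_maskSignal (N := N) (M := M) hf hg lam Finset.univ Finset.univ
  refine (norm_obs_le _ hT s hQ hc).trans ?_
  refine (nishimori_mono _ hT (by fun_prop) (c := c) (by simpa using hc) measurable_const
    (c' := |c|) (by simp) hc).trans_eq ?_
  exact nishimori_const _ hT c

/-- An a priori bound on the unknown x, needed because replacing (M - 1)/N by α multiplies x by an
error of order N^{-1/2}. -/
theorem norm_fullObs_mul_le (hf : IsCoord Pu f Ku) (hg : IsCoord Pv g Kv)
    (R : Regime N M β Ku Kv b m δ D r lam) (s : ℝ) :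
    ‖(N : ℂ) * fullObs Pu Pv (N := N) (M := M) lam f g s fun p => fullU f p * fullV g p‖ ≤ m := by
  have hN := R.natCast_pos
  have hT := measurable_maskSignal (N := N) (M := M) hf hg lam Finset.univ Finset.univ
  have hU := measurable_fullU (N := N) (M := M) hf
  have hV := measurable_fullV (N := N) (M := M) hg
  have hUc := fun p => abs_fullU_le (M := M) hf hN p
  have hVc := fun p => abs_fullV_le (M := M) hg hN p
  have hsU := measurable_sumU (M := M) hf (Finset.univ : Finset (Fin N))
  have hsV := measurable_sumV (N := N) hg (Finset.univ : Finset (Fin M))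
  have e1 : (N : ℂ) * fullObs Pu Pv (N := N) (M := M) lam f g s (fun p => fullU f p * fullV g p) =
      obs (prior Pu Pv N M) (maskSignal lam f g Finset.univ Finset.univ) s
        (fun p => N * (fullU f p * fullV g p)) := by
    rw [obs_const_mul, fullObs]
    simp
  rw [e1]
  have hc : ∀ p : Config N M × Config N M, |N * (fullU f p * fullV g p)| ≤
      N * (Ku ^ 2 * (M * Kv ^ 2 / N)) := fun p => by
    rw [abs_mul, abs_of_pos hN]
    gcongr
    exact abs_mul_le_mul (hUc p) (hVc p)
  refine (norm_obs_le _ hT s (by fun_prop) hc).trans ?_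
  refine le_trans ?_ (nishimori_moment_le hf hg R Finset.univ Finset.univ (c := 1) (c' := 1)
    zero_le_one zero_le_one (by have : 0 ≤ β ^ 4 := by have := R.beta_nonneg; positivity
                                linarith))
  have b1 := fun p : Config N M × Config N M =>
    abs_sq_div_sq_le (abs_sumU_le hf Finset.univ p) hN
  have b2 := fun p : Config N M × Config N M =>
    abs_sq_div_sq_le (abs_sumV_le hg Finset.univ p) hN
  simp only [one_mul]
  refine nishimori_mono _ hT (by fun_prop) (c := N * (Ku ^ 2 * (M * Kv ^ 2 / N)))
    (fun p => by rw [abs_abs]; exact hc p) (by fun_prop)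
    (c' := 1 + (((N * Ku ^ 2) ^ 2 / N) ^ 2 + ((M * Kv ^ 2) ^ 2 / N) ^ 2)) (fun p => ?_) fun p => ?_
  · refine (abs_add_le _ _).trans (add_le_add (by simp) ((abs_add_le _ _).trans ?_))
    exact add_le_add (b1 p) (b2 p)
  · simp only [fullU, fullV]
    have e2 : |(N : ℝ) * (sumU f Finset.univ p / N * (sumV g Finset.univ p / N))| =
        |sumU f Finset.univ p| * |sumV g Finset.univ p| / N := by
      rw [abs_mul, abs_mul, abs_div, abs_div, abs_of_pos hN]
      field_simp
    rw [e2, ← sq_abs (sumU f Finset.univ p), ← sq_abs (sumV g Finset.univ p)]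
    set x := |sumU f Finset.univ p|
    set y := |sumV g Finset.univ p|
    have h1 : x * y / N ≤ (x ^ 2 / N + y ^ 2 / N) / 2 := by
      rw [← add_div, div_div, div_le_div_iff₀ hN (by positivity)]
      nlinarith [mul_nonneg hN.le (sq_nonneg (x - y))]
    nlinarith [sq_nonneg (x ^ 2 / N - 1), sq_nonneg (y ^ 2 / N - 1), sq_nonneg (x ^ 2 / N),
      sq_nonneg (y ^ 2 / N)]

/-- The N single-row estimates, each of order N^{-3/2}, are summed; the products u_i u_i' add up to
N R^u. -/
theorem norm_row_equation_le (hf : IsCoord Pu f Ku) (hg : IsCoord Pv g Kv)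
    (R : Regime N M β Ku Kv b m δ D r lam) (s : ℝ) :
    ‖(N : ℂ) * fullObs Pu Pv (N := N) (M := M) lam f g s (fun p => fullU f p * fullV g p) -
      β * ((N : ℂ) * fullObs Pu Pv (N := N) (M := M) lam f g s fun p => fullV g p * fullV g p)‖ ≤
      cavityConst s b Ku * m / r := by
  have hN := R.natCast_pos
  have hr := R.r_pos
  have hT := measurable_maskSignal (N := N) (M := M) hf hg lam Finset.univ Finset.univ
  have hU := measurable_fullU (N := N) (M := M) hf
  have hV := measurable_fullV (N := N) (M := M) hg
  have hfm := hf.measurable_coord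
  have hUc := fun p => abs_fullU_le (M := M) hf hN p
  have hVc := fun p => abs_fullV_le (M := M) hg hN p
  have hrow : ∀ i : Fin N, Measurable fun p : Config N M × Config N M =>
      (f (p.1.1 i) * f (p.2.1 i) - β * fullV g p) * fullV g p := fun i => by fun_prop
  have hsum := obs_finset_sum (prior Pu Pv N M) hT s Finset.univ hrow
    (c := (Ku ^ 2 + |β| * (M * Kv ^ 2 / N)) * (M * Kv ^ 2 / N)) fun i p =>
      abs_mul_le_mul ((abs_sub _ _).trans (add_le_add (hf.abs_mul_le _ _)
        (abs_mul_le_mul le_rfl (hVc p)))) (hVc p)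
  have hfun : (fun p : Config N M × Config N M =>
      ∑ i, (f (p.1.1 i) * f (p.2.1 i) - β * fullV g p) * fullV g p) =
      fun p => N * (fullU f p * fullV g p) + (-(β * N)) * (fullV g p * fullV g p) := by
    ext p
    rw [← Finset.sum_mul, Finset.sum_sub_distrib]
    have : ∑ i, f (p.1.1 i) * f (p.2.1 i) = N * fullU f p := by
      rw [fullU, mul_div_cancel₀ _ hN.ne']; rfl
    rw [this]
    simp
    ring
  rw [hfun, obs_add _ hT s (by fun_prop) (c := |(N : ℝ)| * (Ku ^ 2 * (M * Kv ^ 2 / N)))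
    (fun p => abs_mul_le_mul le_rfl (abs_mul_le_mul (hUc p) (hVc p))) (by fun_prop)
    (c' := |(-(β * N))| * ((M * Kv ^ 2 / N) * (M * Kv ^ 2 / N)))
    (fun p => abs_mul_le_mul le_rfl (abs_mul_le_mul (hVc p) (hVc p))),
    obs_const_mul, obs_const_mul] at hsum
  have heq : (N : ℂ) * fullObs Pu Pv (N := N) (M := M) lam f g s (fun p => fullU f p * fullV g p) -
      β * ((N : ℂ) * fullObs Pu Pv (N := N) (M := M) lam f g s fun p => fullV g p * fullV g p) =
      ∑ i, obs (prior Pu Pv N M) (maskSignal lam f g Finset.univ Finset.univ) s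
        (fun p => (f (p.1.1 i) * f (p.2.1 i) - β * fullV g p) * fullV g p) := by
    rw [← hsum, fullObs, fullObs]
    push_cast
    ring
  rw [heq]
  refine (norm_sum_le _ _).trans ?_
  calc _ ≤ ∑ _i : Fin N, cavityConst s b Ku * m / r ^ 3 :=
        Finset.sum_le_sum fun i _ => norm_obs_row_le hf hg R s i
    _ = r ^ 2 * (cavityConst s b Ku * m / r ^ 3) := by
        rw [R.r_sq]; simp
    _ = _ := by field_simp

/-- Summing v_j v_j' times the erased overlap gives N (R^v)² minus the diagonal (v_j v_j')²/N, whose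
replacement by 1/N produces the source term M/N. -/
theorem norm_col_equation_le (hf : IsCoord Pu f Ku) (hg : IsCoord Pv g Kv)
    (R : Regime N M β Ku Kv b m δ D r lam) (s : ℝ) :
    ‖(N : ℂ) * fullObs Pu Pv (N := N) (M := M) lam f g s (fun p => fullV g p * fullV g p) -
      (M / N : ℝ) * fullObs Pu Pv (N := N) (M := M) lam f g s (fun _ => 1) -
      (β * ((M - 1) / N) : ℝ) * ((N : ℂ) *
        fullObs Pu Pv (N := N) (M := M) lam f g s fun p => fullU f p * fullV g p)‖ ≤
      2 * (M / N) * (cavityConst s b Kv * m / r) := by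
  have hN := R.natCast_pos
  have hr := R.r_pos
  have hT := measurable_maskSignal (N := N) (M := M) hf hg lam Finset.univ Finset.univ
  have hU := measurable_fullU (N := N) (M := M) hf
  have hV := measurable_fullV (N := N) (M := M) hg
  have hgm := hg.measurable_coord
  have hUc := fun p => abs_fullU_le (M := M) hf hN p
  have hVc := fun p => abs_fullV_le (M := M) hg hN p
  have hVj := fun j : Fin M => measurable_sumV (N := N) hg (Finset.univ.erase j)
  have hVjc : ∀ (j : Fin M) (p : Config N M × Config N M),
      |sumV g (Finset.univ.erase j) p / N| ≤ M * Kv ^ 2 / N := fun j p => by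
    rw [abs_div, abs_of_pos hN]
    gcongr
    exact abs_sumV_le hg _ p
  set F : Fin M → Config N M × Config N M → ℝ := fun j p =>
    (g (p.1.2 j) * g (p.2.2 j) - β * fullU f p) * (sumV g (Finset.univ.erase j) p / N) with hF
  set G : Fin M → Config N M × Config N M → ℝ := fun j p =>
    (g (p.1.2 j) * g (p.2.2 j)) ^ 2 - 1 with hG
  have hFm : ∀ j, Measurable (F j) := fun j => by simp only [hF]; fun_prop
  have hGm : ∀ j, Measurable (G j) := fun j => by simp only [hG]; fun_prop
  have hFc : ∀ j p, |F j p| ≤ (Kv ^ 2 + |β| * Ku ^ 2) * (M * Kv ^ 2 / N) := fun j p =>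
    abs_mul_le_mul ((abs_sub _ _).trans (add_le_add (hg.abs_mul_le _ _)
        (abs_mul_le_mul le_rfl (hUc p)))) (hVjc j p)
  have hGc : ∀ j p, |G j p| ≤ (Kv ^ 2) ^ 2 + 1 := fun j p => by
    refine (abs_sub _ _).trans (add_le_add ?_ (by simp))
    rw [abs_pow]
    exact pow_le_pow_left₀ (abs_nonneg _) (hg.abs_mul_le _ _) 2
  have hsum := obs_finset_sum (prior Pu Pv N M) hT s Finset.univ
    (F := fun j p => F j p + (1 / N : ℝ) * G j p) (fun j => by fun_prop)
    (c := (Kv ^ 2 + |β| * Ku ^ 2) * (M * Kv ^ 2 / N) + |(1 / N : ℝ)| * ((Kv ^ 2) ^ 2 + 1))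
    fun j p => (abs_add_le _ _).trans (add_le_add (hFc j p) (abs_mul_le_mul le_rfl (hGc j p)))
  -- The squares in F and G/N cancel. The correction β R^u v_j v_j'/N from the erased site sums to β
  -- R^u R^v, which turns M into M - 1.
  have hfun : (fun p : Config N M × Config N M => ∑ j, (F j p + (1 / N : ℝ) * G j p)) =
      fun p => N * (fullV g p * fullV g p) + ((-(M / N : ℝ)) * 1 +
        (-(β * (M - 1))) * (fullU f p * fullV g p)) := by
    ext p
    have hV1 : ∑ j, g (p.1.2 j) * g (p.2.2 j) = N * fullV g p := by
      rw [fullV, mul_div_cancel₀ _ hN.ne']; rfl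
    have herase : ∀ j, sumV g (Finset.univ.erase j) p =
        N * fullV g p - g (p.1.2 j) * g (p.2.2 j) := fun j => by
      rw [← hV1, ← Finset.sum_erase_add _ _ (Finset.mem_univ j)]
      simp [sumV, IsCoord.siteSum]
    have hterm : ∀ j, F j p + (1 / N : ℝ) * G j p =
        (fullV g p + β * fullU f p / N) * (g (p.1.2 j) * g (p.2.2 j)) +
          (-(β * fullU f p * fullV g p) - 1 / N) := fun j => by
      simp only [hF, hG, herase]
      field_simp
      ring
    simp only [hterm]
    rw [Finset.sum_add_distrib, ← Finset.mul_sum, hV1]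
    simp only [Finset.sum_const, Finset.card_univ, Fintype.card_fin, nsmul_eq_mul]
    field_simp
    ring
  rw [hfun, obs_add _ hT s (by fun_prop) (c := |(N : ℝ)| * ((M * Kv ^ 2 / N) * (M * Kv ^ 2 / N)))
    (fun p => abs_mul_le_mul le_rfl (abs_mul_le_mul (hVc p) (hVc p))) (by fun_prop)
    (c' := |(-(M / N : ℝ))| * 1 + |(-(β * (M - 1)))| * (Ku ^ 2 * (M * Kv ^ 2 / N)))
    (fun p => (abs_add_le _ _).trans (add_le_add (abs_mul_le_mul le_rfl (by simp))
      (abs_mul_le_mul le_rfl (abs_mul_le_mul (hUc p) (hVc p))))),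
    obs_add _ hT s measurable_const (c := |(-(M / N : ℝ))| * 1)
      (fun p => abs_mul_le_mul le_rfl (by simp)) (by fun_prop)
      (c' := |(-(β * (M - 1)))| * (Ku ^ 2 * (M * Kv ^ 2 / N)))
      (fun p => abs_mul_le_mul le_rfl (abs_mul_le_mul (hUc p) (hVc p))),
    obs_const_mul, obs_const_mul _ _ _ (fun _ => 1), obs_const_mul] at hsum
  have hNC : (N : ℂ) ≠ 0 := by exact_mod_cast hN.ne'
  have heq : (N : ℂ) * fullObs Pu Pv (N := N) (M := M) lam f g s (fun p => fullV g p * fullV g p) -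
      (M / N : ℝ) * fullObs Pu Pv (N := N) (M := M) lam f g s (fun _ => 1) -
      (β * ((M - 1) / N) : ℝ) * ((N : ℂ) *
        fullObs Pu Pv (N := N) (M := M) lam f g s fun p => fullU f p * fullV g p) =
      ∑ j, obs (prior Pu Pv N M) (maskSignal lam f g Finset.univ Finset.univ) s
        (fun p => F j p + (1 / N : ℝ) * G j p) := by
    rw [← hsum, fullObs, fullObs, fullObs]
    push_cast
    field_simp
    ring
  rw [heq]
  refine (norm_sum_le _ _).trans ?_
  have hterm : ∀ j ∈ (Finset.univ : Finset (Fin M)),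
      ‖obs (prior Pu Pv N M) (maskSignal lam f g Finset.univ Finset.univ) s
        (fun p => F j p + (1 / N : ℝ) * G j p)‖ ≤ 2 * (cavityConst s b Kv * m / r ^ 3) := by
    intro j _
    obtain ⟨h1, h2⟩ := norm_obs_col_le hf hg R s j
    rw [obs_add _ hT s (hFm j) (hFc j) (by fun_prop) (c' := |(1 / N : ℝ)| * ((Kv ^ 2) ^ 2 + 1))
      (fun p => abs_mul_le_mul le_rfl (hGc j p)), obs_const_mul]
    refine (norm_add_le _ _).trans ?_
    rw [two_mul]
    refine add_le_add h1 ?_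
    rw [norm_mul, Complex.norm_real, Real.norm_of_nonneg (by positivity), ← R.r_sq]
    calc _ ≤ 1 / r ^ 2 * (cavityConst s b Kv * m / r) := by gcongr
      _ = _ := by field_simp
  calc _ ≤ ∑ _j : Fin M, 2 * (cavityConst s b Kv * m / r ^ 3) := Finset.sum_le_sum hterm
    _ = M * (2 * (cavityConst s b Kv * m / r ^ 3)) := by simp
    _ = _ := by
        rw [← R.r_sq]
        field_simp

/-- The limiting equation for the product of the overlaps, with an explicit error. -/
theorem norm_fullObs_sub_le (hf : IsCoord Pu f Ku) (hg : IsCoord Pv g Kv)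
    (R : Regime N M β Ku Kv b m δ D r lam) (s : ℝ) {α C A : ℝ} (hα : α * β ^ 2 < 1)
    (hM : |(M : ℝ) - α * N| ≤ C * r) (hA : (M : ℝ) ≤ A * N) (hr1 : 1 ≤ r) (hm : 0 ≤ m) :
    ‖(N : ℂ) * fullObs Pu Pv (N := N) (M := M) lam f g s (fun p => fullU f p * fullV g p) -
      (α * β / (1 - α * β ^ 2) : ℝ) *
        fullObs Pu Pv (N := N) (M := M) lam f g s (fun _ => 1)‖ ≤
      (cavityConst s b Ku * m + β * (2 * A * (cavityConst s b Kv * m)) + β * C +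
        β ^ 2 * (C + 1) * m) / (1 - α * β ^ 2) / r := by
  have hN := R.natCast_pos
  have hr := R.r_pos
  have hβ := R.beta_nonneg
  have hd : 0 < 1 - α * β ^ 2 := by linarith
  have hcv := cavityConst_nonneg s R.b_nonneg Kv
  have h1 := norm_row_equation_le hf hg R s
  have h2 := norm_col_equation_le hf hg R s
  have h3 := norm_fullObs_mul_le hf hg R s
  have h4 := norm_fullObs_one_le (N := N) (M := M) hf hg lam s
  set x := (N : ℂ) * fullObs Pu Pv (N := N) (M := M) lam f g s (fun p => fullU f p * fullV g p)
  set y := (N : ℂ) * fullObs Pu Pv (N := N) (M := M) lam f g s (fun p => fullV g p * fullV g p)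
  set a := fullObs Pu Pv (N := N) (M := M) lam f g s (fun _ => 1)
  have hMN : |(M : ℝ) / N - α| ≤ C / r := by
    have : (M : ℝ) / N - α = (M - α * N) / N := by field_simp
    rw [this, abs_div, abs_of_pos hN, div_le_div_iff₀ hN hr]
    rw [show C * (N : ℝ) = C * r * r by rw [← R.r_sq]; ring]
    gcongr
  have hMN1 : |((M : ℝ) - 1) / N - α| ≤ (C + 1) / r := by
    have : ((M : ℝ) - 1) / N - α = (M / N - α) - 1 / N := by ring
    rw [this, add_div]
    refine (abs_sub _ _).trans (add_le_add hMN ?_)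
    rw [abs_of_pos (by positivity), ← R.r_sq]
    gcongr
    nlinarith
  have hAN : (M : ℝ) / N ≤ A := (div_le_iff₀ hN).2 hA
  -- Elimination of y from the row and column equations, with the replacement of M/N and (M - 1)/N
  -- by α kept as explicit errors.
  have key : ((1 - α * β ^ 2 : ℝ) : ℂ) * (x - (α * β / (1 - α * β ^ 2) : ℝ) * a) =
      (x - β * y) + β * (y - (M / N : ℝ) * a - (β * ((M - 1) / N) : ℝ) * x) +
        (β * (M / N - α) : ℝ) * a + (β ^ 2 * ((M - 1) / N - α) : ℝ) * x := by
    have hd' : ((1 : ℂ) - α * β ^ 2) ≠ 0 := by exact_mod_cast hd.ne'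
    have hNC : (N : ℂ) ≠ 0 := by exact_mod_cast hN.ne'
    push_cast
    field_simp
    ring
  have hnorm : (1 - α * β ^ 2) * ‖x - (α * β / (1 - α * β ^ 2) : ℝ) * a‖ ≤
      cavityConst s b Ku * m / r + β * (2 * A * (cavityConst s b Kv * m / r)) +
        β * (C / r) * 1 + β ^ 2 * ((C + 1) / r) * m := by
    calc _ = ‖((1 - α * β ^ 2 : ℝ) : ℂ) * (x - (α * β / (1 - α * β ^ 2) : ℝ) * a)‖ := by
          rw [norm_mul, Complex.norm_real, Real.norm_of_nonneg hd.le]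
      _ ≤ _ := by
          rw [key]
          refine (norm_add_le _ _).trans (add_le_add ((norm_add_le _ _).trans (add_le_add
            ((norm_add_le _ _).trans (add_le_add h1 ?_)) ?_)) ?_)
          · rw [norm_mul, Complex.norm_real, Real.norm_of_nonneg hβ]
            gcongr
            exact h2.trans (by gcongr)
          · rw [norm_mul, Complex.norm_real, Real.norm_eq_abs, abs_mul, abs_of_nonneg hβ]
            have := (abs_nonneg _).trans hMN
            gcongr
          · rw [norm_mul, Complex.norm_real, Real.norm_eq_abs, abs_mul, abs_of_nonneg (sq_nonneg β)]
            have := (abs_nonneg _).trans hMN1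
            gcongr
  rw [le_div_iff₀ hr, le_div_iff₀ hd]
  calc _ = ((1 - α * β ^ 2) * ‖x - (α * β / (1 - α * β ^ 2) : ℝ) * a‖) * r := by ring
    _ ≤ (cavityConst s b Ku * m / r + β * (2 * A * (cavityConst s b Kv * m / r)) +
        β * (C / r) * 1 + β ^ 2 * ((C + 1) / r) * m) * r := by gcongr
    _ = _ := by field_simp

end Assembly

/-! ### Truncated coordinates -/

/-- Truncation to the interval `[-K, K]`. -/
def clip (K x : ℝ) : ℝ := max (-K) (min K x)

theorem measurable_clip (K : ℝ) : Measurable (clip K) := by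
  unfold clip
  fun_prop

theorem clip_of_abs_le {K x : ℝ} (h : |x| ≤ K) : clip K x = x := by
  rw [clip, min_eq_right (abs_le.1 h).2, max_eq_right (abs_le.1 h).1]

theorem IsPrior.clip_ae {P : Measure ℝ} {K : ℝ} (h : IsPrior P K) : ∀ᵐ x ∂P, clip K x = x :=
  h.bounded_support.mono fun _ => clip_of_abs_le

/-- The support condition holds almost surely, whereas the estimates use pointwise bounds.
Truncation supplies these without changing anything outside a null set. -/
theorem IsPrior.isCoord {P : Measure ℝ} {K : ℝ} (h : IsPrior P K) : IsCoord P (clip K) K := by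
  have := h.isProbabilityMeasure
  obtain ⟨x, hx⟩ := h.bounded_support.exists
  have hK : 0 ≤ K := (abs_nonneg x).trans hx
  refine ⟨measurable_clip K, fun e => abs_le.2 ⟨le_max_left _ _, max_le (by linarith)
    (min_le_left _ _)⟩, ?_, ?_⟩
  · rw [integral_congr_ae h.clip_ae, h.mean_zero]
  · have e : (fun x => clip K x ^ 2) =ᵐ[P] fun x => x ^ 2 :=
      h.clip_ae.mono fun x hx => by simp only [hx]
    rw [integral_congr_ae e, h.unit_variance]

/-! ### Translation of the spiked model -/

section Statement

variable {N M : ℕ} {Pu Pv : Measure ℝ} {Ku Kv : ℝ}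

/-- The signal of the spiked model. -/
def spike {N M : ℕ} (β : ℝ) (x : Config N M) : Fin N → Fin M → ℝ :=
  fun i j => √(β / N) * (x.1 i * x.2 j)

/-- The signal of the spiked model with truncated coordinates. -/
def clipSpike {N M : ℕ} (Ku Kv β : ℝ) : Config N M → Fin N → Fin M → ℝ :=
  maskSignal √(β / N) (clip Ku) (clip Kv) Finset.univ Finset.univ

theorem exp_negHamiltonian {β : ℝ} (hβ : 0 ≤ β) (Y : Fin N → Fin M → ℝ) (x : Config N M) :
    Real.exp (negHamiltonian β Y x) = tilt Y (spike β x) := by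
  rw [tilt, negHamiltonian, dot, dot, Finset.sum_div, ← Finset.sum_sub_distrib]
  congr 1
  refine Finset.sum_congr rfl fun i _ => ?_
  rw [Finset.sum_div, ← Finset.sum_sub_distrib]
  refine Finset.sum_congr rfl fun j _ => ?_
  have h : √(β / N) * √(β / N) = β / N := Real.mul_self_sqrt (by positivity)
  simp only [spike]
  calc _ = √(β / N) * Y i j * x.1 i * x.2 j - (β / N) * (x.1 i * x.2 j) ^ 2 / 2 := by ring
    _ = _ := by linear_combination ((x.1 i * x.2 j) ^ 2 / 2) * h

theorem prior_clip_ae (hu : IsPrior Pu Ku) (hv : IsPrior Pv Kv) :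
    ∀ᵐ x ∂prior Pu Pv N M, (∀ i, clip Ku (x.1 i) = x.1 i) ∧ ∀ j, clip Kv (x.2 j) = x.2 j := by
  have := hu.isProbabilityMeasure
  have := hv.isProbabilityMeasure
  have h1 : ∀ᵐ u ∂(Measure.pi fun _ : Fin N => Pu), ∀ i, clip Ku (u i) = u i :=
    ae_all_iff.2 fun i => (measurePreserving_eval (fun _ : Fin N => Pu) i).quasiMeasurePreserving.ae
      hu.clip_ae
  have h2 : ∀ᵐ v ∂(Measure.pi fun _ : Fin M => Pv), ∀ j, clip Kv (v j) = v j :=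
    ae_all_iff.2 fun j => (measurePreserving_eval (fun _ : Fin M => Pv) j).quasiMeasurePreserving.ae
      hv.clip_ae
  exact (Measure.quasiMeasurePreserving_fst.ae h1).and (Measure.quasiMeasurePreserving_snd.ae h2)

theorem clipSpike_eq {β : ℝ} {x : Config N M}
    (h : (∀ i, clip Ku (x.1 i) = x.1 i) ∧ ∀ j, clip Kv (x.2 j) = x.2 j) :
    clipSpike Ku Kv β x = spike β x := by
  ext i j
  simp [clipSpike, maskSignal, spike, h.1, h.2]

theorem measurable_clipSpike (hu : IsPrior Pu Ku) (hv : IsPrior Pv Kv) (β : ℝ) :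
    Measurable (clipSpike (N := N) (M := M) Ku Kv β) := by
  have := hu.isProbabilityMeasure
  have := hv.isProbabilityMeasure
  exact measurable_maskSignal hu.isCoord hv.isCoord _ _ _

/-- The spiked law is a mixture of shifted Gaussian laws; Cameron–Martin gives the density of each,
and the prior average of the densities is the partition function. -/
theorem spikedLaw_eq_withDensity (hu : IsPrior Pu Ku) (hv : IsPrior Pv Kv) (β : ℝ) :
    spikedLaw Pu Pv N M β = (noise N M).withDensity fun Y =>
      ENNReal.ofReal (partition (prior Pu Pv N M) (clipSpike Ku Kv β) Y) := by
  have := hu.isProbabilityMeasure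
  have := hv.isProbabilityMeasure
  have hT := measurable_clipSpike (N := N) (M := M) hu hv β
  have h1 : spikedLaw Pu Pv N M β = ((prior Pu Pv N M).prod (noise N M)).map
      fun p => p.2 + clipSpike Ku Kv β p.1 := by
    refine Measure.map_congr ?_
    filter_upwards [Measure.quasiMeasurePreserving_fst.ae (prior_clip_ae hu hv)] with p hp
    rw [clipSpike_eq hp, add_comm]
    rfl
  rw [h1]
  refine Measure.ext_of_lintegral _ fun f hf => ?_
  have h2 : ∀ Y, ENNReal.ofReal (partition (prior Pu Pv N M) (clipSpike Ku Kv β) Y) =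
      ∫⁻ x, ENNReal.ofReal (tilt Y (clipSpike Ku Kv β x)) ∂prior Pu Pv N M := fun Y =>
    ofReal_integral_eq_lintegral_ofReal (integrable_tilt _ hT Y)
      (Filter.Eventually.of_forall fun _ => (tilt_pos _ _).le)
  have h3 : Measurable fun Y => ENNReal.ofReal
      (partition (prior Pu Pv N M) (clipSpike Ku Kv β) Y) :=
    (measurable_partition _ hT).ennreal_ofReal
  rw [lintegral_withDensity_eq_lintegral_mul _ h3 hf, lintegral_map hf (by fun_prop),
    ← lintegral_prod_swap]
  have h4 := prod_withDensity_tilt (prior Pu Pv N M) hT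
  have h5 : ∫⁻ z, f z.1 ∂((noise N M).prod (prior Pu Pv N M)).map
      (fun p => (p.1 + clipSpike Ku Kv β p.2, p.2)) =
      ∫⁻ z, f (z.1 + clipSpike Ku Kv β z.2) ∂(noise N M).prod (prior Pu Pv N M) :=
    lintegral_map (by fun_prop) (by fun_prop)
  rw [← h4, lintegral_withDensity_eq_lintegral_mul _ (by fun_prop) (by fun_prop),
    lintegral_prod _ (by fun_prop)] at h5
  simp only [Prod.fst_swap, Prod.snd_swap]
  rw [← h5]
  refine lintegral_congr fun Y => ?_
  simp only [Pi.mul_apply, h2]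
  rw [lintegral_mul_const _ (by fun_prop)]

theorem spikedLaw_zero (hu : IsPrior Pu Ku) (hv : IsPrior Pv Kv) :
    spikedLaw Pu Pv N M 0 = noise N M := by
  have := hu.isProbabilityMeasure
  have := hv.isProbabilityMeasure
  rw [spikedLaw_eq_withDensity hu hv]
  have h0 : ∀ x : Config N M, clipSpike Ku Kv 0 x = 0 := fun x => by
    ext i j
    simp [clipSpike, maskSignal]
  simp [partition, h0]

theorem likelihoodRatio_ae (hu : IsPrior Pu Ku) (hv : IsPrior Pv Kv) (β : ℝ) :
    ∀ᵐ Y ∂noise N M, likelihoodRatio Pu Pv N M β Y =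
      partition (prior Pu Pv N M) (clipSpike Ku Kv β) Y := by
  have := hu.isProbabilityMeasure
  have := hv.isProbabilityMeasure
  have hT := measurable_clipSpike (N := N) (M := M) hu hv β
  have h3 : Measurable fun Y => ENNReal.ofReal
      (partition (prior Pu Pv N M) (clipSpike Ku Kv β) Y) :=
    (measurable_partition _ hT).ennreal_ofReal
  have h := Measure.rnDeriv_withDensity (noise N M) h3
  filter_upwards [h] with Y hY
  rw [likelihoodRatio, spikedLaw_zero hu hv, spikedLaw_eq_withDensity hu hv, hY,
    ENNReal.toReal_ofReal (partition_pos _ hT Y).le]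

theorem integral_spikedLaw (hu : IsPrior Pu Ku) (hv : IsPrior Pv Kv) (β : ℝ)
    (G : (Fin N → Fin M → ℝ) → ℂ) :
    ∫ Y, G Y ∂spikedLaw Pu Pv N M β =
      ∫ Y, partition (prior Pu Pv N M) (clipSpike Ku Kv β) Y • G Y ∂noise N M := by
  have := hu.isProbabilityMeasure
  have := hv.isProbabilityMeasure
  have hT := measurable_clipSpike (N := N) (M := M) hu hv β
  have h3 : Measurable fun Y => ENNReal.ofReal
      (partition (prior Pu Pv N M) (clipSpike Ku Kv β) Y) :=
    (measurable_partition _ hT).ennreal_ofReal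
  rw [spikedLaw_eq_withDensity hu hv, integral_withDensity_eq_integral_toReal_smul h3 (by simp)]
  simp only [ENNReal.toReal_ofReal (partition_pos _ hT _).le]

theorem gibbsAverage_overlap_eq (hu : IsPrior Pu Ku) (hv : IsPrior Pv Kv) {β : ℝ} (hβ : 0 ≤ β)
    (Y : Fin N → Fin M → ℝ) :
    gibbsAverage Pu Pv β Y (fun x : Fin 2 → Config N M =>
      overlapU (x 0) (x 1) * overlapV (x 0) (x 1)) =
      pairInt (prior Pu Pv N M) (clipSpike Ku Kv β) Y
        (fun p => fullU (clip Ku) p * fullV (clip Kv) p) /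
      partition (prior Pu Pv N M) (clipSpike Ku Kv β) Y ^ 2 := by
  have := hu.isProbabilityMeasure
  have := hv.isProbabilityMeasure
  have hae := prior_clip_ae (N := N) (M := M) hu hv
  have hden : ∫ x, Real.exp (negHamiltonian β Y x) ∂prior Pu Pv N M =
      partition (prior Pu Pv N M) (clipSpike Ku Kv β) Y := by
    refine integral_congr_ae ?_
    filter_upwards [hae] with x hx
    rw [exp_negHamiltonian hβ, clipSpike_eq hx]
  have hnum : ∫ x, overlapU (x 0) (x 1) * overlapV (x 0) (x 1) *
      ∏ l, Real.exp (negHamiltonian β Y (x l)) ∂(Measure.pi fun _ : Fin 2 => prior Pu Pv N M) =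
      pairInt (prior Pu Pv N M) (clipSpike Ku Kv β) Y
        (fun p => fullU (clip Ku) p * fullV (clip Kv) p) := by
    have hmp := measurePreserving_finTwoArrow (prior Pu Pv N M)
    have h1 := hmp.integral_comp' (g := fun p : Config N M × Config N M =>
      overlapU p.1 p.2 * overlapV p.1 p.2 *
        (Real.exp (negHamiltonian β Y p.1) * Real.exp (negHamiltonian β Y p.2)))
    rw [pairInt]
    refine Eq.trans ?_ (h1.trans ?_)
    · refine integral_congr_ae (Filter.Eventually.of_forall fun x => ?_)
      simp only [Fin.prod_univ_two]
      rfl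
    · refine integral_congr_ae ?_
      filter_upwards [Measure.quasiMeasurePreserving_fst.ae hae,
        Measure.quasiMeasurePreserving_snd.ae hae] with p h1 h2
      rw [exp_negHamiltonian hβ, exp_negHamiltonian hβ, pairWeight, clipSpike_eq h1,
        clipSpike_eq h2, mul_comm]
      congr 1
      simp only [overlapU, overlapV, fullU, fullV, sumU, sumV, IsCoord.siteSum, h1.1, h1.2, h2.1,
        h2.2]
  rw [gibbsAverage, hden, hnum]

/-- Passing to the noise law brings a factor L, which meets the L⁻² normalising two replicas and
leaves the weight L⁻¹ L^{is} of `obs`. -/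
theorem integral_gibbsAverage_eq (hu : IsPrior Pu Ku) (hv : IsPrior Pv Kv) {β : ℝ} (hβ : 0 ≤ β)
    (s : ℝ) :
    ∫ Y, (gibbsAverage Pu Pv β Y (fun x : Fin 2 → Config N M =>
      overlapU (x 0) (x 1) * overlapV (x 0) (x 1)) : ℂ) * expLogLR Pu Pv N M β s Y
        ∂spikedLaw Pu Pv N M β =
      fullObs Pu Pv √(β / N) (clip Ku) (clip Kv) s
        (fun p : Config N M × Config N M => fullU (clip Ku) p * fullV (clip Kv) p) := by
  have := hu.isProbabilityMeasure
  have := hv.isProbabilityMeasure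
  have hT := measurable_clipSpike (N := N) (M := M) hu hv β
  rw [integral_spikedLaw hu hv]
  refine integral_congr_ae ?_
  filter_upwards [likelihoodRatio_ae hu hv β] with Y hY
  have hpos := partition_pos (prior Pu Pv N M) hT Y
  rw [gibbsAverage_overlap_eq hu hv hβ, expLogLR, hY]
  simp only [clipSpike] at hpos ⊢
  set L := partition (prior Pu Pv N M)
    (maskSignal √(β / N) (clip Ku) (clip Kv) Finset.univ Finset.univ) Y
  have hL : (L : ℂ) ≠ 0 := by exact_mod_cast hpos.ne'
  rw [phaseFun, Complex.real_smul]
  push_cast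
  field_simp

theorem integral_expLogLR_eq (hu : IsPrior Pu Ku) (hv : IsPrior Pv Kv) (β s : ℝ) :
    ∫ Y, expLogLR Pu Pv N M β s Y ∂spikedLaw Pu Pv N M β =
      fullObs Pu Pv √(β / N) (clip Ku) (clip Kv) s (fun _ : Config N M × Config N M => 1) := by
  have := hu.isProbabilityMeasure
  have := hv.isProbabilityMeasure
  have hT := measurable_clipSpike (N := N) (M := M) hu hv β
  rw [integral_spikedLaw hu hv]
  refine integral_congr_ae ?_
  filter_upwards [likelihoodRatio_ae hu hv β] with Y hY
  have hpos := partition_pos (prior Pu Pv N M) hT Y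
  rw [expLogLR, hY, pairInt_const]
  simp only [clipSpike] at hpos ⊢
  set L := partition (prior Pu Pv N M)
    (maskSignal √(β / N) (clip Ku) (clip Kv) Finset.univ Finset.univ) Y
  have hL : (L : ℂ) ≠ 0 := by exact_mod_cast hpos.ne'
  rw [phaseFun, Complex.real_smul]
  push_cast
  field_simp

end Statement

/-! ### Uniformity in β and the choice of K(β) -/

section Uniform

/-- The assertion that `B` is an admissible error constant at the parameter `β`. -/
def IsErrorBound (s α Ku Kv C β B : ℝ) : Prop :=
  ∀ Pu Pv : Measure ℝ, IsPrior Pu Ku → IsPrior Pv Kv →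
    ∀ N M : ℕ, 1 ≤ N → 1 ≤ M → |(M : ℝ) - α * N| ≤ C * √(N : ℝ) →
      ‖(N : ℂ) * (∫ Y, (gibbsAverage Pu Pv β Y (fun x : Fin 2 → Config N M =>
          overlapU (x 0) (x 1) * overlapV (x 0) (x 1)) : ℂ) *
            expLogLR Pu Pv N M β s Y ∂(spikedLaw Pu Pv N M β)) -
          ((α * β / (1 - α * β ^ 2) : ℝ) : ℂ) *
            ∫ Y, expLogLR Pu Pv N M β s Y ∂(spikedLaw Pu Pv N M β)‖ ≤ B / √(N : ℝ)

set_option maxHeartbeats 1000000 in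
theorem exists_uniform_error_bound (s α Ku Kv C : ℝ) (hα : 0 ≤ α) (β' : ℝ) (hβ' : 0 ≤ β')
    (hsub : α * β' ^ 2 * Ku ^ 4 * Kv ^ 4 < 1) :
    ∃ B, 0 ≤ B ∧ ∀ β ∈ Set.Icc 0 β', IsErrorBound s α Ku Kv C β B := by
  -- Unit variance forces both support bounds to be at least one; otherwise no prior exists and any
  -- constant works.
  by_cases hK : 1 ≤ Ku ∧ 1 ≤ Kv
  swap
  · refine ⟨0, le_rfl, fun β _ Pu Pv hu hv => (hK ?_).elim⟩
    have := hu.isProbabilityMeasure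
    have := hv.isProbabilityMeasure
    exact ⟨hu.isCoord.one_le_bound, hv.isCoord.one_le_bound⟩
  obtain ⟨hKu, hKv⟩ := hK
  have hKK : 1 ≤ Ku ^ 4 * Kv ^ 4 := one_le_mul_of_one_le_of_one_le (one_le_pow₀ hKu)
    (one_le_pow₀ hKv)
  have hKu0 : 0 < Ku := zero_lt_one.trans_le hKu
  have hKv0 : 0 < Kv := zero_lt_one.trans_le hKv
  set Q := β' ^ 2 * (Ku ^ 4 * Kv ^ 4) with hQ
  have hQ0 : 0 ≤ Q := by positivity
  have hsub' : α * Q < 1 := by rw [hQ]; linarith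
  -- Half of the distance to the threshold is kept as the gap δ; the other half absorbs the
  -- deviation of M/N from α.
  set δ := (1 - α * Q) / 2 with hδ
  have hδ0 : 0 < δ := by rw [hδ]; linarith
  set A := α + |C| with hA
  have hA0 : 0 ≤ A := by positivity
  set D := Ku ^ 4 + A * Kv ^ 4 with hD
  have hD0 : 0 < D := by positivity
  set b := β' * (A * Kv ^ 2) + β' * Ku ^ 2 with hb
  have hb0 : 0 ≤ b := by positivity
  set m := 1 + (1 + β' ^ 4) * (1 + momentConst D δ) with hm
  have hmc := momentConst_nonneg hD0 hδ0
  have hm0 : 0 ≤ m := by positivity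
  -- From √N ≥ r₀ on, that deviation costs at most δ in the subcriticality condition.
  set r₀ := Q * |C| / δ with hr₀
  have hr₀0 : 0 ≤ r₀ := by positivity
  have hαβ' : α * β' ^ 2 < 1 := by
    have : α * β' ^ 2 * 1 ≤ α * β' ^ 2 * (Ku ^ 4 * Kv ^ 4) := by gcongr
    linarith
  have hd0 : 0 < 1 - α * β' ^ 2 := by linarith
  have hcu := cavityConst_nonneg s hb0 Ku
  have hcv := cavityConst_nonneg s hb0 Kv
  set B₁ := (cavityConst s b Ku * m + β' * (2 * A * (cavityConst s b Kv * m)) + β' * |C| +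
        β' ^ 2 * (|C| + 1) * m) / (1 - α * β' ^ 2) with hB₁
  have hB₁0 : 0 ≤ B₁ := by positivity
  -- The trivial bound for √N < r₀: N and the last factor √N are replaced by powers of r₀, and
  -- overlaps and phases by their maximal size.
  set B₂ := (r₀ ^ 2 * (Ku ^ 2 * (A * Kv ^ 2)) + α * β' / (1 - α * β' ^ 2)) * r₀ with hB₂
  have hB₂0 : 0 ≤ B₂ := by positivity
  refine ⟨B₁ + B₂, by positivity, ?_⟩
  rintro β ⟨hβ0, hββ'⟩ Pu Pv hu hv N M hN1 _ hMN
  have := hu.isProbabilityMeasure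
  have := hv.isProbabilityMeasure
  rw [integral_gibbsAverage_eq hu hv hβ0, integral_expLogLR_eq hu hv]
  have hN : (1 : ℝ) ≤ N := by exact_mod_cast hN1
  have hN0 : (0 : ℝ) < N := by linarith
  set r := √(N : ℝ) with hr
  have hr1 : 1 ≤ r := Real.one_le_sqrt.2 hN
  have hr0 : 0 < r := by linarith
  have hrsq : r ^ 2 = N := Real.sq_sqrt hN0.le
  have hMN' : |(M : ℝ) - α * N| ≤ |C| * r :=
    hMN.trans (mul_le_mul_of_nonneg_right (le_abs_self _) hr0.le)
  have hMle : (M : ℝ) ≤ α * N + |C| * r := by linarith [(abs_le.1 hMN').2]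
  have hMA : (M : ℝ) ≤ A * N := by
    have : |C| * r ≤ |C| * N := by
      gcongr
      rw [← hrsq]
      nlinarith
    rw [hA]
    linarith
  have hαβ : α * β ^ 2 ≤ α * β' ^ 2 := by gcongr
  have hcoef : α * β / (1 - α * β ^ 2) ≤ α * β' / (1 - α * β' ^ 2) := by
    gcongr
  have hcoef0 : 0 ≤ α * β / (1 - α * β ^ 2) := div_nonneg (by positivity) (by linarith)
  have hlam : √(β / N) ^ 2 = β / N := Real.sq_sqrt (by positivity)
  rcases le_or_gt r₀ r with hlarge | hsmall
  · have R : Regime N M β Ku Kv b m δ D r √(β / N) :=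
      { r_pos := hr0
        r_sq := hrsq
        beta_nonneg := hβ0
        lam_sq := hlam
        delta_pos := hδ0
        D_pos := hD0
        subcritical := by
          rw [hlam]
          have h1 : (β / N) ^ 2 * (N * Ku ^ 4 * (M * Kv ^ 4)) =
              β ^ 2 * (Ku ^ 4 * Kv ^ 4) * (M / N) := by
            field_simp
          have h2 : (M : ℝ) / N ≤ α + |C| / r := by
            rw [div_le_iff₀ hN0, add_mul]
            have : |C| / r * N = |C| * r := by rw [← hrsq]; field_simp
            linarith
          have h3 : Q * (|C| / r) ≤ δ := by
            rw [hr₀, div_le_iff₀ hδ0] at hlarge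
            rw [← mul_div_assoc, div_le_iff₀ hr0]
            linarith
          rw [h1]
          calc _ ≤ β' ^ 2 * (Ku ^ 4 * Kv ^ 4) * (α + |C| / r) := by gcongr
            _ = α * Q + Q * (|C| / r) := by rw [hQ]; ring
            _ ≤ 1 - δ := by rw [hδ] at h3 ⊢; linarith
        u_le := by
          have : 0 ≤ A * Kv ^ 4 * N := by positivity
          rw [hD]; linarith
        v_le := by
          have h1 : (M : ℝ) * Kv ^ 4 ≤ A * N * Kv ^ 4 := by gcongr
          have : 0 ≤ Ku ^ 4 * N := by positivity
          rw [hD]; linarith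
        row_le := by
          rw [hlam]
          calc β / N * (M * Kv ^ 2) ≤ β' / N * (A * N * Kv ^ 2) := by gcongr
            _ = β' * (A * Kv ^ 2) := by field_simp
            _ ≤ b := le_add_of_nonneg_right (by positivity)
        col_le := by
          rw [hlam]
          calc β / N * (N * Ku ^ 2) ≤ β' / N * (N * Ku ^ 2) := by gcongr
            _ = β' * Ku ^ 2 := by field_simp
            _ ≤ b := le_add_of_nonneg_left (by positivity)
        moment_le := by rw [hm]; gcongr }
    refine (norm_fullObs_sub_le hu.isCoord hv.isCoord R s (hαβ.trans_lt hαβ') hMN' hMA hr1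
      hm0).trans ?_
    refine div_le_div_of_nonneg_right (le_trans ?_ (le_add_of_nonneg_right hB₂0)) hr0.le
    rw [hB₁]
    gcongr
  · have hU := measurable_fullU (N := N) (M := M) hu.isCoord
    have hV := measurable_fullV (N := N) (M := M) hv.isCoord
    have h1 := norm_fullObs_le hu.isCoord hv.isCoord √(β / N) s
      (Q := fun p : Config N M × Config N M => fullU (clip Ku) p * fullV (clip Kv) p)
      (by fun_prop) fun p => abs_mul_le_mul (abs_fullU_le hu.isCoord hN0 p)
        (abs_fullV_le hv.isCoord hN0 p)
    have h2 := norm_fullObs_one_le (N := N) (M := M) hu.isCoord hv.isCoord √(β / N) s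
    have h3 : (M : ℝ) * Kv ^ 2 / N ≤ A * Kv ^ 2 := by
      rw [div_le_iff₀ hN0]
      calc (M : ℝ) * Kv ^ 2 ≤ A * N * Kv ^ 2 := by gcongr
        _ = _ := by ring
    have h4 := h1.trans (mul_le_mul_of_nonneg_left h3 (sq_nonneg Ku))
    have hNle : (N : ℝ) ≤ r₀ ^ 2 := hrsq ▸ pow_le_pow_left₀ hr0.le hsmall.le 2
    have h5 := mul_le_mul hNle h4 (norm_nonneg _) (sq_nonneg r₀)
    have h6 := mul_le_mul hcoef h2 (norm_nonneg _) (hcoef0.trans hcoef)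
    rw [mul_one] at h6
    refine (norm_sub_le _ _).trans ?_
    rw [norm_mul, norm_mul, Complex.norm_real, Real.norm_of_nonneg hcoef0, Complex.norm_natCast,
      le_div_iff₀ hr0]
    have h7 := mul_le_mul (add_le_add h5 h6) hsmall.le hr0.le
      (add_nonneg (by positivity) (hcoef0.trans hcoef))
    exact h7.trans (le_add_of_nonneg_left hB₁0)

end Uniform

end SpikedModel

end

theorem mainTheorem3 (s α Ku Kv C : ℝ) (hα : 0 ≤ α) :
    ∃ K : ℝ → ℝ,
      (∀ β' : ℝ, 0 ≤ β' → α * β' ^ 2 * Ku ^ 4 * Kv ^ 4 < 1 →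
        ∃ B : ℝ, ∀ β ∈ Set.Icc 0 β', |K β| ≤ B) ∧
      ∀ β : ℝ, 0 ≤ β → α * β ^ 2 * Ku ^ 4 * Kv ^ 4 < 1 →
        ∀ Pu Pv : Measure ℝ, SpikedModel.IsPrior Pu Ku → SpikedModel.IsPrior Pv Kv →
          ∀ N M : ℕ, 1 ≤ N → 1 ≤ M → |(M : ℝ) - α * N| ≤ C * √(N : ℝ) →
            ‖(N : ℂ) * (∫ Y, (SpikedModel.gibbsAverage Pu Pv β Y
                    (fun x : Fin 2 → SpikedModel.Config N M =>
                      SpikedModel.overlapU (x 0) (x 1) * SpikedModel.overlapV (x 0) (x 1)) : ℂ) *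
                  SpikedModel.expLogLR Pu Pv N M β s Y ∂(SpikedModel.spikedLaw Pu Pv N M β)) -
                ((α * β / (1 - α * β ^ 2) : ℝ) : ℂ) *
                  ∫ Y, SpikedModel.expLogLR Pu Pv N M β s Y ∂(SpikedModel.spikedLaw Pu Pv N M β)‖
              ≤ K β / √(N : ℝ) := by
  -- Taking the smallest admissible constant at each β makes K independent of β', so every uniform
  -- bound on [0, β'] is also a bound for K there.
  refine ⟨fun β => sInf {B | 0 ≤ B ∧ SpikedModel.IsErrorBound s α Ku Kv C β B}, ?_, ?_⟩
  · intro β' hβ' hsub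
    obtain ⟨B, hB0, hB⟩ := SpikedModel.exists_uniform_error_bound s α Ku Kv C hα β' hβ' hsub
    refine ⟨B, fun β hβ => ?_⟩
    rw [abs_of_nonneg (Real.sInf_nonneg fun x hx => hx.1)]
    exact csInf_le ⟨0, fun x hx => hx.1⟩ ⟨hB0, hB β hβ⟩
  · intro β hβ hsub Pu Pv hu hv N M hN hM hMN
    obtain ⟨B, hB0, hB⟩ := SpikedModel.exists_uniform_error_bound s α Ku Kv C hα β hβ hsub
    have hr : 0 < √(N : ℝ) := Real.sqrt_pos.2 (by exact_mod_cast hN)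
    rw [le_div_iff₀ hr]
    -- The infimum is itself admissible, because the left side is a lower bound of all admissible
    -- constants.
    refine le_csInf ⟨B, hB0, hB β ⟨hβ, le_rfl⟩⟩ fun x hx => ?_
    rw [← le_div_iff₀ hr]
    exact hx.2 Pu Pv hu hv N M hN hM hMN
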